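/- Fix $T>0$ and let the set of players be $\Omega=[0,1]$ with Lebesgue measure. A (scalar, deterministic) mean field game is given by data $(f,L,\psi,\phi,\bar x)$, where $f,L:[0,T]\times\mathbb R^3\to\mathbb R$, $\psi:\mathbb R\to\mathbb R$, $\phi:[0,T]\times\mathbb R\to\mathbb R$ and $\bar x:\Omega\to\mathbb R$. Given $\eta\in\mathcal C([0,T])$, player $\xi$ minimizes $$\int_0^T L\bigl(t,x(t),u(t),\eta(t)\bigr)\,dt+\psi(x(T))\quad\text{subject to}\quad \dot x=f(t,x,u,\eta),\quad x(0)=\bar x(\xi),$$ over measurable controls $u:[0,T]\to\mathbb R$. * The moment of a family of trajectories $x(\cdot,\xi)$, $\xi\in\Omega$, is $\eta(t)=\int_\Omega\phi(t,x(t,\xi))\,d\xi$. A *solution* of the game is a family $x\in L^1(\Omega;\mathcal C([0,T]))$ such that, with $\eta$ the moment of $x$, for a.e. $\xi$ the trajectory $x(\cdot,\xi)$ (with some control $u(\cdot,\xi)$) is optimal for player $\xi$. * The (multivalued) best reply map $\Phi$ on $\mathcal C([0,T])$ sends $\eta$ to the set of the moments of all families $x\in L^1(\Omega;\mathcal C([0,T]))$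 for which $x(\cdot,\xi)$ is optimal, given $\eta$, for a.e. player $\xi$. * A solution with moment $\eta^*$ is *stable* if for every $\varepsilon>0$ there is $\delta>0$ such that every sequence with $\|\eta^{(0)}-\eta^*\|_{\mathcal C^0}<\delta$ and $\eta^{(k)}\in\Phi(\eta^{(k-1)})$ for all $k\ge1$ satisfies $\|\eta^{(k)}-\eta^*\|_{\mathcal C^0}<\varepsilon$ for all $k\geq 1$. Otherwise it is *unstable*. * A solution $x$ is *structurally stable* if for every $\varepsilon>0$ there is $\delta>0$ such that every game $(f^\dagger,L^\dagger,\psi^\dagger,\phi^\dagger,\bar x^\dagger)$ with $f^\dagger,L^\dagger,\psi^\dagger,\phi^\dagger$ of class $\mathcal C^2$, $\bar x^\dagger$ measurable, $$\max\bigl\{\|f^\dagger-f\|_{\mathcal C^2},\|L^\dagger-L\|_{\mathcal C^2},\|\psi^\dagger-\psi\|_{\mathcal C^2},\|\phi^\dagger-\phi\|_{\mathcal C^2}\bigr\}<\delta,\qquad \|\bar x^\dagger-\bar x\|_{L^\infty}<\delta$$ (the $\mathcal C^2$ norms being taken over the whole domains of the functions) has a solution $x^\dagger$ with $\sup_{t\in[0,T]}\int_\Omega|x^\dagger(t,\xi)-x(t,\xi)|\,d\xi<\varepsilon$.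 **Proposition.** Let $\kappa>1$ and $T>2$, and consider the game in which every player minimizes $$\int_0^T\Bigl[|u(t)|^2+\frac1{1+x^2(t)}+\kappa\,|x(t)-b(t)|^2\Bigr]dt,\qquad \dot x=u,\quad x(0,\xi)=0\ \text{ for all }\xi\in[0,1],$$ where $b(t)=\int_0^1x(t,\xi)\,d\xi$ is the barycenter of the players, i.e. $f=u$, $L=|u|^2+\frac{1}{1+x^2}+\kappa|x-\eta|^2$, $\psi=0$, $\phi(t,x)=x$, $\bar x=0$. 1. The game has at least three solutions, of the form $x_i(t,\xi)=y_i(t)$, $i=0,1,2$, with $y_0=0$, $y_1$ strictly increasing on $[0,T]$, and $y_2=-y_1$. 2. The zero solution $x_0$ is unstable. If $T\neq\frac{(2n-1)\pi}2$ for every integer $n\ge1$, it is structurally stable. 3. Both $x_1$ and $x_2$ are stable and structurally stable. -/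

import Mathlib

open MeasureTheory Set

noncomputable section

namespace MFG

/-- The time interval `[0, T]`. -/
abbrev Time (T : ℝ) : Type := Set.Icc (0 : ℝ) T

/-- Integrals over `[0, T]` are taken with respect to Lebesgue measure. -/
instance (T : ℝ) : MeasureSpace (Time T) := Measure.Subtype.measureSpace

/-- `𝒞([0, T]; ℝ)` with the supremum norm. -/
abbrev Path (T : ℝ) : Type := C(Time T, ℝ)

/-- The space of players: `[0, 1]` with Lebesgue measure. -/
abbrev Player : Type := unitInterval

/-- The data `(f, L, ψ, φ, x̄)` of a deterministic first order mean field game on `[0, T]` with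
scalar states, scalar controls and a single moment `η`.  Player `ξ` minimizes
`∫₀ᵀ L(t, x, u, η) dt + ψ(x(T))` subject to `ẋ = f(t, x, u, η)`, `x(0) = x̄(ξ)`, where
`η(t) = ∫ φ(t, x(t, ξ)) dξ`. -/
structure ScalarGame (T : ℝ) where
  /-- the horizon is nonnegative -/
  T_nonneg : 0 ≤ T
  /-- the dynamics `f(t, x, u, η)` -/
  f : ℝ → ℝ → ℝ → ℝ → ℝ
  /-- the running cost `L(t, x, u, η)` -/
  L : ℝ → ℝ → ℝ → ℝ → ℝ
  /-- the terminal cost `ψ(x)` -/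
  ψ : ℝ → ℝ
  /-- the function `φ(t, x)` defining the moment -/
  φ : ℝ → ℝ → ℝ
  /-- the initial datum `x̄(ξ)` -/
  xinit : Player → ℝ

namespace ScalarGame

variable {T : ℝ}

/-- The pair (trajectory `x`, control `u`) is admissible for the control problem with given moment
`η` and initial point `a`: the control is measurable, `x` is the Carathéodory solution of
`ẋ = f(t, x, u, η)`, `x(0) = a`, and the running cost is integrable. -/
structure IsAdmissible (G : ScalarGame T) (η : Path T) (a : ℝ) (x : Path T) (u : Time T → ℝ) :
    Prop where
  control_measurable : AEMeasurable u volume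
  velocity_integrable : Integrable (fun s : Time T => G.f s (x s) (u s) (η s)) volume
  trajectory : ∀ t : Time T, x t = a + ∫ s in Set.Iic t, G.f s (x s) (u s) (η s)
  cost_integrable : Integrable (fun s : Time T => G.L s (x s) (u s) (η s)) volume

/-- The cost `∫₀ᵀ L(t, x, u, η) dt + ψ(x(T))`. -/
def cost (G : ScalarGame T) (η x : Path T) (u : Time T → ℝ) : ℝ :=
  (∫ s : Time T, G.L s (x s) (u s) (η s)) + G.ψ (x ⟨T, G.T_nonneg, le_rfl⟩)

/-- `(x, u)` is an optimal pair for the control problem with given `η` and initial point `a`. -/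
def IsOptimal (G : ScalarGame T) (η : Path T) (a : ℝ) (x : Path T) (u : Time T → ℝ) : Prop :=
  G.IsAdmissible η a x u ∧
    ∀ (x' : Path T) (u' : Time T → ℝ), G.IsAdmissible η a x' u' → G.cost η x u ≤ G.cost η x' u'

/-- `η` is the (well defined) moment of the family of trajectories `x`:
`η(t) = ∫ φ(t, x(t, ξ)) dξ`. -/
def IsMoment (G : ScalarGame T) (x : Player → Path T) (η : Path T) : Prop :=
  ∀ t : Time T, Integrable (fun ξ : Player => G.φ t (x ξ t)) volume ∧
    η t = ∫ ξ : Player, G.φ t (x ξ t)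

/-- `x` is a strong solution of the game: `x ∈ L¹(Ω; 𝒞([0, T]))` and, together with some
controls `u(·, ξ)`, it is optimal for a.e. player `ξ`, the moment `η` being that of `x`. -/
def IsSolution (G : ScalarGame T) (x : Player → Path T) : Prop :=
  Integrable x volume ∧ ∃ (u : Player → Time T → ℝ) (η : Path T), G.IsMoment x η ∧
    ∀ᵐ ξ : Player, G.IsOptimal η (G.xinit ξ) (x ξ) (u ξ)

/-- The multivalued best reply map `Φ` on `𝒞([0, T])`: the moments of all families of
optimal trajectories for the given `η`. -/
def bestReply (G : ScalarGame T) (η : Path T) : Set (Path T) :=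
  {η' | ∃ (x : Player → Path T) (u : Player → Time T → ℝ), Integrable x volume ∧
    (∀ᵐ ξ : Player, G.IsOptimal η (G.xinit ξ) (x ξ) (u ξ)) ∧ G.IsMoment x η'}

end ScalarGame

/-- `p` is a (Lyapunov) stable fixed point of the multivalued map `Φ`. -/
def IsStableFixedPoint {E : Type*} [NormedAddCommGroup E] (Φ : E → Set E) (p : E) : Prop :=
  p ∈ Φ p ∧ ∀ ε > 0, ∃ δ > 0, ∀ η : ℕ → E, ‖η 0 - p‖ < δ → (∀ k ≥ 1, η k ∈ Φ (η (k - 1))) →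
    ∀ k ≥ 1, ‖η k - p‖ < ε

/-- `g` is of class `𝒞²` on `S` and `‖g - h‖_{𝒞²(S)} < δ`, the norm being the largest of the suprema
over `S` of the norms of the derivatives of order `0`, `1`, `2`. -/
def IsC2Near {E : Type*} [NormedAddCommGroup E] [NormedSpace ℝ E] (S : Set E) (g h : E → ℝ)
    (δ : ℝ) : Prop :=
  ContDiffOn ℝ 2 g S ∧ ∃ r < δ, ∀ k ≤ 2, ∀ z ∈ S,
    ‖iteratedFDerivWithin ℝ k (fun w => g w - h w) S z‖ ≤ r

namespace ScalarGame

variable {T : ℝ}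

/-- A solution is stable if its moment is a stable fixed point of the best reply map. -/
def IsStable (G : ScalarGame T) (x : Player → Path T) : Prop :=
  ∃ η : Path T, G.IsMoment x η ∧ IsStableFixedPoint G.bestReply η

/-- The data of `G'` are `δ`-close to those of `G`: in `𝒞²` for `f, L, ψ, φ` (on
`[0, T] × ℝ³`, `[0, T] × ℝ³`, `ℝ`, `[0, T] × ℝ` respectively) and in `L^∞` for the initial datum. -/
structure IsNear (G G' : ScalarGame T) (δ : ℝ) : Prop where
  f_near : IsC2Near (Set.Icc (0 : ℝ) T ×ˢ (Set.univ : Set (ℝ × ℝ × ℝ)))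
    (fun z => G'.f z.1 z.2.1 z.2.2.1 z.2.2.2) (fun z => G.f z.1 z.2.1 z.2.2.1 z.2.2.2) δ
  L_near : IsC2Near (Set.Icc (0 : ℝ) T ×ˢ (Set.univ : Set (ℝ × ℝ × ℝ)))
    (fun z => G'.L z.1 z.2.1 z.2.2.1 z.2.2.2) (fun z => G.L z.1 z.2.1 z.2.2.1 z.2.2.2) δ
  ψ_near : IsC2Near Set.univ G'.ψ G.ψ δ
  φ_near : IsC2Near (Set.Icc (0 : ℝ) T ×ˢ (Set.univ : Set ℝ))
    (fun z => G'.φ z.1 z.2) (fun z => G.φ z.1 z.2) δ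
  xinit_measurable : AEMeasurable G'.xinit volume
  xinit_near : eLpNorm (fun ξ => G'.xinit ξ - G.xinit ξ) ⊤ volume < ENNReal.ofReal δ

/-- The solution `x` of `G` is structurally stable (essential): every game sufficiently close to
`G` has a solution `x'` with `sup_t ∫ |x'(t, ξ) - x(t, ξ)| dξ < ε`. -/
def IsStructurallyStable (G : ScalarGame T) (x : Player → Path T) : Prop :=
  ∀ ε > 0, ∃ δ > 0, ∀ G' : ScalarGame T, G.IsNear G' δ →
    ∃ x' : Player → Path T, G'.IsSolution x' ∧
      (⨆ t : Time T, ∫ ξ : Player, |x' ξ t - x ξ t|) < ε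

end ScalarGame

/-- The game with cost `∫₀ᵀ |u|² + 1/(1+x²) + κ|x - b|² dt`, dynamics `ẋ = u`, `x(0) = 0`, where
`b(t) = ∫ x(t, ξ) dξ` is the barycenter. -/
def barycenterGame (κ T : ℝ) (hT : 0 ≤ T) : ScalarGame T where
  T_nonneg := hT
  f _ _ u _ := u
  L _ x u b := |u| ^ 2 + 1 / (1 + x ^ 2) + κ * |x - b| ^ 2
  ψ _ := 0
  φ _ x := x
  xinit _ := 0

end MFG

end

noncomputable section

namespace MFG

variable {T : ℝ}

/-! For a frozen moment `η` the Euler-Lagrange equation is `-x'' = x/(1+x²)² + κ(η - x)`, `x(0) =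
0`, `x'(T) = 0`, an integral equation for the Green operator `green`. The nonlinearity `force` is
1-Lipschitz and `κ > 1`, so the player's problem is strictly convex in the state: `exists_reply` and
`IsReply.unique` give exactly one solution, and `IsExtremal.cost_gain` shows that it is the only
optimal trajectory. All players start at 0, so the best reply map is single-valued
(`mem_bestReply_iff`). By the maximum principle it is also monotone, with sub- and supersolutions
available. Its fixed points solve `y = green (force y)`, an equation without `κ`.

Since `T > π/2`, the first mode `sin(πt/2T)` has frequency below 1, and small multiples of it are
multiplied by at least some `l > 1` under reply (`exists_growth`). This makes 0 unstable, and
monotone iteration from such a multiple produces a positive equilibrium `y`. As `force z / z`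
decreases for `z > 0`, `l y` is a supersolution for `l ≥ 1` and a subsolution for `0 ≤ l ≤ 1`. The
order intervals around `y` are therefore invariant under reply, which gives stability. Oddness of
`force` transfers everything to `-y`.

Structural stability follows from nondegeneracy: `x = green (force'(y) x)` has only the zero
solution. At 0 this says `cos T ≠ 0`; at `y` it is a Sturm comparison based on `force'(z) z < force
z`. For a perturbed game, players are parametrized by their initial point in a compact interval, and
the Pontryagin systems of all of them, coupled through the averaged moment, are solved together by a
quantitative inverse function argument (`exists_coupled_solution`). The extremals found are optimal
because the convexity survives small perturbations (`IsExtremal.isOptimal`). -/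

/-! ### Integration over the time interval. -/

theorem measurableEmbedding_time : MeasurableEmbedding (Subtype.val : Time T → ℝ) :=
  MeasurableEmbedding.subtype_coe measurableSet_Icc

theorem volume_time_apply (A : Set (Time T)) :
    (volume : Measure (Time T)) A = volume ((↑) '' A : Set ℝ) :=
  measurableEmbedding_time.comap_apply _ _

instance : IsFiniteMeasure (volume : Measure (Time T)) :=
  ⟨by rw [volume_time_apply, image_univ, Subtype.range_coe]; exact measure_Icc_lt_top⟩

instance : NullSingletonClass (volume : Measure (Time T)) :=
  ⟨fun t => by rw [volume_time_apply, image_singleton]; exact measure_singleton _⟩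

theorem volume_real_univ (hT : 0 ≤ T) : (volume : Measure (Time T)).real univ = T := by
  rw [Measure.real, volume_time_apply, image_univ, Subtype.range_coe, Real.volume_Icc]
  simp [hT]

theorem volume_real_Ioc {s t : Time T} (h : s ≤ t) :
    (volume : Measure (Time T)).real (Ioc s t) = t - s := by
  have : ((↑) '' Ioc s t : Set ℝ) = Ioc (s : ℝ) t := by
    ext z
    constructor
    · rintro ⟨w, hw, rfl⟩; exact hw
    · intro hz; exact ⟨⟨z, s.2.1.trans hz.1.le, hz.2.trans t.2.2⟩, hz, rfl⟩
  rw [Measure.real, volume_time_apply, this, Real.volume_Ioc]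
  exact ENNReal.toReal_ofReal (sub_nonneg.2 h)

theorem integrable_path (v : Path T) : Integrable v (volume : Measure (Time T)) := by
  exact Integrable.of_bound v.continuous.aestronglyMeasurable ‖v‖
    (Filter.Eventually.of_forall v.norm_coe_le_norm)

theorem setIntegral_Iic_sub {v : Time T → ℝ} (hv : Integrable v volume) {s t : Time T}
    (h : s ≤ t) : (∫ r in Iic t, v r) - ∫ r in Iic s, v r = ∫ r in Ioc s t, v r := by
  rw [← Iic_union_Ioc_eq_Iic h, setIntegral_union (Iic_disjoint_Ioc le_rfl) measurableSet_Ioc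
    hv.integrableOn hv.integrableOn]
  ring

theorem setIntegral_Ici {v : Time T → ℝ} (hv : Integrable v volume) (t : Time T) :
    ∫ r in Ici t, v r = (∫ r, v r) - ∫ r in Iic t, v r := by
  rw [← setIntegral_congr_set Ioi_ae_eq_Ici, ← compl_Iic, ← integral_add_compl measurableSet_Iic hv]
  ring

theorem abs_setIntegral_Ioc_le (v : Path T) {s t : Time T} (h : s ≤ t) :
    |∫ r in Ioc s t, v r| ≤ ‖v‖ * (t - s) := by
  rw [← volume_real_Ioc h]
  exact norm_setIntegral_le_of_norm_le_const (measure_lt_top _ _) fun r _ => v.norm_coe_le_norm r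

theorem lipschitz_setIntegral_Iic (v : Path T) :
    LipschitzWith ‖v‖₊ fun t : Time T => ∫ r in Iic t, v r := by
  refine LipschitzWith.of_dist_le_mul fun t s => ?_
  rw [Real.dist_eq, Subtype.dist_eq, Real.dist_eq, coe_nnnorm]
  rcases le_total s t with h | h
  · rw [setIntegral_Iic_sub (integrable_path v) h, abs_of_nonneg (sub_nonneg.2 h : (0 : ℝ) ≤ t - s)]
    exact abs_setIntegral_Ioc_le v h
  · rw [abs_sub_comm, setIntegral_Iic_sub (integrable_path v) h, abs_sub_comm (t : ℝ),
      abs_of_nonneg (sub_nonneg.2 h : (0 : ℝ) ≤ s - t)]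
    exact abs_setIntegral_Ioc_le v h

/-! ### Forward and backward primitives, the Green operator, the Fredholm alternative. -/

/-- The total length of the time interval. -/
def len (T : ℝ) : ℝ := (volume : Measure (Time T)).real univ

theorem len_nonneg : 0 ≤ len T := measureReal_nonneg

theorem len_eq (hT : 0 ≤ T) : len T = T := volume_real_univ hT

theorem abs_setIntegral_le (v : Path T) (A : Set (Time T)) : |∫ r in A, v r| ≤ len T * ‖v‖ := by
  have h := norm_setIntegral_le_of_norm_le_const (μ := (volume : Measure (Time T)))
    (measure_lt_top _ A) fun r _ => v.norm_coe_le_norm r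
  rw [mul_comm]
  exact h.trans (mul_le_mul_of_nonneg_left (measureReal_mono (subset_univ A)) (norm_nonneg v))

/-- The primitive `t ↦ ∫₀ᵗ v`. -/
def fwd (T : ℝ) : Path T →L[ℝ] Path T :=
  LinearMap.mkContinuous
    { toFun := fun v => ⟨fun t => ∫ r in Iic t, v r, (lipschitz_setIntegral_Iic v).continuous⟩
      map_add' := fun v w => by
        ext t
        exact integral_add (integrable_path v).integrableOn (integrable_path w).integrableOn
      map_smul' := fun c v => by
        ext t
        exact integral_const_mul c v }
    (len T) fun v => (ContinuousMap.norm_le _ (mul_nonneg len_nonneg (norm_nonneg v))).2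
      fun t => abs_setIntegral_le v _

theorem fwd_apply (v : Path T) (t : Time T) : fwd T v t = ∫ r in Iic t, v r := rfl

/-- The backward primitive `t ↦ ∫ₜᵀ v`. -/
def bwd (T : ℝ) : Path T →L[ℝ] Path T :=
  LinearMap.mkContinuous
    { toFun := fun v => ⟨fun t => ∫ r in Ici t, v r, by
        simp only [setIntegral_Ici (integrable_path v)]
        exact continuous_const.sub (lipschitz_setIntegral_Iic v).continuous⟩
      map_add' := fun v w => by
        ext t
        exact integral_add (integrable_path v).integrableOn (integrable_path w).integrableOn
      map_smul' := fun c v => by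
        ext t
        exact integral_const_mul c v }
    (len T) fun v => (ContinuousMap.norm_le _ (mul_nonneg len_nonneg (norm_nonneg v))).2
      fun t => abs_setIntegral_le v _

theorem bwd_apply (v : Path T) (t : Time T) : bwd T v t = ∫ r in Ici t, v r := rfl

theorem norm_fwd_le (v : Path T) : ‖fwd T v‖ ≤ len T * ‖v‖ :=
  (fwd T).le_of_opNorm_le (LinearMap.mkContinuous_norm_le _ len_nonneg _) v

theorem norm_bwd_le (v : Path T) : ‖bwd T v‖ ≤ len T * ‖v‖ :=
  (bwd T).le_of_opNorm_le (LinearMap.mkContinuous_norm_le _ len_nonneg _) v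

theorem fwd_sub (v : Path T) {s t : Time T} (h : s ≤ t) :
    fwd T v t - fwd T v s = ∫ r in Ioc s t, v r := setIntegral_Iic_sub (integrable_path v) h

theorem bwd_sub (v : Path T) {s t : Time T} (h : s ≤ t) :
    bwd T v s - bwd T v t = ∫ r in Ioc s t, v r := by
  rw [bwd_apply, bwd_apply, setIntegral_Ici (integrable_path v), setIntegral_Ici (integrable_path v),
    ← fwd_sub v h, fwd_apply, fwd_apply]
  ring

theorem fwd_mono {v w : Path T} (h : ∀ t, v t ≤ w t) (t : Time T) : fwd T v t ≤ fwd T w t :=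
  setIntegral_mono (integrable_path v).integrableOn (integrable_path w).integrableOn h

theorem bwd_mono {v w : Path T} (h : ∀ t, v t ≤ w t) (t : Time T) : bwd T v t ≤ bwd T w t :=
  setIntegral_mono (integrable_path v).integrableOn (integrable_path w).integrableOn h

/-- Arzelà-Ascoli: primitives of functions in the unit ball are 1-Lipschitz and bounded by `len T`.
-/
theorem isCompactOperator_fwd : IsCompactOperator (fwd T) := by
  refine (isCompactOperator_iff_image_closedBall_subset_compact
    (fwd T : Path T →ₗ[ℝ] Path T) one_pos).2 ?_
  set S : Set (Path T) := {f | (∀ t, f t ∈ Icc (-len T) (len T)) ∧ LipschitzWith 1 f} with hS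
  refine ⟨S, ArzelaAscoli.isCompact_of_equicontinuous S ?_ ?_, ?_⟩
  · have : ContinuousMap.toFun '' S =
        (univ.pi fun _ : Time T => Icc (-len T) (len T)) ∩ {f | LipschitzWith 1 f} := by
      ext f
      constructor
      · rintro ⟨g, hg, rfl⟩; exact ⟨fun t _ => hg.1 t, hg.2⟩
      · rintro ⟨h1, h2⟩; exact ⟨⟨f, h2.continuous⟩, ⟨fun t => h1 t trivial, h2⟩, rfl⟩
    rw [this]
    refine (isCompact_univ_pi fun _ => isCompact_Icc).inter_right ?_
    simp only [lipschitzWith_iff_dist_le_mul, ofPred_forall]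
    exact isClosed_iInter fun x => isClosed_iInter fun y =>
      isClosed_le ((continuous_apply x).dist (continuous_apply y)) continuous_const
  · exact (LipschitzWith.uniformEquicontinuous _ 1 fun f : S => f.2.2).equicontinuous
  · rintro _ ⟨v, hv, rfl⟩
    rw [mem_closedBall_zero_iff] at hv
    refine ⟨fun t => abs_le.1 ((abs_setIntegral_le v _).trans ?_),
      (lipschitz_setIntegral_Iic v).weaken hv⟩
    exact mul_le_of_le_one_right len_nonneg hv

/-- The Green operator of `-x'' = r`, `x(0) = 0`, `x'(T) = 0`. -/
def green (T : ℝ) : Path T →L[ℝ] Path T := (fwd T).comp (bwd T)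

theorem green_apply (v : Path T) : green T v = fwd T (bwd T v) := rfl

theorem green_mono {v w : Path T} (h : ∀ t, v t ≤ w t) (t : Time T) :
    green T v t ≤ green T w t := fwd_mono (bwd_mono h) t

/-- Fredholm alternative for `x - green (c x)`. -/
theorem surjective_sub_green_mul (c : Path T) (h : ∀ x : Path T, x = green T (c * x) → x = 0)
    (r : Path T) : ∃ x : Path T, x - green T (c * x) = r := by
  set K : Path T →L[ℝ] Path T := (green T).comp (ContinuousLinearMap.mul ℝ (Path T) c) with hKdef
  have hK : IsCompactOperator K :=
    isCompactOperator_fwd.comp_clm ((bwd T).comp (ContinuousLinearMap.mul ℝ (Path T) c))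
  -- Riesz theory for the compact operator `K`: `h` rules out the eigenvalue 1, so `1 - K` is
  -- invertible.
  rcases hK.hasEigenvalue_or_mem_resolventSet one_ne_zero with h1 | h1
  · obtain ⟨x, hx⟩ := h1.exists_hasEigenvector
    exact absurd (h x (by simpa [hKdef] using hx.apply_eq_smul.symm)) hx.2
  · rw [spectrum.mem_resolventSet_iff] at h1
    obtain ⟨u, hu⟩ := h1
    refine ⟨(↑u⁻¹ : Path T →L[ℝ] Path T) r, ?_⟩
    have h2 := congrArg (fun A : Path T →L[ℝ] Path T => A r) u.mul_inv
    rw [hu] at h2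
    simpa [hKdef] using h2

theorem fwd_eq_intervalIntegral (hT : 0 ≤ T) (v : Path T) (t : Time T) :
    fwd T v t = ∫ s in (0 : ℝ)..t, IccExtend hT v s := by
  have hmap : Measure.map (Subtype.val : Time T → ℝ) volume = volume.restrict (Icc 0 T) :=
    map_comap_subtype_coe measurableSet_Icc volume
  have hI : Iic (t : ℝ) ∩ Icc 0 T = Icc 0 (t : ℝ) := by
    ext z
    exact ⟨fun h => ⟨h.2.1, h.1⟩, fun h => ⟨h.2, h.1, h.2.trans t.2.2⟩⟩
  have h := measurableEmbedding_time.setIntegral_map (μ := (volume : Measure (Time T)))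
    (IccExtend hT v) (Iic (t : ℝ))
  rw [hmap, Measure.restrict_restrict measurableSet_Iic, hI, integral_Icc_eq_integral_Ioc,
    ← intervalIntegral.integral_of_le t.2.1] at h
  rw [h, fwd_apply]
  simp only [IccExtend_val]
  rfl

theorem continuous_extend (hT : 0 ≤ T) (v : Path T) : Continuous (IccExtend hT v) :=
  v.continuous.Icc_extend'

/-- Extending `v` by constants beyond `[0, T]` gives the primitive a two-sided derivative
everywhere, endpoints included, so that ordinary calculus on `ℝ` applies. -/
theorem exists_hasDerivAt_fwd (hT : 0 ≤ T) (v : Path T) :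
    ∃ F : ℝ → ℝ, (∀ s, HasDerivAt F (IccExtend hT v s) s) ∧ ∀ t : Time T, F t = fwd T v t :=
  ⟨fun s => ∫ r in (0 : ℝ)..s, IccExtend hT v r,
    fun s => ((continuous_extend hT v).integral_hasStrictDerivAt 0 s).hasDerivAt,
    fun t => (fwd_eq_intervalIntegral hT v t).symm⟩

theorem bwd_eq (v : Path T) (t : Time T) : bwd T v t = (∫ r, v r) - fwd T v t :=
  setIntegral_Ici (integrable_path v) t

theorem exists_hasDerivAt_bwd (hT : 0 ≤ T) (v : Path T) :
    ∃ F : ℝ → ℝ, (∀ s, HasDerivAt F (-IccExtend hT v s) s) ∧ ∀ t : Time T, F t = bwd T v t := by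
  obtain ⟨F, hF, hFv⟩ := exists_hasDerivAt_fwd hT v
  exact ⟨fun s => (∫ r, v r) - F s, fun s => (hF s).const_sub _, fun t => by rw [bwd_eq, ← hFv]⟩

/-- The initial time. -/
def t₀ (hT : 0 ≤ T) : Time T := ⟨0, le_rfl, hT⟩

/-- The final time. -/
def t₁ (hT : 0 ≤ T) : Time T := ⟨T, hT, le_rfl⟩

theorem t₀_le (hT : 0 ≤ T) (t : Time T) : t₀ hT ≤ t := t.2.1

theorem le_t₁ (hT : 0 ≤ T) (t : Time T) : t ≤ t₁ hT := t.2.2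

theorem fwd_t₀ (hT : 0 ≤ T) (v : Path T) : fwd T v (t₀ hT) = 0 := by
  rw [fwd_eq_intervalIntegral hT]; exact intervalIntegral.integral_same

theorem bwd_t₁ (hT : 0 ≤ T) (v : Path T) : bwd T v (t₁ hT) = 0 := by
  have : Iic (t₁ hT) = univ := eq_univ_of_forall fun t => le_t₁ hT t
  rw [bwd_eq, fwd_apply, this, setIntegral_univ, sub_self]

/-! ### The maximum principle and integration by parts. -/

theorem isCompact_Iic_inter_le (x : Path T) (b : Time T) (m : ℝ) :
    IsCompact {s : Time T | s ≤ b ∧ x s ≤ m} :=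
  ((isClosed_le continuous_id continuous_const).inter
    (isClosed_le x.continuous continuous_const)).isCompact

/-- Maximum principle. -/
theorem green_le_of_forall (hT : 0 ≤ T) {x r : Path T} {m : ℝ} (hm : 0 ≤ m)
    (hx : x = green T r) (h : ∀ t, m < x t → r t ≤ 0) (t : Time T) : x t ≤ m := by
  by_contra! hlt
  obtain ⟨b, -, hb⟩ := isCompact_univ.exists_isMaxOn ⟨t, mem_univ t⟩ x.continuous.continuousOn
  have hbm : m < x b := hlt.trans_le (hb (mem_univ t))
  have hx0 : x (t₀ hT) = 0 := by rw [hx, green_apply, fwd_t₀]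
  -- At the maximum point `b` the derivative `bwd T r` of `x` vanishes: by the boundary condition if
  -- `b = T`, by criticality otherwise.
  have hgb : bwd T r b ≤ 0 := by
    by_cases hbT : b = t₁ hT
    · rw [hbT, bwd_t₁]
    obtain ⟨F, hF, hFx⟩ := exists_hasDerivAt_fwd hT (bwd T r)
    rw [← green_apply, ← hx] at hFx
    have hb0 : b ≠ t₀ hT := by rintro rfl; linarith
    have h0 : (0 : ℝ) < b := lt_of_le_of_ne b.2.1 fun h => hb0 (Subtype.ext h.symm)
    have h1 : (b : ℝ) < T := lt_of_le_of_ne b.2.2 fun h => hbT (Subtype.ext h)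
    have hloc : IsLocalMax F b := by
      filter_upwards [Ioo_mem_nhds h0 h1] with s hs
      have := hb (mem_univ ⟨s, hs.1.le, hs.2.le⟩)
      simpa [← hFx] using this
    have := hloc.hasDerivAt_eq_zero (hF b)
    rw [IccExtend_val] at this
    exact this.le
  -- `a` is the last time before `b` with `x ≤ m`. On `(a, b)` one has `r ≤ 0`, so the derivative
  -- there is at most its value at `b`, hence nonpositive, and `x` cannot climb from `m` to `x b`.
  obtain ⟨a, ⟨hab, ham⟩, ha⟩ := (isCompact_Iic_inter_le x b m).exists_isGreatest
    ⟨t₀ hT, t₀_le hT b, by simpa [hx0] using hm⟩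
  have hr : ∀ s ∈ Ioc a b, r s ≤ 0 := fun s hs => h s (by
    by_contra! hs'
    exact absurd (ha ⟨hs.2, hs'⟩) (not_le.2 hs.1))
  have hg : ∀ s ∈ Ioc a b, bwd T r s ≤ 0 := fun s hs => by
    have h1 := bwd_sub r hs.2
    have h2 : ∫ z in Ioc s b, r z ≤ 0 := setIntegral_nonpos measurableSet_Ioc
      fun z hz => hr z ⟨hs.1.trans hz.1, hz.2⟩
    linarith
  have h1 := fwd_sub (bwd T r) hab
  rw [← green_apply, ← hx] at h1
  have h2 := setIntegral_nonpos (μ := (volume : Measure (Time T))) measurableSet_Ioc hg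
  have h3 : x a ≤ m := ham
  linarith

/-- Integration by parts against a merely integrable velocity. -/
theorem integral_bwd_mul {r : Path T} {v : Time T → ℝ} (hv : Integrable v volume) :
    ∫ s, bwd T r s * v s = ∫ t, r t * ∫ s in Iic t, v s := by
  have hS : MeasurableSet {z : Time T × Time T | z.1 ≤ z.2} :=
    (isClosed_le continuous_fst continuous_snd).measurableSet
  have hint : Integrable (fun z : Time T × Time T =>
      {z : Time T × Time T | z.1 ≤ z.2}.indicator (fun z => v z.1 * r z.2) z)
      (volume.prod volume) := (hv.mul_prod (integrable_path r)).indicator hS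
  have h := integral_integral_swap (f := fun s t : Time T =>
      {z : Time T × Time T | z.1 ≤ z.2}.indicator (fun z => v z.1 * r z.2) (s, t)) hint
  have h1 : ∀ s : Time T, ∫ t, {z : Time T × Time T | z.1 ≤ z.2}.indicator
      (fun z => v z.1 * r z.2) (s, t) = bwd T r s * v s := fun s => by
    rw [bwd_apply, ← integral_mul_const, ← integral_indicator measurableSet_Ici]
    congr 1 with t
    by_cases hst : s ≤ t <;> simp [indicator, hst, mul_comm]
  have h2 : ∀ t : Time T, ∫ s, {z : Time T × Time T | z.1 ≤ z.2}.indicator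
      (fun z => v z.1 * r z.2) (s, t) = r t * ∫ s in Iic t, v s := fun t => by
    rw [← integral_const_mul, ← integral_indicator measurableSet_Iic]
    congr 1 with s
    by_cases hst : s ≤ t <;> simp [indicator, hst, mul_comm]
  simp only [h1, h2] at h
  exact h

/-! ### The nonlinearity: Lipschitz bounds and sublinearity. -/

/-- `-½` times the derivative of `1 / (1 + x²)`. -/
def force : C(ℝ, ℝ) := ⟨fun x => x / (1 + x ^ 2) ^ 2, by
  refine continuous_id.div (by fun_prop) fun x => ?_
  positivity⟩

/-- The derivative of `force`. -/
def stiffness : C(ℝ, ℝ) := ⟨fun x => (1 - 3 * x ^ 2) / (1 + x ^ 2) ^ 3, by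
  refine Continuous.div (by fun_prop) (by fun_prop) fun x => ?_
  positivity⟩

theorem force_apply (x : ℝ) : force x = x / (1 + x ^ 2) ^ 2 := rfl

theorem stiffness_apply (x : ℝ) : stiffness x = (1 - 3 * x ^ 2) / (1 + x ^ 2) ^ 3 := rfl

theorem hasDerivAt_force (x : ℝ) : HasDerivAt force (stiffness x) x := by
  have h1 : HasDerivAt (fun x : ℝ => (1 + x ^ 2) ^ 2) (2 * (1 + x ^ 2) * (2 * x)) x := by
    have := ((hasDerivAt_pow 2 x).const_add 1).fun_pow 2
    simpa using this
  have h2 := (hasDerivAt_id x).div h1 (by positivity)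
  refine h2.congr_deriv ?_
  have : (1 + x ^ 2) ≠ 0 := by positivity
  simp only [stiffness_apply, id]
  field_simp
  ring

theorem hasDerivAt_stiffness (x : ℝ) :
    HasDerivAt stiffness ((12 * x ^ 3 - 12 * x) / (1 + x ^ 2) ^ 4) x := by
  have h1 : HasDerivAt (fun x : ℝ => (1 + x ^ 2) ^ 3) (3 * (1 + x ^ 2) ^ 2 * (2 * x)) x := by
    have := ((hasDerivAt_pow 2 x).const_add 1).fun_pow 3
    simpa using this
  have h0 : HasDerivAt (fun x : ℝ => 1 - 3 * x ^ 2) (-(3 * (2 * x))) x := by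
    have := ((hasDerivAt_pow 2 x).const_mul 3).const_sub 1
    simpa using this
  have h2 := h0.div h1 (by positivity)
  refine h2.congr_deriv ?_
  have : (1 + x ^ 2) ≠ 0 := by positivity
  field_simp
  ring

/-- The bound against which the coupling `κ > 1` is measured throughout. -/
theorem abs_stiffness_le (x : ℝ) : |stiffness x| ≤ 1 := by
  rw [stiffness_apply, abs_div, abs_of_pos (by positivity : (0 : ℝ) < (1 + x ^ 2) ^ 3),
    div_le_one (by positivity), abs_le]
  have := sq_nonneg x
  constructor <;> nlinarith [pow_nonneg this 2, pow_nonneg this 3]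

theorem abs_deriv_stiffness_le (x : ℝ) :
    |(12 * x ^ 3 - 12 * x) / (1 + x ^ 2) ^ 4| ≤ 12 := by
  rw [abs_div, abs_of_pos (by positivity : (0 : ℝ) < (1 + x ^ 2) ^ 4), div_le_iff₀ (by positivity)]
  have h0 := sq_nonneg x
  have h1 : |x| ≤ 1 + x ^ 2 := by rw [abs_le]; constructor <;> nlinarith
  have h2 : |12 * x ^ 3 - 12 * x| ≤ 12 * (|x| * (1 + x ^ 2)) := by
    rw [show 12 * x ^ 3 - 12 * x = 12 * (x * (x ^ 2 - 1)) by ring, abs_mul, abs_mul,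
      abs_of_pos (by norm_num : (0 : ℝ) < 12)]
    gcongr
    rw [abs_le]; constructor <;> linarith
  refine h2.trans ?_
  gcongr
  calc |x| * (1 + x ^ 2) ≤ (1 + x ^ 2) * (1 + x ^ 2) := by gcongr
    _ = (1 + x ^ 2) ^ 2 := by ring
    _ ≤ (1 + x ^ 2) ^ 4 := pow_le_pow_right₀ (by linarith) (by norm_num)

theorem abs_force_sub_le (a b : ℝ) : |force a - force b| ≤ |a - b| := by
  have := convex_univ.norm_image_sub_le_of_norm_hasDerivWithin_le
    (fun x _ => (hasDerivAt_force x).hasDerivWithinAt) (fun x _ => abs_stiffness_le x)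
    (mem_univ b) (mem_univ a)
  simpa using this

theorem abs_stiffness_sub_le (a b : ℝ) : |stiffness a - stiffness b| ≤ 12 * |a - b| := by
  exact convex_univ.norm_image_sub_le_of_norm_hasDerivWithin_le
    (fun x _ => (hasDerivAt_stiffness x).hasDerivWithinAt) (fun x _ => abs_deriv_stiffness_le x)
    (mem_univ b) (mem_univ a)

/-- Mean value inequality for `force x - stiffness c * x`, whose derivative on the ball is at most
`12 ρ`. -/
theorem abs_force_sub_sub_le {a b c ρ : ℝ} (ha : |a - c| ≤ ρ) (hb : |b - c| ≤ ρ) :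
    |force a - force b - stiffness c * (a - b)| ≤ 12 * ρ * |a - b| := by
  have hd : ∀ x ∈ Metric.closedBall c ρ, HasDerivWithinAt (fun x => force x - stiffness c * x)
      (stiffness x - stiffness c) (Metric.closedBall c ρ) x := fun x _ => by
    have := (hasDerivAt_force x).fun_sub ((hasDerivAt_id x).const_mul (stiffness c))
    simpa using this.hasDerivWithinAt
  have := (convex_closedBall c ρ).norm_image_sub_le_of_norm_hasDerivWithin_le hd
    (C := 12 * ρ) (fun x hx => (abs_stiffness_sub_le x c).trans (by
      have : |x - c| ≤ ρ := hx
      linarith))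
    (show b ∈ _ from hb) (show a ∈ _ from ha)
  simp only [Real.norm_eq_abs] at this
  convert this using 2
  ring

theorem force_neg (x : ℝ) : force (-x) = -force x := by
  simp only [force_apply]; ring

theorem force_pos {x : ℝ} (hx : 0 < x) : 0 < force x := by
  rw [force_apply]; positivity

theorem force_zero : force 0 = 0 := by simp [force_apply]

theorem force_le_one (x : ℝ) : force x ≤ 1 := by
  rw [force_apply, div_le_one (by positivity)]
  nlinarith [sq_nonneg x, sq_nonneg (x - 1), sq_nonneg (x ^ 2)]

theorem le_force {z : ℝ} (hz : 0 ≤ z) : z * (1 - 2 * z ^ 2) ≤ force z := by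
  rw [force_apply, le_div_iff₀ (by positivity), mul_assoc]
  refine mul_le_of_le_one_right hz ?_
  nlinarith [pow_nonneg hz 4, pow_nonneg hz 6]

/-- The ratio `force z / z = (1 + z²)⁻²` decreases for `z > 0`. This sublinearity is what makes the
positive equilibrium attract from both sides. -/
theorem force_mul_le {l z : ℝ} (hl : 1 ≤ l) (hz : 0 ≤ z) : force (l * z) ≤ l * force z := by
  rw [force_apply, force_apply, ← mul_div_assoc]
  have : z ^ 2 ≤ (l * z) ^ 2 := pow_le_pow_left₀ hz (le_mul_of_one_le_left hz hl) 2
  gcongr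

theorem le_force_mul {l z : ℝ} (hl0 : 0 ≤ l) (hl : l ≤ 1) (hz : 0 ≤ z) :
    l * force z ≤ force (l * z) := by
  rw [force_apply, force_apply, ← mul_div_assoc]
  have : (l * z) ^ 2 ≤ z ^ 2 := pow_le_pow_left₀ (by positivity) (mul_le_of_le_one_left hz hl) 2
  gcongr

/-- Infinitesimal form of strict sublinearity; the gap is `4 z³ / (1 + z²)³`. It drives the Sturm
comparison. -/
theorem stiffness_mul_lt_force {z : ℝ} (hz : 0 < z) : stiffness z * z < force z := by
  rw [force_apply, stiffness_apply, div_mul_eq_mul_div, div_lt_div_iff₀ (by positivity)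
    (by positivity)]
  have : 0 < z * (1 + z ^ 2) ^ 2 * (4 * z ^ 2) := by positivity
  nlinarith

/-! ### Replies -/

/-- The Euler-Lagrange boundary value problem
`-x'' = x / (1 + x²)² + κ (η - x)`, `x(0) = 0`, `x'(T) = 0`. -/
def IsReply (κ : ℝ) (η x : Path T) : Prop := x = green T (force.comp x + κ • (η - x))

theorem sub_eq_green {x r x' r' : Path T} (hx : x = green T r) (hx' : x' = green T r') :
    x - x' = green T (r - r') := by rw [map_sub, ← hx, ← hx']

/-- Where `x > x'`, the 1-Lipschitz bound on `force` gives `r - r' ≤ (1 - κ)(x - x') < 0`, so the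
maximum principle applies to `x - x'`. -/
theorem le_of_subsolution_supersolution (hT : 0 ≤ T) {κ : ℝ} (hκ : 1 < κ) {η η' x x' r r' : Path T}
    (hη : ∀ t, η t ≤ η' t) (hx : x = green T r) (hr : ∀ t, r t ≤ force (x t) + κ * (η t - x t))
    (hx' : x' = green T r') (hr' : ∀ t, force (x' t) + κ * (η' t - x' t) ≤ r' t) (t : Time T) :
    x t ≤ x' t := by
  have := green_le_of_forall hT le_rfl (sub_eq_green hx hx') (fun t ht => ?_) t
  · simpa using this
  · simp only [ContinuousMap.sub_apply] at ht ⊢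
    have h1 := (abs_le.1 (abs_force_sub_le (x t) (x' t))).2
    rw [abs_of_pos ht] at h1
    nlinarith [hr t, hr' t, hη t]

theorem IsReply.le_supersolution (hT : 0 ≤ T) {κ : ℝ} (hκ : 1 < κ) {η x x' r' : Path T}
    (h : IsReply κ η x) (hx' : x' = green T r')
    (hr' : ∀ t, force (x' t) + κ * (η t - x' t) ≤ r' t) (t : Time T) : x t ≤ x' t :=
  le_of_subsolution_supersolution hT hκ (fun _ => le_rfl) h (fun _ => le_rfl) hx' hr' t

theorem IsReply.subsolution_le (hT : 0 ≤ T) {κ : ℝ} (hκ : 1 < κ) {η x x' r' : Path T}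
    (h : IsReply κ η x) (hx' : x' = green T r')
    (hr' : ∀ t, r' t ≤ force (x' t) + κ * (η t - x' t)) (t : Time T) : x' t ≤ x t :=
  le_of_subsolution_supersolution hT hκ (fun _ => le_rfl) hx' hr' h (fun _ => le_rfl) t

theorem IsReply.mono (hT : 0 ≤ T) {κ : ℝ} (hκ : 1 < κ) {η η' x x' : Path T}
    (h : IsReply κ η x) (h' : IsReply κ η' x') (hη : ∀ t, η t ≤ η' t) (t : Time T) : x t ≤ x' t :=
  le_of_subsolution_supersolution hT hκ hη h (fun _ => le_rfl) h' (fun _ => le_rfl) t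

theorem IsReply.unique (hT : 0 ≤ T) {κ : ℝ} (hκ : 1 < κ) {η x x' : Path T}
    (h : IsReply κ η x) (h' : IsReply κ η x') : x = x' :=
  ContinuousMap.ext fun t => le_antisymm (h.mono hT hκ h' (fun _ => le_rfl) t)
    (h'.mono hT hκ h (fun _ => le_rfl) t)

theorem IsReply.neg {κ : ℝ} {η x : Path T} (h : IsReply κ η x) : IsReply κ (-η) (-x) := by
  unfold IsReply at h ⊢
  nth_rewrite 1 [h]
  rw [← map_neg]
  congr 1
  ext t
  simp [force_neg]
  ring

theorem eq_zero_of_eq_green_mul (hT : 0 ≤ T) {c x : Path T} (hc : ∀ t, c t ≤ 0)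
    (hx : x = green T (c * x)) : x = 0 := by
  have hx' : -x = green T (-(c * x)) := by rw [map_neg, ← hx]
  ext t
  refine le_antisymm (green_le_of_forall hT le_rfl hx (fun s hs => ?_) t) ?_
  · exact mul_nonpos_of_nonpos_of_nonneg (hc s) hs.le
  · have := green_le_of_forall hT le_rfl hx' (fun s hs => ?_) t
    · simpa using this
    · have h1 : x s < 0 := by simpa using hs
      have := mul_nonneg_of_nonpos_of_nonpos (hc s) h1.le
      simpa using this

/-- With `κ x` moved to the left, the solution operator `K` of `-x'' + κ x = r` is `κ⁻¹`-Lipschitz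
in sup norm by the maximum principle. As `force` is 1-Lipschitz, `x ↦ K (force x + κ η)` is a
contraction. -/
theorem exists_reply (hT : 0 ≤ T) {κ : ℝ} (hκ : 1 < κ) (η : Path T) : ∃ x, IsReply κ η x := by
  have hκ0 : 0 < κ := one_pos.trans hκ
  have hK : ∀ r : Path T, ∃ x : Path T, x = green T (r - κ • x) := fun r => by
    obtain ⟨x, hx⟩ := surjective_sub_green_mul (ContinuousMap.const _ (-κ))
      (fun x hx => eq_zero_of_eq_green_mul hT (fun t => by simpa using hκ0.le) hx) (green T r)
    refine ⟨x, ?_⟩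
    rw [map_sub, ← hx]
    have : ContinuousMap.const (Time T) (-κ) * x = -(κ • x) := by ext t; simp
    rw [this, map_neg]
    abel
  choose K hK using hK
  have hle : ∀ r r' : Path T, ∀ t, K r t - K r' t ≤ κ⁻¹ * ‖r - r'‖ := fun r r' t => by
    refine green_le_of_forall hT (by positivity) (sub_eq_green (hK r) (hK r')) (fun s hs => ?_) t
    have h1 := (abs_le.1 ((r - r').norm_coe_le_norm s)).2
    simp only [ContinuousMap.sub_apply, ContinuousMap.smul_apply, smul_eq_mul] at hs h1 ⊢
    rw [inv_mul_lt_iff₀ hκ0] at hs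
    linarith
  have hlip : ContractingWith (Real.toNNReal κ⁻¹) fun x => K (force.comp x + κ • η) := by
    refine ⟨Real.toNNReal_lt_one.2 (inv_lt_one_of_one_lt₀ hκ), LipschitzWith.of_dist_le_mul
      fun x x' => ?_⟩
    have h0 : ‖force.comp x + κ • η - (force.comp x' + κ • η)‖ ≤ ‖x - x'‖ := by
      refine (ContinuousMap.norm_le _ (norm_nonneg _)).2 fun t => ?_
      have h1 := (x - x').norm_coe_le_norm t
      have h2 := abs_force_sub_le (x t) (x' t)
      simpa using h2.trans h1
    rw [Real.coe_toNNReal _ (by positivity), dist_eq_norm, dist_eq_norm]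
    refine le_trans ?_ (mul_le_mul_of_nonneg_left h0 (by positivity))
    refine (ContinuousMap.norm_le _ (by positivity)).2 fun t => abs_le.2 ⟨?_, hle _ _ t⟩
    have := hle (force.comp x' + κ • η) (force.comp x + κ • η) t
    rw [norm_sub_rev] at this
    simp only [ContinuousMap.sub_apply]
    linarith
  obtain ⟨x, hx⟩ : ∃ x, K (force.comp x + κ • η) = x := ⟨_, hlip.fixedPoint_isFixedPt⟩
  refine ⟨x, ?_⟩
  have h1 := hK (force.comp x + κ • η)
  rw [hx] at h1
  unfold IsReply
  nth_rewrite 1 [h1]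
  congr 1
  ext t
  simp
  ring

/-- Above this level the damping `(κ - 1)(x - x')` exceeds the source `κ ‖η - η'‖`, so the
right-hand side of the equation for `x - x'` is nonpositive there. -/
theorem IsReply.abs_sub_le (hT : 0 ≤ T) {κ : ℝ} (hκ : 1 < κ) {η x η' x' : Path T}
    (h : IsReply κ η x) (h' : IsReply κ η' x') (t : Time T) :
    |x t - x' t| ≤ κ / (κ - 1) * ‖η - η'‖ := by
  have key : ∀ {η x η' x' : Path T}, IsReply κ η x → IsReply κ η' x' → ∀ t,
      x t - x' t ≤ κ / (κ - 1) * ‖η - η'‖ := by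
    intro η x η' x' h h' t
    have h1 : 0 < κ - 1 := by linarith
    have h0 : 0 < κ := by linarith
    refine green_le_of_forall hT (by positivity) (sub_eq_green h h') (fun s hs => ?_) t
    have h2 := (abs_le.1 ((η - η').norm_coe_le_norm s)).2
    simp only [ContinuousMap.sub_apply, ContinuousMap.smul_apply, smul_eq_mul,
      ContinuousMap.add_apply, ContinuousMap.comp_apply] at hs h2 ⊢
    have h3 : 0 < x s - x' s := lt_of_le_of_lt (by positivity) hs
    have h4 := (abs_le.1 (abs_force_sub_le (x s) (x' s))).2
    rw [abs_of_pos h3] at h4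
    rw [div_mul_eq_mul_div, div_lt_iff₀ h1] at hs
    nlinarith
  refine abs_le.2 ⟨?_, key h h' t⟩
  have := key h' h t
  rw [norm_sub_rev] at this
  linarith

theorem fwd_eq_sub_of_hasDerivAt (hT : 0 ≤ T) {f : ℝ → ℝ} {v : Path T}
    (h : ∀ t : Time T, HasDerivAt f (v t) t) (t : Time T) : fwd T v t = f t - f 0 := by
  rw [fwd_eq_intervalIntegral hT]
  refine intervalIntegral.integral_eq_sub_of_hasDerivAt (fun s hs => ?_)
    ((continuous_extend hT v).intervalIntegrable _ _)
  rw [uIcc_of_le t.2.1] at hs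
  have := h ⟨s, hs.1, hs.2.trans t.2.2⟩
  rwa [← IccExtend_of_mem hT v ⟨hs.1, hs.2.trans t.2.2⟩] at this

theorem bwd_eq_sub_of_hasDerivAt (hT : 0 ≤ T) {f : ℝ → ℝ} {v : Path T}
    (h : ∀ t : Time T, HasDerivAt f (v t) t) (t : Time T) : bwd T v t = f T - f t := by
  have h1 := bwd_eq v t
  have h2 := bwd_eq v (t₁ hT)
  rw [bwd_t₁, fwd_eq_sub_of_hasDerivAt hT h] at h2
  rw [fwd_eq_sub_of_hasDerivAt hT h] at h1
  simp only [t₁] at h2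
  linarith

theorem fwd_lt_fwd (hT : 0 ≤ T) {v : Path T} {s t : Time T} (hst : s < t)
    (h : ∀ r ∈ Ioo s t, 0 < v r) : fwd T v s < fwd T v t := by
  obtain ⟨F, hF, hFv⟩ := exists_hasDerivAt_fwd hT v
  rw [← hFv, ← hFv]
  have hd : Differentiable ℝ F := fun z => (hF z).differentiableAt
  refine strictMonoOn_of_deriv_pos (convex_Icc (s : ℝ) t) hd.continuous.continuousOn
    (fun z hz => ?_) (left_mem_Icc.2 hst.le) (right_mem_Icc.2 hst.le) hst
  rw [interior_Icc] at hz
  have hz' : z ∈ Icc 0 T := ⟨s.2.1.trans hz.1.le, hz.2.le.trans t.2.2⟩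
  rw [(hF z).deriv, IccExtend_of_mem hT v hz']
  exact h ⟨z, hz'⟩ hz

theorem bwd_pos (hT : 0 ≤ T) {v : Path T} {t : Time T} (ht : t < t₁ hT)
    (h : ∀ r ∈ Ioo t (t₁ hT), 0 < v r) : 0 < bwd T v t := by
  have h1 := bwd_eq v t
  have h2 := bwd_eq v (t₁ hT)
  rw [bwd_t₁] at h2
  linarith [fwd_lt_fwd hT ht h]

/-! ### The first mode, growth near zero, and existence of a positive equilibrium. -/

/-- The frequency of the first mode. -/
def freq (T : ℝ) : ℝ := Real.pi / (2 * T)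

/-- The first mode `sin (π t / (2 T))`. -/
def sine (T : ℝ) : Path T := ⟨fun t => Real.sin (freq T * t), by fun_prop⟩

theorem sine_apply (t : Time T) : sine T t = Real.sin (freq T * t) := rfl

theorem freq_pos (hT : 2 < T) : 0 < freq T := by
  have := Real.pi_pos
  unfold freq; positivity

theorem freq_lt_one (hT : 2 < T) : freq T < 1 := by
  unfold freq
  rw [div_lt_one (by linarith)]
  linarith [Real.pi_lt_four]

theorem freq_mul (hT : 2 < T) : freq T * T = Real.pi / 2 := by
  unfold freq
  field_simp

theorem sine_eq_green (hT : 2 < T) : sine T = green T ((freq T) ^ 2 • sine T) := by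
  have hT0 : 0 ≤ T := by linarith
  have hω := freq_pos hT
  set c : Path T := ⟨fun t => Real.cos (freq T * t), by fun_prop⟩ with hc
  have hlin : ∀ s : ℝ, HasDerivAt (fun s => freq T * s) (freq T) s := fun s => by
    simpa using (hasDerivAt_id s).const_mul (freq T)
  have h1 : bwd T ((freq T) ^ 2 • sine T) = freq T • c := by
    ext t
    rw [bwd_eq_sub_of_hasDerivAt hT0 (f := fun s => -freq T * Real.cos (freq T * s)), freq_mul hT,
      Real.cos_pi_div_two]
    · simp [hc]
    · intro t
      refine ((hlin t).cos.const_mul (-freq T)).congr_deriv ?_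
      simp only [sine_apply, ContinuousMap.smul_apply, smul_eq_mul]
      ring
  rw [green_apply, h1]
  ext t
  rw [fwd_eq_sub_of_hasDerivAt hT0 (f := fun s => Real.sin (freq T * s))]
  · simp [sine_apply]
  · intro t
    refine (hlin t).sin.congr_deriv ?_
    simp only [hc, ContinuousMap.smul_apply, smul_eq_mul, ContinuousMap.coe_mk]
    ring

theorem sine_arg_mem (hT : 2 < T) (t : Time T) :
    0 ≤ freq T * t ∧ freq T * t ≤ Real.pi / 2 := by
  have hω := freq_pos hT
  refine ⟨mul_nonneg hω.le t.2.1, ?_⟩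
  rw [← freq_mul hT]
  exact mul_le_mul_of_nonneg_left t.2.2 hω.le

theorem sine_nonneg (hT : 2 < T) (t : Time T) : 0 ≤ sine T t :=
  Real.sin_nonneg_of_nonneg_of_le_pi (sine_arg_mem hT t).1
    ((sine_arg_mem hT t).2.trans (by linarith [Real.pi_pos]))

theorem sine_le_one (t : Time T) : sine T t ≤ 1 := Real.sin_le_one _

theorem sine_t₁ (hT : 2 < T) (hT0 : 0 ≤ T) : sine T (t₁ hT0) = 1 := by
  rw [sine_apply]
  simp only [t₁]
  rw [freq_mul hT, Real.sin_pi_div_two]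

theorem div_le_sine (hT : 2 < T) (t : Time T) : (t : ℝ) / T ≤ sine T t := by
  have h := Real.mul_le_sin (sine_arg_mem hT t).1 (sine_arg_mem hT t).2
  refine le_trans (le_of_eq ?_) h
  have := Real.pi_ne_zero
  have : T ≠ 0 := by linarith
  unfold freq
  field_simp

theorem norm_one_le : ‖(1 : Path T)‖ ≤ 1 :=
  (ContinuousMap.norm_le _ zero_le_one).2 fun t => by simp

/-- Both sides vanish linearly at `t = 0`: `green T 1 t ≤ T t` on the left, and Jordan's inequality
bounds the sine below by `t / T`. -/
theorem green_one_le (hT : 2 < T) (t : Time T) : green T 1 t ≤ T ^ 2 * sine T t := by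
  have hT0 : 0 ≤ T := by linarith
  have h1 : ∀ s, bwd T 1 s ≤ ContinuousMap.const (Time T) T s := fun s => by
    have h := (le_abs_self _).trans ((bwd T 1).norm_coe_le_norm s)
    have h2 := norm_bwd_le (1 : Path T)
    rw [len_eq hT0] at h2
    exact h.trans (h2.trans (mul_le_of_le_one_right hT0 norm_one_le))
  have h2 := fwd_mono h1 t
  rw [fwd_eq_sub_of_hasDerivAt hT0 (f := fun s => T * s)
    (v := ContinuousMap.const _ T) (fun s => by simpa using (hasDerivAt_id (s : ℝ)).const_mul T)]
    at h2
  have h3 := div_le_sine hT t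
  rw [div_le_iff₀ (by linarith)] at h3
  refine h2.trans ?_
  rw [mul_zero, sub_zero]
  nlinarith

/-- Growth of the best reply near zero. -/
theorem exists_growth (hT : 2 < T) {κ : ℝ} (hκ : 1 < κ) : ∃ l > 1, ∃ b > 0, ∀ c, 0 ≤ c → l * c ≤ b →
    ∀ η x : Path T, IsReply κ η x → (∀ t, c * sine T t ≤ η t) → ∀ t, l * c * sine T t ≤ x t := by
  have hT0 : 0 ≤ T := by linarith
  have hω := freq_pos hT
  set d := 1 - freq T ^ 2 with hd
  have hd0 : 0 < d := by nlinarith [freq_lt_one hT]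
  have hκ0 : 0 < κ := by linarith
  -- `d = 1 - ω²` is the spectral margin. The amplitude bound `√(d/4)` gives `force z ≥ (1 - d/2)
  -- z`, leaving a surplus of `d/2` over `ω² = 1 - d`; the choice of `l` makes the coupling cost `κ
  -- (l - 1) = d/4`.
  refine ⟨1 + d / (4 * κ), by linarith [show 0 < d / (4 * κ) by positivity], Real.sqrt (d / 4),
    by positivity, fun c hc hcb η x hx hη t => ?_⟩
  set l := 1 + d / (4 * κ) with hl
  have hl1 : 1 ≤ l := by linarith [show 0 < d / (4 * κ) by positivity]
  have hκl : κ * (l - 1) = d / 4 := by rw [hl]; field_simp; ring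
  have hgr : (l * c) • sine T = green T ((l * c) • (freq T ^ 2 • sine T)) := by
    rw [map_smul, ← sine_eq_green hT]
  refine hx.subsolution_le hT0 hκ hgr (fun s => ?_) t
  simp only [ContinuousMap.smul_apply, smul_eq_mul]
  have hs0 := sine_nonneg hT s
  have hs1 := sine_le_one s
  have hlc : 0 ≤ l * c := by positivity
  have hz := le_force (mul_nonneg hlc hs0)
  have hzb : (l * c * sine T s) ^ 2 ≤ d / 4 := by
    rw [← Real.sq_sqrt (by positivity : 0 ≤ d / 4)]
    exact pow_le_pow_left₀ (by positivity) ((mul_le_of_le_one_right hlc hs1).trans hcb) 2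
  have hcs : 0 ≤ c * sine T s := by positivity
  have h2 := hη s
  set u := c * sine T s with hu
  have e1 : l * c * sine T s = l * u := by rw [hu]; ring
  rw [e1] at hz hzb ⊢
  have h4 : l * u * (1 - 2 * (l * u) ^ 2) ≥ l * u * (1 - d / 2) :=
    mul_le_mul_of_nonneg_left (by linarith) (by positivity)
  have h5 : l * c * (freq T ^ 2 * sine T s) = l * u * (1 - d) := by rw [hu, hd]; ring
  rw [h5]
  have h6 : κ * (η s - l * u) ≥ -(d / 4) * u := by
    rw [← hκl]
    nlinarith
  have h7 : l * u * (d / 2) ≥ u * (d / 2) := by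
    have : u ≤ l * u := le_mul_of_one_le_left hcs hl1
    exact mul_le_mul_of_nonneg_right this (by positivity)
  nlinarith

/-- Monotone iteration of the reply map. The start `c • sine T` lies below its own reply, so the
iterates increase; `green T 1` is a supersolution because `force ≤ 1`; compactness of the Green
operator gives uniform convergence along a subsequence. -/
theorem exists_positive_equilibrium (hT : 2 < T) :
    ∃ y : Path T, y = green T (force.comp y) ∧ ∃ c > 0, ∀ t, c * sine T t ≤ y t := by
  have hT0 : 0 ≤ T := by linarith
  -- Only an auxiliary coupling: it drops out of the fixed point equation.
  obtain ⟨κ, hκ⟩ : ∃ κ : ℝ, 1 < κ := ⟨2, by norm_num⟩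
  obtain ⟨l, hl, b, hb, hgrow⟩ := exists_growth hT hκ
  have hω := freq_pos hT
  have hω1 := freq_lt_one hT
  set c := min 1 (b / l) with hc
  have hc0 : 0 < c := lt_min one_pos (by positivity)
  have hc1 : c ≤ 1 := min_le_left _ _
  have hcb : l * c ≤ b := by
    have := min_le_right 1 (b / l)
    rw [← hc, le_div_iff₀ (by linarith)] at this
    linarith
  choose Φ hΦ using exists_reply hT0 hκ
  set X : ℕ → Path T := fun k => Φ^[k] (c • sine T) with hX
  have hXs : ∀ k, X (k + 1) = Φ (X k) := fun k => Function.iterate_succ_apply' _ _ _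
  have hle : ∀ k t, X k t ≤ X (k + 1) t := by
    intro k
    induction k with
    | zero =>
      intro t
      rw [hXs]
      refine le_trans ?_ (hgrow c hc0.le hcb _ _ (hΦ (X 0)) (fun t => le_rfl) t)
      have : 0 ≤ c * sine T t := mul_nonneg hc0.le (sine_nonneg hT t)
      have h2 : X 0 t = c * sine T t := rfl
      rw [h2, mul_assoc]
      exact le_mul_of_one_le_left this hl.le
    | succ k ih =>
      intro t
      rw [hXs, hXs (k + 1)]
      exact (hΦ _).mono hT0 hκ (hΦ _) ih t
  have hmono : Monotone fun k => X k := monotone_nat_of_le_succ fun k t => hle k t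
  have h0 : ∀ k t, c * sine T t ≤ X k t := fun k t => hmono (Nat.zero_le k) t
  have hX0 : X 0 = green T (c • (freq T ^ 2 • sine T)) := by
    rw [map_smul, ← sine_eq_green hT]; rfl
  have hup : ∀ k t, X k t ≤ green T 1 t := by
    intro k
    induction k with
    | zero =>
      rw [hX0]
      refine green_mono fun t => ?_
      simp only [ContinuousMap.smul_apply, smul_eq_mul, ContinuousMap.one_apply]
      have := sine_nonneg hT t
      have := sine_le_one t
      have : freq T ^ 2 ≤ 1 := by nlinarith
      exact mul_le_one₀ hc1 (by positivity) (mul_le_one₀ this (by positivity) (by assumption))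
    | succ k ih =>
      rw [hXs]
      refine (hΦ _).le_supersolution hT0 hκ rfl fun t => ?_
      have h1 := force_le_one (green T 1 t)
      have h2 := mul_nonneg (by linarith : 0 ≤ κ) (sub_nonneg.2 (ih t))
      simp only [ContinuousMap.one_apply]
      linarith
  set C := ‖green T 1‖ with hC
  have hbd : ∀ k t, |X k t| ≤ C := fun k t => by
    have h1 : 0 ≤ c * sine T t := mul_nonneg hc0.le (sine_nonneg hT t)
    rw [abs_of_nonneg (h1.trans (h0 k t))]
    exact (hup k t).trans ((le_abs_self _).trans ((green T 1).norm_coe_le_norm t))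
  have hC0 : 0 ≤ C := norm_nonneg _
  have hmem : ∀ k, X (k + 1) ∈ closure (green T '' Metric.closedBall 0 (1 + κ * (C + C) + C)) := by
    intro k
    refine subset_closure ⟨force.comp (X (k + 1)) + κ • (X k - X (k + 1)), ?_, ?_⟩
    · rw [mem_closedBall_zero_iff]
      refine (ContinuousMap.norm_le _ (by positivity)).2 fun t => ?_
      have h1 := abs_force_sub_le (X (k + 1) t) 0
      rw [force_zero, sub_zero, sub_zero] at h1
      have h2 := hbd (k + 1) t
      have h3 := hbd k t
      rw [abs_le] at h1 h2 h3
      simp only [ContinuousMap.add_apply, ContinuousMap.comp_apply, ContinuousMap.smul_apply,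
        ContinuousMap.sub_apply, smul_eq_mul, Real.norm_eq_abs]
      have h5 : 0 ≤ κ := by linarith
      rw [abs_le]
      have h6 : |κ * (X k t - X (k + 1) t)| ≤ κ * (C + C) := by
        rw [abs_mul, abs_of_nonneg h5]
        exact mul_le_mul_of_nonneg_left (abs_le.2 ⟨by linarith, by linarith⟩) h5
      have h7 := abs_le.1 (hbd (k + 1) t)
      have h8 := abs_le.2 h2
      rw [abs_le] at h6
      constructor <;> linarith
    · have := hΦ (X k)
      rw [← hXs] at this
      exact this.symm
  have hcomp : IsCompact (closure (green T '' Metric.closedBall 0 (1 + κ * (C + C) + C))) :=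
    IsCompactOperator.isCompact_closure_image_closedBall (f := (green T : Path T →ₗ[ℝ] Path T))
      (isCompactOperator_fwd.comp_clm (bwd T)) _
  -- Consecutive iterates are extracted together; monotonicity then forces their two limits to
  -- agree, so the limit is a fixed point.
  obtain ⟨⟨y, y'⟩, -, φ, hφ, hlim⟩ := (hcomp.prod hcomp).tendsto_subseq
    (x := fun k => (X (k + 1), X (k + 1 + 1))) fun k => ⟨hmem k, hmem (k + 1)⟩
  have hy : Filter.Tendsto (fun j => X (φ j + 1)) Filter.atTop (nhds y) :=
    (continuous_fst.tendsto _).comp hlim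
  have hy' : Filter.Tendsto (fun j => X (φ j + 1 + 1)) Filter.atTop (nhds y') :=
    (continuous_snd.tendsto _).comp hlim
  have hev : ∀ (t : Time T) {u : ℕ → Path T} {z : Path T}, Filter.Tendsto u Filter.atTop (nhds z) →
      Filter.Tendsto (fun j => u j t) Filter.atTop (nhds (z t)) := fun t u z hu =>
    ((continuous_eval_const t).tendsto _).comp hu
  have heq : y = y' := by
    ext t
    refine le_antisymm (le_of_tendsto_of_tendsto' (hev t hy) (hev t hy') fun j => hle _ t) ?_
    refine le_of_tendsto_of_tendsto' (hev t hy')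
      ((hev t hy).comp (Filter.tendsto_add_atTop_nat 1)) fun j => ?_
    refine hmono ?_ t
    have := hφ (Nat.lt_succ_self j)
    simpa using this
  rw [← heq] at hy'
  refine ⟨y, ?_, c, hc0, fun t => ge_of_tendsto' (hev t hy) fun j => h0 _ t⟩
  have hrep : ∀ j, X (φ j + 1 + 1) = green T (force.comp (X (φ j + 1 + 1)) +
      κ • (X (φ j + 1) - X (φ j + 1 + 1))) := fun j => by
    have := hΦ (X (φ j + 1))
    rw [← hXs] at this
    exact this
  have hlim2 : Filter.Tendsto (fun j => green T (force.comp (X (φ j + 1 + 1)) +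
      κ • (X (φ j + 1) - X (φ j + 1 + 1)))) Filter.atTop
      (nhds (green T (force.comp y + κ • (y - y)))) := by
    refine ((green T).continuous.tendsto _).comp (Filter.Tendsto.add ?_ ((hy.sub hy').const_smul κ))
    exact ((ContinuousMap.continuous_postcomp force).tendsto _).comp hy'
  have := tendsto_nhds_unique (hy'.congr hrep) hlim2
  simpa using this

/-! ### Monotonicity and stability of the positive equilibrium. -/

/-- A positive solution of `-y'' = y / (1 + y²)²`, `y(0) = 0`, `y'(T) = 0`. -/
structure IsPositiveEquilibrium (y : Path T) : Prop where
  eq_green : y = green T (force.comp y)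
  lower : ∃ c > 0, ∀ t, c * sine T t ≤ y t

namespace IsPositiveEquilibrium

variable {y : Path T}

theorem nonneg (hT : 2 < T) (hy : IsPositiveEquilibrium y) (t : Time T) : 0 ≤ y t := by
  obtain ⟨c, hc, h⟩ := hy.lower
  exact (mul_nonneg hc.le (sine_nonneg hT t)).trans (h t)

theorem pos (hT : 2 < T) (hy : IsPositiveEquilibrium y) {t : Time T} (ht : (0 : ℝ) < t) :
    0 < y t := by
  obtain ⟨c, hc, h⟩ := hy.lower
  have hT0 : 0 < T := by linarith
  have := div_le_sine hT t
  have h2 : 0 < (t : ℝ) / T := by positivity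
  exact (mul_pos hc (h2.trans_le this)).trans_le (h t)

theorem bwd_force_pos (hT : 2 < T) (hy : IsPositiveEquilibrium y) {t : Time T}
    (ht : t < t₁ (by linarith)) : 0 < bwd T (force.comp y) t :=
  bwd_pos _ ht fun _ hr => force_pos (hy.pos hT (t.2.1.trans_lt hr.1))

theorem strictMono (hT : 2 < T) (hy : IsPositiveEquilibrium y) : StrictMono y := by
  intro s t hst
  rw [hy.eq_green, green_apply]
  exact fwd_lt_fwd (by linarith) hst fun r hr =>
    hy.bwd_force_pos hT (hr.2.trans_le (le_t₁ _ t))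

/-- A Hopf-type bound: it turns sup-norm control of a right-hand side into control of the solution
by a multiple of `y`, even near `t = 0` where `y` vanishes. -/
theorem exists_green_one_le (hT : 2 < T) (hy : IsPositiveEquilibrium y) :
    ∃ c > 0, ∀ t, c * green T 1 t ≤ y t := by
  obtain ⟨c, hc, h⟩ := hy.lower
  have hT0 : 0 < T := by linarith
  refine ⟨c / T ^ 2, by positivity, fun t => le_trans ?_ (h t)⟩
  rw [div_mul_eq_mul_div, div_le_iff₀ (by positivity)]
  have := green_one_le hT t
  nlinarith

theorem isReply {κ : ℝ} (hy : y = green T (force.comp y)) : IsReply κ y y := by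
  unfold IsReply
  simpa using hy

/-- By sublinearity `l • y` is a supersolution for every moment below it. -/
theorem reply_le (hT : 2 < T) {κ : ℝ} (hκ : 1 < κ) (hy : IsPositiveEquilibrium y) {l : ℝ}
    (hl : 1 ≤ l) {η x : Path T} (hx : IsReply κ η x) (hη : ∀ t, η t ≤ l * y t) (t : Time T) :
    x t ≤ l * y t := by
  refine hx.le_supersolution (by linarith) hκ (x' := l • y) (r' := l • force.comp y) ?_
    (fun s => ?_) t
  · rw [map_smul, ← hy.eq_green]
  · have h1 := force_mul_le hl (hy.nonneg hT s)
    have h2 := mul_nonneg (by linarith : 0 ≤ κ) (sub_nonneg.2 (hη s))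
    simp only [ContinuousMap.smul_apply, ContinuousMap.comp_apply, smul_eq_mul]
    linarith

theorem le_reply (hT : 2 < T) {κ : ℝ} (hκ : 1 < κ) (hy : IsPositiveEquilibrium y) {l : ℝ}
    (hl0 : 0 ≤ l) (hl : l ≤ 1) {η x : Path T} (hx : IsReply κ η x) (hη : ∀ t, l * y t ≤ η t)
    (t : Time T) : l * y t ≤ x t := by
  refine hx.subsolution_le (by linarith) hκ (x' := l • y) (r' := l • force.comp y) ?_
    (fun s => ?_) t
  · rw [map_smul, ← hy.eq_green]
  · have h1 := le_force_mul hl0 hl (hy.nonneg hT s)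
    have h2 := mul_nonneg (by linarith : 0 ≤ κ) (sub_nonneg.2 (hη s))
    simp only [ContinuousMap.smul_apply, ContinuousMap.comp_apply, smul_eq_mul]
    linarith

/-- The reply to a nearby moment deviates from `y` by a small multiple of `y`. -/
theorem exists_abs_reply_sub_le (hT : 2 < T) {κ : ℝ} (hκ : 1 < κ) (hy : IsPositiveEquilibrium y) :
    ∃ C > 0, ∀ η x : Path T, IsReply κ η x → ∀ t, |x t - y t| ≤ C * ‖η - y‖ * y t := by
  have hT0 : 0 ≤ T := by linarith
  obtain ⟨c, hc, hcy⟩ := hy.exists_green_one_le hT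
  have hκ1 : 0 < κ - 1 := by linarith
  have hκ0 : 0 < κ := by linarith
  set A := (1 + κ) * (κ / (κ - 1)) + κ with hA
  have hA0 : 0 < A := by positivity
  refine ⟨A / c, by positivity, fun η x hx t => ?_⟩
  have hsub := sub_eq_green hx (isReply (κ := κ) hy.eq_green)
  set r := force.comp x + κ • (η - x) - (force.comp y + κ • (y - y)) with hr
  have hbound : ∀ s, |r s| ≤ A * ‖η - y‖ := fun s => by
    have h1 := hx.abs_sub_le hT0 hκ (isReply hy.eq_green) s
    have h2 := abs_force_sub_le (x s) (y s)
    have h3 := (η - y).norm_coe_le_norm s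
    rw [Real.norm_eq_abs, ContinuousMap.sub_apply] at h3
    have h4 : r s = (force (x s) - force (y s)) + κ * (η s - y s) - κ * (x s - y s) := by
      simp [hr]; ring
    rw [h4]
    have h5 : |κ * (η s - y s)| ≤ κ * ‖η - y‖ := by
      rw [abs_mul, abs_of_pos hκ0]; gcongr
    have h6 : |κ * (x s - y s)| ≤ κ * (κ / (κ - 1) * ‖η - y‖) := by
      rw [abs_mul, abs_of_pos hκ0]; gcongr
    have h7 := h2.trans h1
    have e : A * ‖η - y‖ = κ / (κ - 1) * ‖η - y‖ + κ * ‖η - y‖ + κ * (κ / (κ - 1) * ‖η - y‖) := by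
      rw [hA]; ring
    rw [e]
    exact (abs_sub _ _).trans (add_le_add ((abs_add_le _ _).trans (add_le_add h7 h5)) h6)
  have hle : ∀ {v : Path T}, (∀ s, v s ≤ A * ‖η - y‖) → green T v t ≤ A / c * ‖η - y‖ * y t := by
    intro v hv
    have h1 := green_mono (w := (A * ‖η - y‖) • (1 : Path T)) (fun s => by simpa using hv s) t
    rw [map_smul, ContinuousMap.smul_apply, smul_eq_mul] at h1
    refine h1.trans ?_
    have h2 := hcy t
    have h3 : green T 1 t ≤ y t / c := by rw [le_div_iff₀ hc]; linarith
    calc A * ‖η - y‖ * green T 1 t ≤ A * ‖η - y‖ * (y t / c) := by gcongr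
      _ = _ := by ring
  have h1 := hle (v := r) fun s => (abs_le.1 (hbound s)).2
  have h2 := hle (v := -r) fun s => by
    have := (abs_le.1 (hbound s)).1
    simp only [ContinuousMap.neg_apply]
    linarith
  rw [map_neg, ← hsub] at h2
  rw [← hsub] at h1
  simp only [ContinuousMap.neg_apply, ContinuousMap.sub_apply] at h1 h2
  exact abs_le.2 ⟨by linarith, h1⟩

/-- Iterated replies to a moment near `y` remain near `y`. -/
theorem stable (hT : 2 < T) {κ : ℝ} (hκ : 1 < κ) (hy : IsPositiveEquilibrium y) {ε : ℝ}
    (hε : 0 < ε) : ∃ δ > 0, ∀ η : ℕ → Path T, ‖η 0 - y‖ < δ →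
      (∀ k, IsReply κ (η k) (η (k + 1))) → ∀ k, ‖η (k + 1) - y‖ < ε := by
  obtain ⟨C, hC, h⟩ := hy.exists_abs_reply_sub_le hT hκ
  -- The bound `1/2` keeps `1 - ε'` nonnegative; the other makes `ε' ‖y‖ < ε`.
  set ε' := min (1 / 2) (ε / (2 * (‖y‖ + 1))) with hε'
  have hy1 : 0 < ‖y‖ + 1 := by positivity
  have hε'0 : 0 < ε' := lt_min (by norm_num) (by positivity)
  have hε'1 : ε' ≤ 1 / 2 := min_le_left _ _
  refine ⟨ε' / C, by positivity, fun η h0 hη k => ?_⟩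
  -- The invariant order interval. The claim starts at index 1: sup-norm closeness does not compare
  -- `η 0` with multiples of `y` near `t = 0`, but one reply does.
  have hk : ∀ k, ∀ t, (1 - ε') * y t ≤ η (k + 1) t ∧ η (k + 1) t ≤ (1 + ε') * y t := by
    intro k
    induction k with
    | zero =>
      intro t
      have h1 := h _ _ (hη 0) t
      have h2 : C * ‖η 0 - y‖ ≤ ε' := by
        rw [lt_div_iff₀ hC] at h0
        linarith
      have h3 := h1.trans (mul_le_mul_of_nonneg_right h2 (hy.nonneg hT t))
      rw [abs_le] at h3
      constructor <;> linarith
    | succ k ih =>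
      exact fun t => ⟨hy.le_reply hT hκ (by linarith) (by linarith) (hη _) (fun t => (ih t).1) t,
        hy.reply_le hT hκ (by linarith) (hη _) (fun t => (ih t).2) t⟩
  have h1 : ‖η (k + 1) - y‖ ≤ ε' * ‖y‖ := by
    refine (ContinuousMap.norm_le _ (by positivity)).2 fun t => ?_
    have h2 := hk k t
    have h3 := (le_abs_self _).trans (y.norm_coe_le_norm t)
    have h4 : ε' * y t ≤ ε' * ‖y‖ := by gcongr
    rw [Real.norm_eq_abs, ContinuousMap.sub_apply, abs_le]
    constructor <;> linarith
  have h2 : ε' ≤ ε / (2 * (‖y‖ + 1)) := min_le_right _ _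
  rw [le_div_iff₀ (by positivity)] at h2
  nlinarith [norm_nonneg y]

end IsPositiveEquilibrium

/-! ### Nondegeneracy of the equilibria. -/

/-- Backward uniqueness: a solution of `-x'' = q x`, `x'(T) = 0`, `x(T) = 0` vanishes. -/
theorem eq_zero_of_eq_green_mul_of_final (hT : 0 ≤ T) {q x : Path T} (hq : ∀ t, |q t| ≤ 1)
    (hx : x = green T (q * x)) (h1 : x (t₁ hT) = 0) : x = 0 := by
  set g := bwd T (q * x) with hg
  have hxg : x = fwd T g := hx
  obtain ⟨F, hF, hFx⟩ := exists_hasDerivAt_fwd hT g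
  obtain ⟨G, hG, hGx⟩ := exists_hasDerivAt_bwd hT (q * x)
  rw [← hxg] at hFx
  rw [← hg] at hGx
  have hd : ∀ s : ℝ, HasDerivAt (fun s => (F s ^ 2 + G s ^ 2) * Real.exp (2 * s))
      ((2 * F s * IccExtend hT g s + 2 * G s * -IccExtend hT (q * x) s) * Real.exp (2 * s) +
        (F s ^ 2 + G s ^ 2) * (Real.exp (2 * s) * 2)) s := fun s => by
    have h2 := ((hF s).fun_pow 2).fun_add ((hG s).fun_pow 2)
    have h3 : HasDerivAt (fun s : ℝ => Real.exp (2 * s)) (Real.exp (2 * s) * 2) s := by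
      simpa using ((hasDerivAt_id s).const_mul 2).exp
    simpa using h2.fun_mul h3
  -- Grönwall run backward: `x² + x'²` weighted by `e^{2s}` is nondecreasing because `|q| ≤ 1`, and
  -- it vanishes at `T`.
  have hmono : MonotoneOn (fun s => (F s ^ 2 + G s ^ 2) * Real.exp (2 * s)) (Icc 0 T) := by
    refine monotoneOn_of_deriv_nonneg (convex_Icc 0 T)
      (fun s _ => (hd s).continuousAt.continuousWithinAt)
      (fun s _ => (hd s).differentiableAt.differentiableWithinAt) fun s hs => ?_
    rw [interior_Icc] at hs
    have hs' : s ∈ Icc 0 T := ⟨hs.1.le, hs.2.le⟩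
    rw [(hd s).deriv, IccExtend_of_mem hT _ hs', IccExtend_of_mem hT _ hs']
    have e1 : F s = x ⟨s, hs'⟩ := hFx ⟨s, hs'⟩
    have e2 : G s = g ⟨s, hs'⟩ := hGx ⟨s, hs'⟩
    rw [e1, e2, ContinuousMap.mul_apply]
    set a := x ⟨s, hs'⟩
    set b := g ⟨s, hs'⟩
    have hq1 := abs_le.1 (hq ⟨s, hs'⟩)
    set k := q ⟨s, hs'⟩
    have he := Real.exp_pos (2 * s)
    have : 0 ≤ 2 * a * b + 2 * b * -(k * a) + 2 * (a ^ 2 + b ^ 2) := by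
      have h3 : |(1 - k) * (a * b)| ≤ 2 * |a * b| := by
        rw [abs_mul]
        exact mul_le_mul_of_nonneg_right (abs_le.2 ⟨by linarith, by linarith⟩) (abs_nonneg _)
      have h4 : 2 * |a * b| ≤ a ^ 2 + b ^ 2 := by
        rw [abs_mul, ← sq_abs a, ← sq_abs b]
        nlinarith [sq_nonneg (|a| - |b|)]
      have h5 := (abs_le.1 h3).1
      nlinarith
    nlinarith
  ext t
  have h2 := hmono t.2 (t₁ hT).2 t.2.2
  have e1 : F (t₁ hT) = 0 := by rw [hFx, h1]
  have e2 : G (t₁ hT) = 0 := by rw [hGx, hg, bwd_t₁]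
  simp only [e1, e2, hFx] at h2
  have h3 : (x t ^ 2 + G t ^ 2) ≤ 0 := by
    by_contra! hlt
    have := mul_pos hlt (Real.exp_pos (2 * (t : ℝ)))
    simp at h2
    linarith
  have h4 : x t ^ 2 = 0 := by nlinarith [sq_nonneg (x t), sq_nonneg (G t)]
  simpa using h4

/-- Sturm comparison. Normalize `x(T) > 0` and let `a` be the last time with `x ≤ 0`. The Wronskian
`y x' - x y'` has derivative `x (force y - stiffness y · y) > 0` on `(a, T)`, yet it is nonnegative
at `a` and zero at `T`. -/
theorem IsPositiveEquilibrium.nondegenerate (hT : 2 < T) {y x : Path T}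
    (hy : IsPositiveEquilibrium y) (hx : x = green T (stiffness.comp y * x)) : x = 0 := by
  have hT0 : 0 ≤ T := by linarith
  by_contra hne
  have hxT : x (t₁ hT0) ≠ 0 := fun h =>
    hne (eq_zero_of_eq_green_mul_of_final hT0 (fun t => abs_stiffness_le _) hx h)
  wlog hpos : 0 < x (t₁ hT0) generalizing x
  · refine this (x := -x) ?_ (by simpa using hne) (by simpa using hxT) ?_
    · rw [mul_neg, map_neg, ← hx]
    · have := lt_of_le_of_ne (not_lt.1 hpos) hxT
      simpa using this
  obtain ⟨a, ⟨-, ha⟩, hmax⟩ := (isCompact_Iic_inter_le x (t₁ hT0) 0).exists_isGreatest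
    ⟨t₀ hT0, t₀_le hT0 _, by rw [hx, green_apply, fwd_t₀]⟩
  have ha1 : a < t₁ hT0 := lt_of_le_of_ne (le_t₁ _ a) (by rintro rfl; linarith)
  have hxpos : ∀ s, a < s → 0 < x s := fun s hs => by
    by_contra! h
    exact absurd (hmax ⟨le_t₁ _ s, h⟩) (not_le.2 hs)
  set g := bwd T (stiffness.comp y * x) with hg
  set Y := bwd T (force.comp y) with hY
  have hxg : x = fwd T g := hx
  have hyY : y = fwd T Y := hy.eq_green
  obtain ⟨F, hF, hFx⟩ := exists_hasDerivAt_fwd hT0 g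
  obtain ⟨G, hG, hGx⟩ := exists_hasDerivAt_bwd hT0 (stiffness.comp y * x)
  obtain ⟨P, hP, hPx⟩ := exists_hasDerivAt_fwd hT0 Y
  obtain ⟨Q, hQ, hQx⟩ := exists_hasDerivAt_bwd hT0 (force.comp y)
  rw [← hxg] at hFx
  rw [← hg] at hGx
  rw [← hyY] at hPx
  rw [← hY] at hQx
  -- The slopes of `x` to the right of `a` are nonnegative, since `x a ≤ 0 < x s` for `s > a`.
  have hga : 0 ≤ g a := by
    have h1 := hF a
    rw [IccExtend_val] at h1
    have h2 := h1.hasDerivWithinAt (s := Ioi (a : ℝ))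
    rw [hasDerivWithinAt_iff_tendsto_slope' (by simp)] at h2
    refine ge_of_tendsto h2 ?_
    filter_upwards [Ioo_mem_nhdsGT (show (a : ℝ) < T from ha1)] with s hs
    have h3 := hxpos ⟨s, a.2.1.trans hs.1.le, hs.2.le⟩ hs.1
    rw [← hFx] at h3
    rw [slope_def_field, hFx a]
    have h4 : 0 < s - a := sub_pos.2 hs.1
    simp only at h3
    have h5 : x a ≤ 0 := ha
    exact div_nonneg (by linarith) h4.le
  have hYa : 0 ≤ Y a := (hy.bwd_force_pos hT ha1).le
  set v : Path T := x * (force.comp y - stiffness.comp y * y) with hv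
  have hW : ∀ t : Time T, HasDerivAt (fun s => P s * G s - F s * Q s) (v t) t := fun t => by
    refine (((hP t).fun_mul (hG t)).fun_sub ((hF t).fun_mul (hQ t))).congr_deriv ?_
    simp only [IccExtend_val, hFx, hGx, hPx, hQx, hv, ContinuousMap.mul_apply,
      ContinuousMap.sub_apply, ContinuousMap.comp_apply]
    ring
  have h1 := fwd_eq_sub_of_hasDerivAt hT0 hW a
  have h2 := fwd_eq_sub_of_hasDerivAt hT0 hW (t₁ hT0)
  simp only [hFx, hGx, hPx, hQx, hg, hY, bwd_t₁] at h1 h2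
  rw [← hg, ← hY] at h1
  have h3 := fwd_lt_fwd hT0 (v := v) ha1 fun r hr =>
    mul_pos (hxpos r hr.1) (sub_pos.2 (stiffness_mul_lt_force (hy.pos hT (a.2.1.trans_lt hr.1))))
  have h4 := mul_nonneg (hy.nonneg hT a) hga
  have h5 : x a * Y a ≤ 0 := mul_nonpos_of_nonpos_of_nonneg ha hYa
  linarith

/-- For `-x'' = x` the rotated pair `x cos - x' sin`, `x sin + x' cos` is constant. The first entry
is 0 by `x(0) = 0`; with `x'(T) = 0` this reads `x(T) cos T = 0`, and then the second entry vanishes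
too. -/
theorem eq_zero_of_eq_green (hT : 0 ≤ T) (hcos : Real.cos T ≠ 0) {x : Path T}
    (hx : x = green T x) : x = 0 := by
  set g := bwd T x with hg
  have hxg : x = fwd T g := hx
  obtain ⟨F, hF, hFx⟩ := exists_hasDerivAt_fwd hT g
  obtain ⟨G, hG, hGx⟩ := exists_hasDerivAt_bwd hT x
  rw [← hxg] at hFx
  rw [← hg] at hGx
  have hα : ∀ t : Time T, HasDerivAt (fun s => F s * Real.cos s - G s * Real.sin s)
      ((0 : Path T) t) t := fun t => by
    refine (((hF t).fun_mul (Real.hasDerivAt_cos t)).fun_sub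
      ((hG t).fun_mul (Real.hasDerivAt_sin t))).congr_deriv ?_
    simp only [IccExtend_val, hFx, hGx, ContinuousMap.zero_apply]
    ring
  have hβ : ∀ t : Time T, HasDerivAt (fun s => F s * Real.sin s + G s * Real.cos s)
      ((0 : Path T) t) t := fun t => by
    refine (((hF t).fun_mul (Real.hasDerivAt_sin t)).fun_add
      ((hG t).fun_mul (Real.hasDerivAt_cos t))).congr_deriv ?_
    simp only [IccExtend_val, hFx, hGx, ContinuousMap.zero_apply]
    ring
  have hF0 : F 0 = 0 := by
    have := hFx (t₀ hT)
    rw [hxg, fwd_t₀] at this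
    exact this
  have h1 : ∀ t : Time T, x t * Real.cos t - g t * Real.sin t = 0 := fun t => by
    have := fwd_eq_sub_of_hasDerivAt hT hα t
    simp [hF0, hFx, hGx] at this
    linarith
  have h2 : ∀ t : Time T, x t * Real.sin t + g t * Real.cos t = G 0 := fun t => by
    have := fwd_eq_sub_of_hasDerivAt hT hβ t
    simp [hF0, hFx, hGx] at this
    linarith
  have hgT : g (t₁ hT) = 0 := bwd_t₁ hT x
  have hxT : x (t₁ hT) = 0 := by
    have := h1 (t₁ hT)
    rw [hgT, zero_mul, sub_zero] at this
    exact (mul_eq_zero.1 this).resolve_right hcos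
  have hG0 : G 0 = 0 := by
    have := h2 (t₁ hT)
    rw [hgT, hxT] at this
    linarith
  ext t
  have e1 := h1 t
  have e2 := h2 t
  rw [hG0] at e2
  have := Real.sin_sq_add_cos_sq (t : ℝ)
  calc x t = x t * (Real.sin t ^ 2 + Real.cos t ^ 2) := by rw [this, mul_one]
    _ = (x t * Real.cos t - g t * Real.sin t) * Real.cos t +
      (x t * Real.sin t + g t * Real.cos t) * Real.sin t := by ring
    _ = (0 : Path T) t := by rw [e1, e2]; simp

/-! ### Perturbations of the data that are small in `𝒞²`. -/

/-- `g` is `𝒞²`-small on `S`, with derivative `D`, in the integrated form used for estimates. -/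
structure IsC2Small {E : Type*} [NormedAddCommGroup E] [NormedSpace ℝ E] (S : Set E) (g : E → ℝ)
    (D : E → E →L[ℝ] ℝ) (r : ℝ) : Prop where
  abs_le : ∀ z ∈ S, |g z| ≤ r
  norm_le : ∀ z ∈ S, ‖D z‖ ≤ r
  abs_sub_le : ∀ z ∈ S, ∀ z' ∈ S, |g z' - g z| ≤ r * ‖z' - z‖
  norm_sub_le : ∀ z ∈ S, ∀ z' ∈ S, ‖D z' - D z‖ ≤ r * ‖z' - z‖
  taylor : ∀ z ∈ S, ∀ z' ∈ S, |g z' - g z - D z (z' - z)| ≤ r * ‖z' - z‖ ^ 2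

theorem IsC2Small.continuousOn {E : Type*} [NormedAddCommGroup E] [NormedSpace ℝ E] {S : Set E}
    {g : E → ℝ} {D : E → E →L[ℝ] ℝ} {r : ℝ} (h : IsC2Small S g D r) : ContinuousOn g S := by
  refine (LipschitzOnWith.of_dist_le_mul (K := Real.toNNReal r) fun x hx y hy => ?_).continuousOn
  rw [Real.dist_eq, dist_eq_norm]
  exact (h.abs_sub_le y hy x hx).trans
    (mul_le_mul_of_nonneg_right (Real.le_coe_toNNReal r) (norm_nonneg _))

theorem IsC2Small.continuousOn_apply {E : Type*} [NormedAddCommGroup E] [NormedSpace ℝ E]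
    {S : Set E} {g : E → ℝ} {D : E → E →L[ℝ] ℝ} {r : ℝ} (h : IsC2Small S g D r) (v : E) :
    ContinuousOn (fun z => D z v) S := by
  have : ContinuousOn D S := by
    refine (LipschitzOnWith.of_dist_le_mul (K := Real.toNNReal r)
      fun x hx y hy => ?_).continuousOn
    rw [dist_eq_norm, dist_eq_norm]
    exact (h.norm_sub_le y hy x hx).trans
      (mul_le_mul_of_nonneg_right (Real.le_coe_toNNReal r) (norm_nonneg _))
  exact this.clm_apply continuousOn_const

theorem IsC2Small.abs_apply_le {E : Type*} [NormedAddCommGroup E] [NormedSpace ℝ E]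
    {S : Set E} {g : E → ℝ} {D : E → E →L[ℝ] ℝ} {r : ℝ} (h : IsC2Small S g D r) {v : E}
    (hv : ‖v‖ ≤ 1) (z : E) (hz : z ∈ S) : |D z v| ≤ r := by
  have h1 := (D z).le_opNorm v
  rw [Real.norm_eq_abs] at h1
  exact h1.trans ((mul_le_of_le_one_right (norm_nonneg _) hv).trans (h.norm_le z hz))

theorem IsC2Small.abs_apply_sub_le {E : Type*} [NormedAddCommGroup E] [NormedSpace ℝ E]
    {S : Set E} {g : E → ℝ} {D : E → E →L[ℝ] ℝ} {r : ℝ} (h : IsC2Small S g D r) {v : E}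
    (hv : ‖v‖ ≤ 1) (z : E) (hz : z ∈ S) (z' : E) (hz' : z' ∈ S) :
    |D z' v - D z v| ≤ r * ‖z' - z‖ := by
  have h1 := (D z' - D z).le_opNorm v
  rw [Real.norm_eq_abs, sub_apply] at h1
  exact h1.trans ((mul_le_of_le_one_right (norm_nonneg _) hv).trans (h.norm_sub_le z hz z' hz'))

/-- Mean value inequalities on the convex set `S`, for the function and for its derivative. The
Taylor bound comes from the segment, along which the derivative moves by at most `δ ‖z' - z‖`. -/
theorem IsC2Near.exists_isC2Small {E : Type*} [NormedAddCommGroup E] [NormedSpace ℝ E] {S : Set E}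
    (hS : UniqueDiffOn ℝ S) (hconv : Convex ℝ S) {g h : E → ℝ} {δ : ℝ} (hg : IsC2Near S g h δ)
    (hh : ContDiffOn ℝ 2 h S) : ∃ D, IsC2Small S (fun z => g z - h z) D δ := by
  obtain ⟨hgC, r, hrδ, hr⟩ := hg
  set k : E → ℝ := fun z => g z - h z with hk
  have hkC : ContDiffOn ℝ 2 k S := hgC.sub hh
  have hd : DifferentiableOn ℝ k S := hkC.differentiableOn (by norm_num)
  have hD : DifferentiableOn ℝ (fderivWithin ℝ k S) S :=
    (hkC.fderivWithin hS (m := 1) (by norm_num)).differentiableOn (by norm_num)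
  have h0 : ∀ z ∈ S, |k z| ≤ δ := fun z hz => by
    have := hr 0 (by norm_num) z hz
    rw [norm_iteratedFDerivWithin_zero] at this
    exact this.trans hrδ.le
  have h1 : ∀ z ∈ S, ‖fderivWithin ℝ k S z‖ ≤ δ := fun z hz => by
    have := hr 1 (by norm_num) z hz
    rw [norm_iteratedFDerivWithin_one _ (hS z hz)] at this
    exact this.trans hrδ.le
  have h2 : ∀ z ∈ S, ‖fderivWithin ℝ (fderivWithin ℝ k S) S z‖ ≤ δ := fun z hz => by
    have := hr 2 le_rfl z hz
    rw [← norm_iteratedFDerivWithin_fderivWithin hS hz,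
      norm_iteratedFDerivWithin_one _ (hS z hz)] at this
    exact this.trans hrδ.le
  have h3 : ∀ z ∈ S, ∀ z' ∈ S, ‖fderivWithin ℝ k S z' - fderivWithin ℝ k S z‖ ≤ δ * ‖z' - z‖ :=
    fun z hz z' hz' => hconv.norm_image_sub_le_of_norm_fderivWithin_le hD h2 hz hz'
  refine ⟨fderivWithin ℝ k S, h0, h1, fun z hz z' hz' =>
    hconv.norm_image_sub_le_of_norm_fderivWithin_le hd h1 hz hz', h3, fun z hz z' hz' => ?_⟩
  have hsub : segment ℝ z z' ⊆ S := hconv.segment_subset hz hz'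
  have hδ : 0 ≤ δ := (abs_nonneg _).trans (h0 z hz)
  have := (convex_segment z z').norm_image_sub_le_of_norm_hasFDerivWithin_le'
    (φ := fderivWithin ℝ k S z) (C := δ * ‖z' - z‖)
    (fun w hw => ((hd w (hsub hw)).hasFDerivWithinAt).mono hsub) (fun w hw => ?_)
    (left_mem_segment ℝ z z') (right_mem_segment ℝ z z')
  · rw [Real.norm_eq_abs] at this
    rwa [sq, ← mul_assoc]
  · refine (h3 z hz w (hsub hw)).trans (mul_le_mul_of_nonneg_left
      (norm_sub_le_of_mem_segment hw) hδ)

/-- The domain of the dynamics and of the running cost. -/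
def dom (T : ℝ) : Set (ℝ × ℝ × ℝ × ℝ) := Icc (0 : ℝ) T ×ˢ univ

/-- The domain of the moment function. -/
def domφ (T : ℝ) : Set (ℝ × ℝ) := Icc (0 : ℝ) T ×ˢ univ

theorem mem_dom (t : Time T) (x u η : ℝ) : ((t : ℝ), x, u, η) ∈ dom T := ⟨t.2, trivial⟩

theorem mem_domφ (t : Time T) (x : ℝ) : ((t : ℝ), x) ∈ domφ T := ⟨t.2, trivial⟩

/-- The state direction. -/
def dirX : ℝ × ℝ × ℝ × ℝ := (0, 1, 0, 0)

/-- The control direction. -/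
def dirU : ℝ × ℝ × ℝ × ℝ := (0, 0, 1, 0)

theorem norm_dirX : ‖dirX‖ ≤ 1 := by simp [dirX]

theorem norm_dirU : ‖dirU‖ ≤ 1 := by simp [dirU]

/-- The data of `G` are those of the barycenter game plus `𝒞²`-small perturbations. -/
structure IsPerturbation (κ δ : ℝ) (G : ScalarGame T) (Df Dl : ℝ × ℝ × ℝ × ℝ → ℝ × ℝ × ℝ × ℝ →L[ℝ] ℝ)
    (Dψ : ℝ → ℝ →L[ℝ] ℝ) (Dφ : ℝ × ℝ → ℝ × ℝ →L[ℝ] ℝ) : Prop where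
  f : IsC2Small (dom T) (fun z => G.f z.1 z.2.1 z.2.2.1 z.2.2.2 - z.2.2.1) Df δ
  L : IsC2Small (dom T) (fun z => G.L z.1 z.2.1 z.2.2.1 z.2.2.2 -
    (z.2.2.1 ^ 2 + 1 / (1 + z.2.1 ^ 2) + κ * (z.2.1 - z.2.2.2) ^ 2)) Dl δ
  ψ : IsC2Small univ G.ψ Dψ δ
  φ : IsC2Small (domφ T) (fun z => G.φ z.1 z.2 - z.2) Dφ δ

theorem ScalarGame.IsNear.exists_isPerturbation {κ δ : ℝ} {hT : 0 ≤ T} (hT0 : 0 < T)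
    {G : ScalarGame T} (h : (barycenterGame κ T hT).IsNear G δ) :
    ∃ Df Dl Dψ Dφ, IsPerturbation κ δ G Df Dl Dψ Dφ := by
  have hI : UniqueDiffOn ℝ (Icc (0 : ℝ) T) := uniqueDiffOn_Icc hT0
  have hcI : Convex ℝ (Icc (0 : ℝ) T) := convex_Icc 0 T
  obtain ⟨Df, hf⟩ := h.f_near.exists_isC2Small (hI.prod uniqueDiffOn_univ)
    (hcI.prod convex_univ) (by
      simp only [barycenterGame]
      exact ContDiff.contDiffOn (by fun_prop))
  obtain ⟨Dl, hl⟩ := h.L_near.exists_isC2Small (hI.prod uniqueDiffOn_univ)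
    (hcI.prod convex_univ) (by
      simp only [barycenterGame, sq_abs]
      refine ContDiff.contDiffOn (ContDiff.add (ContDiff.add (by fun_prop) ?_) (by fun_prop))
      exact contDiff_const.div (by fun_prop) fun z => by positivity)
  obtain ⟨Dψ, hψ⟩ := h.ψ_near.exists_isC2Small uniqueDiffOn_univ convex_univ
    (by
      simp only [barycenterGame]
      exact contDiff_const.contDiffOn)
  obtain ⟨Dφ, hφ⟩ := h.φ_near.exists_isC2Small (hI.prod uniqueDiffOn_univ)
    (hcI.prod convex_univ) (by
      simp only [barycenterGame]
      exact ContDiff.contDiffOn (by fun_prop))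
  refine ⟨Df, Dl, Dψ, Dφ, hf, ?_, ?_, hφ⟩
  · simpa only [barycenterGame, sq_abs, dom] using hl
  · simpa only [barycenterGame, sub_zero] using hψ

/-- With `δ = 0` the optimality results for perturbed games cover the original game as well. -/
theorem barycenterGame_isPerturbation {κ δ : ℝ} (hδ : 0 ≤ δ) (hT : 0 ≤ T) :
    IsPerturbation κ δ (barycenterGame κ T hT) 0 0 0 0 := by
  have h0 : ∀ {E : Type} [NormedAddCommGroup E] [NormedSpace ℝ E] (S : Set E),
      IsC2Small S (fun _ => 0) 0 δ := fun S => by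
    refine ⟨fun _ _ => ?_, fun _ _ => ?_, fun _ _ _ _ => ?_, fun _ _ _ _ => ?_, fun _ _ _ _ => ?_⟩
      <;> simp <;> positivity
  refine ⟨?_, ?_, ?_, ?_⟩
  · simpa only [barycenterGame, sub_self] using h0 (dom T)
  · simpa only [barycenterGame, sq_abs, sub_self] using h0 (dom T)
  · exact h0 univ
  · simpa only [barycenterGame, sub_self] using h0 (domφ T)

/-- The superposition operator `(x, u, η) ↦ g(t, x(t), u(t), η(t))`. -/
def superpose {g : ℝ × ℝ × ℝ × ℝ → ℝ} (hg : ContinuousOn g (dom T)) (x u η : Path T) : Path T :=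
  ⟨fun t => g (t, x t, u t, η t), hg.comp_continuous (by fun_prop) fun t => mem_dom t _ _ _⟩

/-! ### Pontryagin extremals are optimal. -/

/-- The Pontryagin system for the player starting at `a`, with costate `p`. -/
structure IsExtremal (κ : ℝ) (G : ScalarGame T) (Df Dl : ℝ × ℝ × ℝ × ℝ → ℝ × ℝ × ℝ × ℝ →L[ℝ] ℝ)
    (Dψ : ℝ → ℝ →L[ℝ] ℝ) (η : Path T) (a : ℝ) (x p u ρ : Path T) : Prop where
  state : ∀ t, x t = a + ∫ s in Iic t, G.f s (x s) (u s) (η s)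
  force_eq : ∀ t, ρ t = -2 * force (x t) + 2 * κ * (x t - η t) +
    (Dl (t, x t, u t, η t) dirX + p t * Df (t, x t, u t, η t) dirX)
  costate : ∀ t, p t = Dψ (x (t₁ G.T_nonneg)) 1 + bwd T ρ t
  stationary : ∀ t, 2 * u t + p t +
    (Dl (t, x t, u t, η t) dirU + p t * Df (t, x t, u t, η t) dirU) = 0

/-- Tangent line inequality for `1/(1+x²) + x²`, which is convex because the second derivative of
`1/(1+x²)` is at least `-2`. -/
theorem inv_one_add_sq_sub_ge (a b : ℝ) :
    -(b - a) ^ 2 ≤ 1 / (1 + b ^ 2) - 1 / (1 + a ^ 2) + 2 * force a * (b - a) := by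
  have e : 1 / (1 + b ^ 2) - 1 / (1 + a ^ 2) + 2 * force a * (b - a) + (b - a) ^ 2 =
      (b - a) ^ 2 * ((1 + a ^ 2) ^ 2 * (1 + b ^ 2) - (1 - 2 * a * b - a ^ 2)) /
        ((1 + a ^ 2) ^ 2 * (1 + b ^ 2)) - 0 := by
    rw [force_apply]
    have h1 : 1 + a ^ 2 ≠ 0 := by positivity
    have h2 : 1 + b ^ 2 ≠ 0 := by positivity
    field_simp
    ring
  have : 0 ≤ (1 + a ^ 2) ^ 2 * (1 + b ^ 2) - (1 - 2 * a * b - a ^ 2) := by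
    nlinarith [sq_nonneg (a + b), sq_nonneg a, sq_nonneg b, sq_nonneg (a * b), sq_nonneg (a ^ 2),
      sq_nonneg (a ^ 2 * b)]
  have h3 : 0 ≤ (b - a) ^ 2 * ((1 + a ^ 2) ^ 2 * (1 + b ^ 2) - (1 - 2 * a * b - a ^ 2)) /
        ((1 + a ^ 2) ^ 2 * (1 + b ^ 2)) := by positivity
  linarith

theorem norm_increment_sq_le (e v : ℝ) : ‖((0 : ℝ), e, v, (0 : ℝ))‖ ^ 2 ≤ e ^ 2 + v ^ 2 := by
  have : ‖((0 : ℝ), e, v, (0 : ℝ))‖ = max |e| |v| := by simp [Prod.norm_def]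
  rw [this, ← sq_abs e, ← sq_abs v]
  rcases max_choice |e| |v| with h | h <;> rw [h]
  · exact le_add_of_nonneg_right (sq_nonneg _)
  · exact le_add_of_nonneg_left (sq_nonneg _)

theorem norm_increment_le (e v : ℝ) : ‖((0 : ℝ), e, v, (0 : ℝ))‖ ≤ |e| + |v| := by
  simp [Prod.norm_def]

theorem increment_eq (t x x' u u' η : ℝ) :
    ((t, x', u', η) - (t, x, u, η) : ℝ × ℝ × ℝ × ℝ) = (0, x' - x, u' - u, 0) := by
  simp

theorem clm_increment (D : ℝ × ℝ × ℝ × ℝ →L[ℝ] ℝ) (e v : ℝ) :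
    D (0, e, v, 0) = e * D dirX + v * D dirU := by
  have : ((0 : ℝ), e, v, (0 : ℝ)) = e • dirX + v • dirU := by simp [dirX, dirU]
  rw [this, map_add, map_smul, map_smul, smul_eq_mul, smul_eq_mul]

/-- Convexity of the Hamiltonian along an extremal. -/
theorem hamiltonian_increment_ge {κ δ P : ℝ} {g l : ℝ × ℝ × ℝ × ℝ → ℝ}
    {Dg Dl : ℝ × ℝ × ℝ × ℝ → ℝ × ℝ × ℝ × ℝ →L[ℝ] ℝ} (hg : IsC2Small (dom T) g Dg δ)
    (hl : IsC2Small (dom T) l Dl δ) (t : Time T) {x u η p x' u' : ℝ} (hp : |p| ≤ P)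
    (hst : 2 * u + p + (Dl (t, x, u, η) dirU + p * Dg (t, x, u, η) dirU) = 0) :
    (κ - 1 - δ * (1 + P)) * (x' - x) ^ 2 + (1 - δ * (1 + P)) * (u' - u) ^ 2 ≤
      (u' ^ 2 + 1 / (1 + x' ^ 2) + κ * (x' - η) ^ 2 + l (t, x', u', η)) -
      (u ^ 2 + 1 / (1 + x ^ 2) + κ * (x - η) ^ 2 + l (t, x, u, η)) +
      p * ((u' + g (t, x', u', η)) - (u + g (t, x, u, η))) -
      (-2 * force x + 2 * κ * (x - η) + (Dl (t, x, u, η) dirX + p * Dg (t, x, u, η) dirX)) *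
        (x' - x) := by
  have h1 := hg.taylor _ (mem_dom t x u η) _ (mem_dom t x' u' η)
  have h2 := hl.taylor _ (mem_dom t x u η) _ (mem_dom t x' u' η)
  rw [increment_eq, clm_increment] at h1 h2
  have hδ : 0 ≤ δ := (abs_nonneg _).trans (hg.abs_le _ (mem_dom t 0 0 0))
  have h3 := mul_le_mul_of_nonneg_left (norm_increment_sq_le (x' - x) (u' - u)) hδ
  have h4 := (abs_le.1 (h2.trans h3)).1
  have h5 : |p * (g (t, x', u', η) - g (t, x, u, η) -
      ((x' - x) * Dg (t, x, u, η) dirX + (u' - u) * Dg (t, x, u, η) dirU))| ≤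
      P * (δ * ((x' - x) ^ 2 + (u' - u) ^ 2)) := by
    rw [abs_mul]
    exact mul_le_mul hp (h1.trans h3) (abs_nonneg _) ((abs_nonneg _).trans hp)
  have h6 := (abs_le.1 h5).1
  have h7 := inv_one_add_sq_sub_ge x x'
  have h8 : (u' - u) * (2 * u + p + (Dl (t, x, u, η) dirU + p * Dg (t, x, u, η) dirU)) = 0 := by
    rw [hst, mul_zero]
  nlinarith

theorem integrable_superpose_add {g : ℝ × ℝ × ℝ × ℝ → ℝ} (hg : ContinuousOn g (dom T))
    (x u η : Path T) : Integrable (fun t : Time T => g (t, x t, u t, η t)) volume :=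
  integrable_path (superpose hg x u η)

/-- Cauchy-Schwarz on `[0, T]`. -/
theorem sq_integral_le (hT : 0 < T) {w : Time T → ℝ} (hw : Integrable w volume)
    (hw2 : Integrable (fun t => w t ^ 2) volume) :
    (∫ t, w t) ^ 2 ≤ T * ∫ t, w t ^ 2 := by
  set c := (∫ t, w t) / T with hc
  have h1 : 0 ≤ ∫ t, (w t - c) ^ 2 := integral_nonneg fun t => sq_nonneg _
  have h2 : ∫ t, (w t - c) ^ 2 = (∫ t, w t ^ 2) - 2 * c * (∫ t, w t) + T * c ^ 2 := by
    have : ∀ t, (w t - c) ^ 2 = w t ^ 2 - 2 * c * w t + c ^ 2 := fun t => by ring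
    simp only [this]
    have h3 : Integrable (fun t => w t ^ 2 - 2 * c * w t) volume := hw2.sub (hw.const_mul _)
    rw [integral_add h3 (integrable_const _),
      integral_sub hw2 (hw.const_mul _), integral_const_mul, integral_const,
      volume_real_univ hT.le, smul_eq_mul]
  rw [h2] at h1
  have h3 : ∫ t, w t = T * c := by rw [hc]; field_simp
  rw [h3] at h1 ⊢
  nlinarith

theorem IsPerturbation.isAdmissible {κ δ : ℝ} {G : ScalarGame T}
    {Df Dl : ℝ × ℝ × ℝ × ℝ → ℝ × ℝ × ℝ × ℝ →L[ℝ] ℝ} {Dψ : ℝ → ℝ →L[ℝ] ℝ}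
    {Dφ : ℝ × ℝ → ℝ × ℝ →L[ℝ] ℝ} (hG : IsPerturbation κ δ G Df Dl Dψ Dφ) {η x u : Path T}
    {a : ℝ} (h : ∀ t, x t = a + ∫ s in Iic t, G.f s (x s) (u s) (η s)) :
    G.IsAdmissible η a x u := by
  have hfi : Integrable (fun s : Time T => G.f s (x s) (u s) (η s)) volume := by
    have := (integrable_superpose_add hG.f.continuousOn x u η).add (integrable_path u)
    refine this.congr (Filter.Eventually.of_forall fun s => ?_)
    simp
  have hLi : Integrable (fun s : Time T => G.L s (x s) (u s) (η s)) volume := by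
    have h1 := integrable_superpose_add hG.L.continuousOn x u η
    have h2 : ContinuousOn (fun z : ℝ × ℝ × ℝ × ℝ =>
        z.2.2.1 ^ 2 + 1 / (1 + z.2.1 ^ 2) + κ * (z.2.1 - z.2.2.2) ^ 2) (dom T) := by
      refine Continuous.continuousOn (((by fun_prop : Continuous _).add
        (continuous_const.div (by fun_prop) fun z => by positivity)).add (by fun_prop))
    refine (h1.add (integrable_superpose_add h2 x u η)).congr
      (Filter.Eventually.of_forall fun s => ?_)
    simp
  exact ⟨u.continuous.aestronglyMeasurable.aemeasurable, hfi, h, hLi⟩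

/-- Sufficiency of the Pontryagin system, with a quantitative gain. -/
theorem IsExtremal.cost_gain (hT : 0 < T) {κ δ P : ℝ} {G : ScalarGame T}
    {Df Dl : ℝ × ℝ × ℝ × ℝ → ℝ × ℝ × ℝ × ℝ →L[ℝ] ℝ} {Dψ : ℝ → ℝ →L[ℝ] ℝ}
    {Dφ : ℝ × ℝ → ℝ × ℝ →L[ℝ] ℝ} (hG : IsPerturbation κ δ G Df Dl Dψ Dφ) {η x p u ρ : Path T}
    {a : ℝ} (h : IsExtremal κ G Df Dl Dψ η a x p u ρ) (hp : ∀ t, |p t| ≤ P) (hδ1 : δ ≤ 1)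
    (hδ : δ * (1 + P + 8 * T) ≤ 1 / 2) (hδκ : δ * (1 + P + 8 * T) ≤ (κ - 1) / 2)
    {x' : Path T} {u' : Time T → ℝ} (hadm : G.IsAdmissible η a x' u') :
    (κ - 1) / 2 * ∫ t, (x' t - x t) ^ 2 ≤ G.cost η x' u' - G.cost η x u := by
  set g : ℝ × ℝ × ℝ × ℝ → ℝ := fun z => G.f z.1 z.2.1 z.2.2.1 z.2.2.2 - z.2.2.1 with hg
  set l : ℝ × ℝ × ℝ × ℝ → ℝ := fun z => G.L z.1 z.2.1 z.2.2.1 z.2.2.2 -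
    (z.2.2.1 ^ 2 + 1 / (1 + z.2.1 ^ 2) + κ * (z.2.1 - z.2.2.2) ^ 2) with hl
  have hδ0 : 0 ≤ δ := (abs_nonneg _).trans (hG.ψ.abs_le 0 trivial)
  have hP : 0 ≤ P := (abs_nonneg _).trans (hp (t₀ hT.le))
  have hfi := (hG.isAdmissible h.state).velocity_integrable
  have hLi := (hG.isAdmissible h.state).cost_integrable
  set w : Time T → ℝ := fun s => G.f s (x' s) (u' s) (η s) - G.f s (x s) (u s) (η s) with hw
  have hwi : Integrable w volume := hadm.velocity_integrable.sub hfi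
  have he : ∀ t, x' t - x t = ∫ s in Iic t, w s := fun t => by
    rw [hadm.trajectory t, h.state t, integral_sub hadm.velocity_integrable.integrableOn
      hfi.integrableOn]
    ring
  have huniv : Iic (t₁ hT.le) = univ := eq_univ_of_forall fun t => le_t₁ hT.le t
  set eT := x' (t₁ hT.le) - x (t₁ hT.le) with heT
  have heTw : eT = ∫ s, w s := by rw [heT, he, huniv, setIntegral_univ]
  set k := Dψ (x (t₁ hT.le)) 1 with hk
  -- Integration by parts with `p(T) = k`; it makes `∫ Q` equal to the difference of running costs
  -- plus the linearized terminal cost.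
  have hpw : ∫ s, p s * w s = k * eT + ∫ t, ρ t * (x' t - x t) := by
    have h1 : ∀ s, p s * w s = k * w s + bwd T ρ s * w s := fun s => by
      rw [h.costate s]; ring
    simp only [h1]
    have h2 : Integrable (fun s => bwd T ρ s * w s) volume :=
      hwi.bdd_mul (bwd T ρ).continuous.aestronglyMeasurable
        (Filter.Eventually.of_forall (bwd T ρ).norm_coe_le_norm)
    rw [integral_add (hwi.const_mul _) h2, integral_const_mul, integral_bwd_mul hwi, ← heTw]
    simp only [he]
  have hpwi : Integrable (fun s => p s * w s) volume :=
    hwi.bdd_mul p.continuous.aestronglyMeasurable (Filter.Eventually.of_forall p.norm_coe_le_norm)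
  have hρi : Integrable (fun t => ρ t * (x' t - x t)) volume := integrable_path (ρ * (x' - x))
  set Q : Time T → ℝ := fun s => G.L s (x' s) (u' s) (η s) - G.L s (x s) (u s) (η s) +
    p s * w s - ρ s * (x' s - x s) with hQ
  have hQi : Integrable Q volume := ((hadm.cost_integrable.sub hLi).add hpwi).sub hρi
  have hQint : ∫ s, Q s = (∫ s : Time T, G.L s (x' s) (u' s) (η s)) -
      (∫ s : Time T, G.L s (x s) (u s) (η s)) + k * eT := by
    have h1 : Integrable (fun s : Time T => G.L s (x' s) (u' s) (η s) - G.L s (x s) (u s) (η s))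
      volume := hadm.cost_integrable.sub hLi
    have h2 : Integrable (fun s : Time T => G.L s (x' s) (u' s) (η s) -
      G.L s (x s) (u s) (η s) + p s * w s) volume := h1.add hpwi
    rw [integral_sub h2 hρi, integral_add h1 hpwi,
      integral_sub hadm.cost_integrable hLi, hpw]
    ring
  have hQge : ∀ s, (κ - 1 - δ * (1 + P)) * (x' s - x s) ^ 2 +
      (1 - δ * (1 + P)) * (u' s - u s) ^ 2 ≤ Q s := fun s => by
    have h1 := hamiltonian_increment_ge (κ := κ) hG.f hG.L s (x' := x' s) (u' := u' s) (hp s)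
      (h.stationary s)
    refine h1.trans (le_of_eq ?_)
    simp only [hQ, hw, h.force_eq s]
    ring
  have hθ : δ * (1 + P) ≤ δ * (1 + P + 8 * T) :=
    mul_le_mul_of_nonneg_left (by linarith) hδ0
  have hei : Integrable (fun s => (x' s - x s) ^ 2) volume := integrable_path ((x' - x) ^ 2)
  -- Admissibility does not require square-integrable controls; this is read off from the integrable
  -- `Q`, which dominates half of `(u' - u)²`.
  have hvi : Integrable (fun s => (u' s - u s) ^ 2) volume := by
    refine (hQi.const_mul 2).mono' ((hadm.control_measurable.sub
      u.continuous.aestronglyMeasurable.aemeasurable).pow_const 2).aestronglyMeasurable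
      (Filter.Eventually.of_forall fun s => ?_)
    rw [Real.norm_eq_abs, abs_of_nonneg (sq_nonneg _)]
    have h1 := hQge s
    have h2 : 0 ≤ (κ - 1 - δ * (1 + P)) * (x' s - x s) ^ 2 := by
      have : 0 ≤ δ * (1 + P) := by positivity
      exact mul_nonneg (by linarith) (sq_nonneg _)
    have h3 : 1 / 2 * (u' s - u s) ^ 2 ≤ (1 - δ * (1 + P)) * (u' s - u s) ^ 2 :=
      mul_le_mul_of_nonneg_right (by linarith) (sq_nonneg _)
    linarith
  have hwle : ∀ s, w s ^ 2 ≤ 8 * (u' s - u s) ^ 2 + 2 * (x' s - x s) ^ 2 := fun s => by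
    have h1 := hG.f.abs_sub_le _ (mem_dom s (x s) (u s) (η s)) _ (mem_dom s (x' s) (u' s) (η s))
    rw [increment_eq] at h1
    have h2 := h1.trans (mul_le_of_le_one_left (norm_nonneg _) hδ1)
    have h3 := h2.trans (norm_increment_le _ _)
    have h4 : w s = (u' s - u s) + (g (s, x' s, u' s, η s) - g (s, x s, u s, η s)) := by
      simp only [hw, hg]; ring
    have h5 : |w s| ≤ 2 * |u' s - u s| + |x' s - x s| := by
      rw [h4]
      refine (abs_add_le _ _).trans ?_
      simp only [hg]
      linarith
    have h6 := pow_le_pow_left₀ (abs_nonneg _) h5 2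
    rw [sq_abs] at h6
    rw [← sq_abs (u' s - u s), ← sq_abs (x' s - x s)]
    nlinarith [sq_nonneg (2 * |u' s - u s| - |x' s - x s|)]
  have hdom : Integrable (fun s => 8 * (u' s - u s) ^ 2 + 2 * (x' s - x s) ^ 2) volume :=
    (hvi.const_mul 8).add (hei.const_mul 2)
  have hw2i : Integrable (fun s => w s ^ 2) volume :=
    hdom.mono' (hwi.aestronglyMeasurable.pow 2) (Filter.Eventually.of_forall fun s => by
      rw [Real.norm_eq_abs, abs_of_nonneg (sq_nonneg _)]; exact hwle s)
  -- The possible concavity `-δ eT²` of the terminal cost is charged to the running gain; this is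
  -- the origin of `8 * T` in the smallness hypotheses.
  have heT2 : eT ^ 2 ≤ T * (8 * (∫ s, (u' s - u s) ^ 2) + 2 * ∫ s, (x' s - x s) ^ 2) := by
    rw [heTw]
    refine (sq_integral_le hT hwi hw2i).trans (mul_le_mul_of_nonneg_left ?_ hT.le)
    rw [← integral_const_mul, ← integral_const_mul,
      ← integral_add (hvi.const_mul 8) (hei.const_mul 2)]
    exact integral_mono hw2i hdom hwle
  have hψ : -(δ * eT ^ 2) ≤ G.ψ (x' (t₁ hT.le)) - G.ψ (x (t₁ hT.le)) - k * eT := by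
    have h1 := hG.ψ.taylor (x (t₁ hT.le)) trivial (x' (t₁ hT.le)) trivial
    have h2 : Dψ (x (t₁ hT.le)) (x' (t₁ hT.le) - x (t₁ hT.le)) = k * eT := by
      rw [← heT, hk, mul_comm, ← smul_eq_mul, ← map_smul, smul_eq_mul, mul_one]
    rw [h2, Real.norm_eq_abs, sq_abs, ← heT] at h1
    exact (abs_le.1 h1).1
  have hQ2 : (κ - 1 - δ * (1 + P)) * (∫ s, (x' s - x s) ^ 2) +
      (1 - δ * (1 + P)) * (∫ s, (u' s - u s) ^ 2) ≤ ∫ s, Q s := by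
    rw [← integral_const_mul, ← integral_const_mul,
      ← integral_add (hei.const_mul _) (hvi.const_mul _)]
    exact integral_mono ((hei.const_mul _).add (hvi.const_mul _)) hQi hQge
  have hcost : G.cost η x' u' - G.cost η x u = (∫ s, Q s) +
      (G.ψ (x' (t₁ hT.le)) - G.ψ (x (t₁ hT.le)) - k * eT) := by
    rw [hQint]
    simp only [ScalarGame.cost, t₁]
    ring
  rw [hcost]
  have hE : 0 ≤ ∫ s, (x' s - x s) ^ 2 := integral_nonneg fun s => sq_nonneg _
  have hV : 0 ≤ ∫ s, (u' s - u s) ^ 2 := integral_nonneg fun s => sq_nonneg _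
  set E := ∫ s, (x' s - x s) ^ 2
  set V := ∫ s, (u' s - u s) ^ 2
  have h9 := mul_le_mul_of_nonneg_left heT2 hδ0
  have h10 : δ * (1 + P + 2 * T) ≤ δ * (1 + P + 8 * T) :=
    mul_le_mul_of_nonneg_left (by linarith) hδ0
  have h11 := mul_nonneg (by linarith : 0 ≤ (κ - 1) / 2 - δ * (1 + P + 2 * T)) hE
  have h12 := mul_nonneg (by linarith : 0 ≤ 1 - δ * (1 + P + 8 * T)) hV
  nlinarith

theorem IsExtremal.isOptimal (hT : 0 < T) {κ δ P : ℝ} (hκ : 1 < κ) {G : ScalarGame T}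
    {Df Dl : ℝ × ℝ × ℝ × ℝ → ℝ × ℝ × ℝ × ℝ →L[ℝ] ℝ} {Dψ : ℝ → ℝ →L[ℝ] ℝ}
    {Dφ : ℝ × ℝ → ℝ × ℝ →L[ℝ] ℝ} (hG : IsPerturbation κ δ G Df Dl Dψ Dφ) {η x p u ρ : Path T}
    {a : ℝ} (h : IsExtremal κ G Df Dl Dψ η a x p u ρ) (hp : ∀ t, |p t| ≤ P) (hδ1 : δ ≤ 1)
    (hδ : δ * (1 + P + 8 * T) ≤ 1 / 2) (hδκ : δ * (1 + P + 8 * T) ≤ (κ - 1) / 2) :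
    G.IsOptimal η a x u := by
  refine ⟨hG.isAdmissible h.state, fun x' u' hadm => ?_⟩
  have h1 := h.cost_gain hT hG hp hδ1 hδ hδκ hadm
  have h2 : 0 ≤ (κ - 1) / 2 * ∫ t, (x' t - x t) ^ 2 :=
    mul_nonneg (by linarith) (integral_nonneg fun t => sq_nonneg _)
  linarith

theorem abs_apply_le_norm (v : Path T) (t : Time T) : |v t| ≤ ‖v‖ := v.norm_coe_le_norm t

theorem IsReply.isExtremal {κ : ℝ} (hT : 0 ≤ T) {η x : Path T} (h : IsReply κ η x) :
    IsExtremal κ (barycenterGame κ T hT) 0 0 0 η 0 x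
      ((-2 : ℝ) • bwd T (force.comp x + κ • (η - x))) (bwd T (force.comp x + κ • (η - x)))
      ((-2 : ℝ) • (force.comp x + κ • (η - x))) where
  state t := by
    nth_rewrite 1 [h]
    simp only [barycenterGame, zero_add]
    rfl
  force_eq t := by
    simp
    ring
  costate t := by simp
  stationary t := by simp; ring

theorem continuous_eq_of_integral_sq_sub {x x' : Path T} (hT : 0 < T)
    (h : ∫ t, (x' t - x t) ^ 2 ≤ 0) : x' = x := by
  have hF := fwd_eq_intervalIntegral hT.le ((x' - x) ^ 2) (t₁ hT.le)
  by_contra hne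
  obtain ⟨t, ht⟩ : ∃ t, x' t - x t ≠ 0 := by
    by_contra! hall
    exact hne (ContinuousMap.ext fun t => sub_eq_zero.1 (hall t))
  have hcont : Continuous (IccExtend hT.le ((x' - x) ^ 2 : Path T)) := continuous_extend hT.le _
  have hpos : 0 < ∫ s in (0 : ℝ)..T, IccExtend hT.le ((x' - x) ^ 2 : Path T) s := by
    refine intervalIntegral.integral_pos hT hcont.continuousOn (fun s _ => ?_) ⟨t, t.2, ?_⟩
    · simp only [IccExtend, Function.comp_apply]
      exact sq_nonneg _
    · rw [IccExtend_val]
      exact lt_of_le_of_ne (sq_nonneg _) (pow_ne_zero 2 ht).symm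
  have huniv : Iic (t₁ hT.le) = univ := eq_univ_of_forall fun t => le_t₁ hT.le t
  rw [fwd_apply, huniv, setIntegral_univ] at hF
  have e : ∫ t, ((x' - x) ^ 2 : Path T) t = ∫ t, (x' t - x t) ^ 2 := rfl
  rw [e] at hF
  simp only [t₁] at hF
  linarith

/-! ### The best reply map of the barycenter game: solutions, stability, instability. -/

namespace barycenterGame

theorem isOptimal_of_isReply (hT : 0 < T) {κ : ℝ} (hκ : 1 < κ) {η x : Path T}
    (h : IsReply κ η x) : (barycenterGame κ T hT.le).IsOptimal η 0 x
      (bwd T (force.comp x + κ • (η - x))) := by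
  refine (h.isExtremal hT.le).isOptimal hT hκ (barycenterGame_isPerturbation le_rfl hT.le)
    (abs_apply_le_norm _) zero_le_one ?_ ?_
  · norm_num
  · rw [zero_mul]; linarith

/-- The quadratic gain in `cost_gain` forces any optimal trajectory to be at `L²` distance zero from
the reply. -/
theorem isReply_of_isOptimal (hT : 0 < T) {κ : ℝ} (hκ : 1 < κ) {η x' : Path T} {u' : Time T → ℝ}
    (h : (barycenterGame κ T hT.le).IsOptimal η 0 x' u') : IsReply κ η x' := by
  obtain ⟨x, hx⟩ := exists_reply hT.le hκ η
  have h1 := (hx.isExtremal hT.le).cost_gain hT (barycenterGame_isPerturbation le_rfl hT.le)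
    (abs_apply_le_norm _) zero_le_one (by norm_num)
    (by rw [zero_mul]; linarith) h.1
  have h2 := h.2 _ _ (isOptimal_of_isReply hT hκ hx).1
  have h3 : ∫ t, (x' t - x t) ^ 2 ≤ 0 := by
    by_contra! hlt
    have := mul_pos (by linarith : 0 < (κ - 1) / 2) hlt
    linarith
  rwa [continuous_eq_of_integral_sq_sub hT h3]

theorem isMoment_const (hT : 0 ≤ T) (κ : ℝ) (y : Path T) :
    (barycenterGame κ T hT).IsMoment (fun _ => y) y := fun t => by
  simp [barycenterGame]

theorem mem_bestReply_iff (hT : 0 < T) {κ : ℝ} (hκ : 1 < κ) {η η' : Path T} :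
    η' ∈ (barycenterGame κ T hT.le).bestReply η ↔ IsReply κ η η' := by
  constructor
  · rintro ⟨x, u, -, hopt, hmom⟩
    obtain ⟨z, hz⟩ := exists_reply hT.le hκ η
    have hx : ∀ᵐ ξ : Player, x ξ = z := hopt.mono fun ξ h =>
      (isReply_of_isOptimal hT hκ h).unique hT.le hκ hz
    have : η' = z := by
      ext t
      rw [(hmom t).2, integral_congr_ae (g := fun _ => z t)
        (hx.mono fun ξ h => by simp [barycenterGame, h])]
      simp
    rwa [this]
  · intro h
    exact ⟨fun _ => η', fun _ => _, integrable_const _,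
      Filter.Eventually.of_forall fun _ => isOptimal_of_isReply hT hκ h, isMoment_const hT.le κ η'⟩

theorem isSolution (hT : 0 < T) {κ : ℝ} (hκ : 1 < κ) {y : Path T}
    (hy : y = green T (force.comp y)) :
    (barycenterGame κ T hT.le).IsSolution fun _ => y :=
  ⟨integrable_const _, fun _ => _, y, isMoment_const hT.le κ y, Filter.Eventually.of_forall fun _ =>
    isOptimal_of_isReply hT hκ (IsPositiveEquilibrium.isReply hy)⟩

theorem moment_const_eq {hT : 0 ≤ T} {κ : ℝ} {y η : Path T}
    (h : (barycenterGame κ T hT).IsMoment (fun _ => y) η) : η = y := by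
  ext t
  rw [(h t).2]
  simp [barycenterGame]

theorem isStable (hT : 2 < T) {κ : ℝ} (hκ : 1 < κ) {y : Path T} (hy : IsPositiveEquilibrium y)
    (hT0 : 0 ≤ T) : (barycenterGame κ T hT0).IsStable fun _ => y := by
  have hTpos : 0 < T := by linarith
  refine ⟨y, isMoment_const hT0 κ y,
    (mem_bestReply_iff hTpos hκ).2 (IsPositiveEquilibrium.isReply hy.eq_green), fun ε hε => ?_⟩
  obtain ⟨δ, hδ, h⟩ := hy.stable hT hκ hε
  refine ⟨δ, hδ, fun η h0 hη k hk => ?_⟩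
  have := h η h0 (fun j => (mem_bestReply_iff hTpos hκ).1 (by simpa using hη (j + 1) (by omega)))
    (k - 1)
  rwa [Nat.sub_add_cancel hk] at this

theorem isStable_neg (hT : 2 < T) {κ : ℝ} (hκ : 1 < κ) {y : Path T} (hy : IsPositiveEquilibrium y)
    (hT0 : 0 ≤ T) : (barycenterGame κ T hT0).IsStable fun _ => -y := by
  have hTpos : 0 < T := by linarith
  refine ⟨-y, isMoment_const hT0 κ (-y),
    (mem_bestReply_iff hTpos hκ).2 (IsPositiveEquilibrium.isReply hy.eq_green).neg, fun ε hε => ?_⟩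
  obtain ⟨δ, hδ, h⟩ := hy.stable hT hκ hε
  refine ⟨δ, hδ, fun η h0 hη k hk => ?_⟩
  have hn : ∀ z : Path T, ‖-z - y‖ = ‖z - -y‖ := fun z => by
    rw [← norm_neg]; congr 1; abel
  have := h (fun k => -η k) (by rwa [hn])
    (fun j => ((mem_bestReply_iff hTpos hκ).1 (by simpa using hη (j + 1) (by omega))).neg) (k - 1)
  rwa [Nat.sub_add_cancel hk, hn] at this

/-- Iterates from a small `c • sine T` dominate `l ^ k * c * sine T` as long as the growth lemma
applies. Stability with tolerance `b / l` would keep it applicable forever, bounding `l ^ k * c`. -/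
theorem not_isStable_zero (hT : 2 < T) {κ : ℝ} (hκ : 1 < κ) (hT0 : 0 ≤ T) :
    ¬ (barycenterGame κ T hT0).IsStable fun _ => 0 := by
  have hTpos : 0 < T := by linarith
  rintro ⟨η, hη, -, hst⟩
  obtain rfl := moment_const_eq hη
  obtain ⟨l, hl, b, hb, hgrow⟩ := exists_growth hT hκ
  have hl0 : 0 < l := by linarith
  obtain ⟨δ, hδ, h⟩ := hst (b / l) (by positivity)
  choose Φ hΦ using exists_reply hT0 hκ
  set c := min (δ / 2) (b / l) with hc
  have hc0 : 0 < c := lt_min (by positivity) (by positivity)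
  set X : ℕ → Path T := fun k => Φ^[k] (c • sine T) with hX
  have hXs : ∀ k, X (k + 1) = Φ (X k) := fun k => Function.iterate_succ_apply' _ _ _
  have hX0 : ‖X 0 - 0‖ < δ := by
    have h1 : ‖sine T‖ ≤ 1 := (ContinuousMap.norm_le _ zero_le_one).2 fun t =>
      abs_le.2 ⟨by linarith [sine_nonneg hT t], sine_le_one t⟩
    have h2 : ‖X 0‖ = c * ‖sine T‖ := by
      simp only [hX, Function.iterate_zero, id, norm_smul, Real.norm_eq_abs, abs_of_pos hc0]
    rw [sub_zero, h2]
    have := min_le_left (δ / 2) (b / l)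
    nlinarith
  have hlt := h X hX0 fun k hk => by
    obtain ⟨j, rfl⟩ : ∃ j, k = j + 1 := ⟨k - 1, by omega⟩
    rw [Nat.add_sub_cancel, hXs]
    exact (mem_bestReply_iff hTpos hκ).2 (hΦ _)
  have hk : ∀ k, l ^ k * c ≤ b / l ∧ ∀ t, l ^ k * c * sine T t ≤ X k t := by
    intro k
    induction k with
    | zero =>
      refine ⟨by rw [pow_zero, one_mul]; exact min_le_right _ _, fun t => ?_⟩
      rw [pow_zero, one_mul]
      exact le_rfl
    | succ k ih =>
      have h1 : l * (l ^ k * c) ≤ b := by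
        have := ih.1
        rw [le_div_iff₀ hl0] at this
        linarith
      have h2 := hgrow (l ^ k * c) (by positivity) h1 _ _ (hΦ (X k)) ih.2
      rw [← hXs] at h2
      have e : l ^ (k + 1) * c = l * (l ^ k * c) := by ring
      refine ⟨?_, fun t => by rw [e]; exact h2 t⟩
      have h3 := h2 (t₁ hT0)
      rw [sine_t₁ hT hT0, mul_one] at h3
      have h4 := (le_abs_self _).trans ((X (k + 1)).norm_coe_le_norm (t₁ hT0))
      have h5 := hlt (k + 1) (by omega)
      rw [sub_zero] at h5
      rw [e]
      linarith
  obtain ⟨n, hn⟩ := pow_unbounded_of_one_lt (b / l / c) hl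
  rw [div_lt_iff₀ hc0] at hn
  exact absurd (hk n).1 (not_le.2 hn)

end barycenterGame

/-! ### A perturbation theorem for equations coupled through an average. -/

section Average

variable {A Ω X : Type*} [TopologicalSpace A] [CompactSpace A] [MeasurableSpace Ω]
  {μ : Measure Ω} [IsProbabilityMeasure μ] [NormedAddCommGroup X] {π : Ω → A}

theorem integrable_comp (hπ : AEStronglyMeasurable π μ) (w : C(A, X)) :
    Integrable (fun ξ => w (π ξ)) μ :=
  Integrable.of_bound (w.continuous.comp_aestronglyMeasurable hπ) ‖w‖
    (Filter.Eventually.of_forall fun ξ => w.norm_coe_le_norm (π ξ))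

variable [NormedSpace ℝ X]

/-- The average of a continuous function along a random point. -/
def average (hπ : AEStronglyMeasurable π μ) : C(A, X) →L[ℝ] X :=
  LinearMap.mkContinuous
    { toFun := fun w => ∫ ξ, w (π ξ) ∂μ
      map_add' := fun v w => integral_add (integrable_comp hπ v) (integrable_comp hπ w)
      map_smul' := fun c v => integral_smul c _ }
    1 fun w => by
      refine (norm_integral_le_of_norm_le_const
        (Filter.Eventually.of_forall fun ξ => w.norm_coe_le_norm (π ξ))).trans ?_
      simp

theorem average_apply (hπ : AEStronglyMeasurable π μ) (w : C(A, X)) :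
    average hπ w = ∫ ξ, w (π ξ) ∂μ := rfl

theorem norm_average_le (hπ : AEStronglyMeasurable π μ) (w : C(A, X)) : ‖average hπ w‖ ≤ ‖w‖ := by
  refine (norm_integral_le_of_norm_le_const
    (Filter.Eventually.of_forall fun ξ => w.norm_coe_le_norm (π ξ))).trans ?_
  simp

theorem average_comp [CompleteSpace X] {Y : Type*} [NormedAddCommGroup Y] [NormedSpace ℝ Y]
    [CompleteSpace Y] (hπ : AEStronglyMeasurable π μ) (L : X →L[ℝ] Y) (w : C(A, X)) :
    average hπ ((L : C(X, Y)).comp w) = L (average hπ w) :=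
  L.integral_comp_comm (integrable_comp hπ w)

theorem average_const [CompleteSpace X] (hπ : AEStronglyMeasurable π μ) (x : X) :
    average hπ (ContinuousMap.const A x) = x := by
  simp [average_apply]

end Average

/-- A perturbation theorem for families of equations `F a (w a) η = 0` coupled through the average
`η = ∫ φ (w (π ξ)) dξ`, near a nondegenerate linear model. -/
theorem exists_coupled_solution {X E : Type*} [NormedAddCommGroup X] [NormedSpace ℝ X]
    [CompleteSpace X] [NormedAddCommGroup E] [NormedSpace ℝ E] [CompleteSpace E]
    (A₀ : X ≃L[ℝ] X) (B : E →L[ℝ] X) (Pr : X →L[ℝ] E) (M : E ≃L[ℝ] E)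
    (hM : ∀ η, M η = η + Pr (A₀.symm (B η))) :
    ∃ K > 0, ∀ {A Ω : Type} [TopologicalSpace A] [CompactSpace A] [MeasurableSpace Ω]
      {μ : Measure Ω} [IsProbabilityMeasure μ] {π : Ω → A} (_ : AEStronglyMeasurable π μ)
      {F : A → X → E → X} (_ : Continuous fun z : A × X × E => F z.1 z.2.1 z.2.2)
      {φ : X → E} (_ : Continuous φ) {w₀ : X} {η₀ : E} {ε c b : ℝ} (_ : 0 ≤ ε)
      (_ : ∀ a w w' η η', ‖w - w₀‖ ≤ ε → ‖w' - w₀‖ ≤ ε → ‖η - η₀‖ ≤ ε → ‖η' - η₀‖ ≤ ε →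
        ‖F a w η - F a w' η' - (A₀ (w - w') + B (η - η'))‖ ≤ c * max ‖w - w'‖ ‖η - η'‖)
      (_ : ∀ a, ‖F a w₀ η₀‖ ≤ b)
      (_ : ∀ w w', ‖w - w₀‖ ≤ ε → ‖w' - w₀‖ ≤ ε →
        ‖φ w - φ w' - Pr (w - w')‖ ≤ c * ‖w - w'‖)
      (_ : ‖η₀ - φ w₀‖ ≤ b) (_ : 0 ≤ c) (_ : K * c ≤ 1 / 2) (_ : 2 * K * b ≤ ε),
      ∃ (w : C(A, X)) (η : E), (∀ a, F a (w a) η = 0) ∧ η = ∫ ξ, φ (w (π ξ)) ∂μ ∧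
        (∀ a, ‖w a - w₀‖ ≤ ε) ∧ ‖η - η₀‖ ≤ ε := by
  set α := ‖(A₀.symm : X →L[ℝ] X)‖ with hα
  set m := ‖(M.symm : E →L[ℝ] E)‖ with hm
  set K₁ := m * (1 + ‖Pr‖ * α) with hK₁
  set K₂ := α * (1 + ‖B‖ * K₁) with hK₂
  have hα0 : 0 ≤ α := norm_nonneg _
  have hm0 : 0 ≤ m := norm_nonneg _
  have hK₁0 : 0 ≤ K₁ := by positivity
  have hK₂0 : 0 ≤ K₂ := by positivity
  refine ⟨K₁ + K₂ + 1, by positivity, ?_⟩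
  set K := K₁ + K₂ + 1 with hK
  have hK0 : 0 < K := by positivity
  intro A Ω _ _ _ μ _ π hπ F hF φ hφ w₀ η₀ ε c b hε hlin hb hφlin hφb hc hKc hKb
  have hAs : ∀ x, ‖A₀.symm x‖ ≤ α * ‖x‖ := fun x => (A₀.symm : X →L[ℝ] X).le_opNorm x
  have hMs : ∀ x, ‖M.symm x‖ ≤ m * ‖x‖ := fun x => (M.symm : E →L[ℝ] E).le_opNorm x
  set J : C(A, X) →L[ℝ] X := average hπ with hJ
  -- The linear model for all parameters `a` at once: `(A₀ w + B η, η - Pr (average w))`.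
  set Lin : C(A, X) × E →L[ℝ] C(A, X) × E :=
    ((((A₀ : X →L[ℝ] X).compLeftContinuous ℝ A).comp (ContinuousLinearMap.fst ℝ _ _) +
      ((ContinuousLinearMap.const ℝ A).comp B).comp (ContinuousLinearMap.snd ℝ _ _)).prod
      (ContinuousLinearMap.snd ℝ _ _ - (Pr.comp J).comp (ContinuousLinearMap.fst ℝ _ _)))
    with hLin
  have hLin1 : ∀ z a, (Lin z).1 a = A₀ (z.1 a) + B z.2 := fun z a => rfl
  have hLin2 : ∀ z, (Lin z).2 = z.2 - Pr (J z.1) := fun z => rfl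
  -- Averaging the first equation eliminates `w` and leaves an equation for `η` alone with operator
  -- `M`. The resulting bounds `K₁`, `K₂` do not involve `A`, `Ω` or `π`, so `K` is uniform over
  -- games.
  let inv2 : C(A, X) × E → E := fun z => M.symm (z.2 + Pr (A₀.symm (J z.1)))
  let inv1 : C(A, X) × E → C(A, X) := fun z =>
    ((A₀.symm : X →L[ℝ] X) : C(X, X)).comp (z.1 - ContinuousMap.const A (B (inv2 z)))
  have hinv1 : ∀ z a, inv1 z a = A₀.symm (z.1 a - B (inv2 z)) := fun z a => rfl
  have hn2 : ∀ z, ‖inv2 z‖ ≤ K₁ * ‖z‖ := fun z => by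
    refine (hMs _).trans ?_
    rw [hK₁, mul_assoc]
    refine mul_le_mul_of_nonneg_left ?_ hm0
    have h1 : ‖Pr (A₀.symm (J z.1))‖ ≤ ‖Pr‖ * (α * ‖z‖) :=
      (Pr.le_opNorm _).trans (mul_le_mul_of_nonneg_left ((hAs _).trans
        (mul_le_mul_of_nonneg_left ((norm_average_le hπ z.1).trans (norm_fst_le z)) hα0))
        (norm_nonneg _))
    calc ‖z.2 + Pr (A₀.symm (J z.1))‖ ≤ ‖z.2‖ + ‖Pr (A₀.symm (J z.1))‖ := norm_add_le _ _
      _ ≤ ‖z‖ + ‖Pr‖ * (α * ‖z‖) := add_le_add (norm_snd_le z) h1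
      _ = _ := by ring
  have hn1 : ∀ z, ‖inv1 z‖ ≤ K₂ * ‖z‖ := fun z => by
    refine (ContinuousMap.norm_le _ (by positivity)).2 fun a => ?_
    rw [hinv1]
    refine (hAs _).trans ?_
    rw [hK₂, mul_assoc]
    refine mul_le_mul_of_nonneg_left ?_ hα0
    have h1 : ‖B (inv2 z)‖ ≤ ‖B‖ * (K₁ * ‖z‖) :=
      (B.le_opNorm _).trans (mul_le_mul_of_nonneg_left (hn2 z) (norm_nonneg _))
    calc ‖z.1 a - B (inv2 z)‖ ≤ ‖z.1 a‖ + ‖B (inv2 z)‖ := norm_sub_le _ _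
      _ ≤ ‖z‖ + ‖B‖ * (K₁ * ‖z‖) :=
        add_le_add ((z.1.norm_coe_le_norm a).trans (norm_fst_le z)) h1
      _ = _ := by ring
  let R : Lin.NonlinearRightInverse :=
    { toFun := fun z => (inv1 z, inv2 z)
      nnnorm := ⟨K, hK0.le⟩
      bound' := fun z => by
        have h1 : K₂ ≤ K := by linarith
        have h2 : K₁ ≤ K := by linarith
        exact max_le ((hn1 z).trans (mul_le_mul_of_nonneg_right h1 (norm_nonneg z)))
          ((hn2 z).trans (mul_le_mul_of_nonneg_right h2 (norm_nonneg z)))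
      right_inv' := fun z => by
        refine Prod.ext (ContinuousMap.ext fun a => ?_) ?_
        · rw [hLin1, hinv1]
          simp
        · rw [hLin2]
          have h1 : J (inv1 z) = A₀.symm (J z.1 - B (inv2 z)) := by
            have := average_comp hπ (A₀.symm : X →L[ℝ] X)
              (z.1 - ContinuousMap.const A (B (inv2 z)))
            rw [map_sub, average_const] at this
            exact this
          have h2 : M (inv2 z) = z.2 + Pr (A₀.symm (J z.1)) := M.apply_symm_apply _
          rw [hM] at h2
          simp only [h1, map_sub]
          rw [← sub_eq_zero] at h2 ⊢
          rw [← h2]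
          abel }
  let N : C(A, X) × E → C(A, X) × E := fun z =>
    (⟨fun a => F a (z.1 a) z.2, hF.comp (continuous_id.prodMk
      (z.1.continuous.prodMk continuous_const))⟩,
      z.2 - average hπ ((⟨φ, hφ⟩ : C(X, E)).comp z.1))
  set z₀ : C(A, X) × E := (ContinuousMap.const A w₀, η₀) with hz₀
  have hball : ∀ z ∈ Metric.closedBall z₀ ε, (∀ a, ‖z.1 a - w₀‖ ≤ ε) ∧ ‖z.2 - η₀‖ ≤ ε := by
    intro z hz
    rw [mem_closedBall_iff_norm] at hz
    exact ⟨fun a => (((z.1 - z₀.1).norm_coe_le_norm a).trans (norm_fst_le (z - z₀))).trans hz,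
      (norm_snd_le (z - z₀)).trans hz⟩
  have happrox : ApproximatesLinearOn N Lin (Metric.closedBall z₀ ε) ⟨c, hc⟩ := by
    intro z hz z' hz'
    obtain ⟨h1, h2⟩ := hball z hz
    obtain ⟨h1', h2'⟩ := hball z' hz'
    have hnn : 0 ≤ c * ‖z - z'‖ := mul_nonneg hc (norm_nonneg _)
    refine max_le ?_ ?_
    · refine (ContinuousMap.norm_le _ hnn).2 fun a => ?_
      refine (hlin a (z.1 a) (z'.1 a) z.2 z'.2 (h1 a) (h1' a) h2 h2').trans ?_
      exact mul_le_mul_of_nonneg_left (max_le (((z.1 - z'.1).norm_coe_le_norm a).trans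
        (norm_fst_le (z - z'))) (norm_snd_le (z - z'))) hc
    · set D : C(A, E) := (⟨φ, hφ⟩ : C(X, E)).comp z.1 - (⟨φ, hφ⟩ : C(X, E)).comp z'.1 -
        (Pr : C(X, E)).comp (z.1 - z'.1) with hD
      have e : (N z - N z' - Lin (z - z')).2 = -average hπ D := by
        have h3 := average_comp hπ Pr (z.1 - z'.1)
        have h4 : (N z - N z' - Lin (z - z')).2 = (z.2 - average hπ ((⟨φ, hφ⟩ : C(X, E)).comp z.1)) -
          (z'.2 - average hπ ((⟨φ, hφ⟩ : C(X, E)).comp z'.1)) -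
            (z.2 - z'.2 - Pr (J (z.1 - z'.1))) := rfl
        have h5 : average hπ D = average hπ ((⟨φ, hφ⟩ : C(X, E)).comp z.1) -
            average hπ ((⟨φ, hφ⟩ : C(X, E)).comp z'.1) - Pr (J (z.1 - z'.1)) := by
          have h6 := map_sub (average hπ) ((⟨φ, hφ⟩ : C(X, E)).comp z.1 -
            (⟨φ, hφ⟩ : C(X, E)).comp z'.1) ((Pr : C(X, E)).comp (z.1 - z'.1))
          rw [h3, map_sub (average hπ) ((⟨φ, hφ⟩ : C(X, E)).comp z.1)] at h6
          exact h6
        rw [h4, h5]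
        abel
      rw [e, norm_neg]
      refine (norm_average_le hπ D).trans ((ContinuousMap.norm_le _ hnn).2 fun a => ?_)
      refine (hφlin (z.1 a) (z'.1 a) (h1 a) (h1' a)).trans ?_
      exact mul_le_mul_of_nonneg_left (((z.1 - z'.1).norm_coe_le_norm a).trans
        (norm_fst_le (z - z'))) hc
  have hb0 : 0 ≤ b := (norm_nonneg _).trans hφb
  have hN0 : ‖N z₀‖ ≤ b := by
    refine max_le ((ContinuousMap.norm_le _ hb0).2 fun a => hb a) ?_
    have : (N z₀).2 = η₀ - φ w₀ := by
      have h1 : (⟨φ, hφ⟩ : C(X, E)).comp (ContinuousMap.const A w₀) =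
        ContinuousMap.const A (φ w₀) := rfl
      simp only [N, hz₀, h1, average_const]
    rw [this]
    exact hφb
  -- Quantitative surjectivity: the image of the `ε`-ball contains the ball of radius `(K⁻¹ - c) ε`
  -- about `N z₀`, which contains 0.
  have hsurj := happrox.surjOn_closedBall_of_nonlinearRightInverse R hε le_rfl
  have hmem : (0 : C(A, X) × E) ∈ Metric.closedBall (N z₀) (((R.nnnorm : ℝ)⁻¹ - c) * ε) := by
    rw [mem_closedBall_iff_norm, zero_sub, norm_neg]
    refine hN0.trans ?_
    have h1 : (R.nnnorm : ℝ) = K := rfl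
    rw [h1]
    have h2 : c ≤ K⁻¹ / 2 := by
      have : c = K⁻¹ * (K * c) := by field_simp
      rw [this]
      have := mul_le_mul_of_nonneg_left hKc (inv_nonneg.2 hK0.le)
      linarith
    have h3 : b ≤ K⁻¹ / 2 * ε := by
      have : b = K⁻¹ / 2 * (2 * K * b) := by field_simp
      rw [this]
      exact mul_le_mul_of_nonneg_left hKb (by positivity)
    nlinarith
  obtain ⟨z, hz, hNz⟩ := hsurj hmem
  obtain ⟨h1, h2⟩ := hball z hz
  refine ⟨z.1, z.2, fun a => ?_, ?_, h1, h2⟩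
  · exact congrArg (fun p : C(A, X) × E => p.1 a) hNz
  · exact sub_eq_zero.1 (congrArg Prod.snd hNz)

/-! ### Invertibility of the linearized Pontryagin system. -/

/-- The triples (state, costate, control). -/
abbrev Triple (T : ℝ) : Type := Path T × Path T × Path T

/-- The linearized Pontryagin system at `y`, for a frozen moment. -/
def linearized (κ : ℝ) (y : Path T) : Triple T →L[ℝ] Triple T :=
  let x := ContinuousLinearMap.fst ℝ (Path T) (Path T × Path T)
  let pu := ContinuousLinearMap.snd ℝ (Path T) (Path T × Path T)
  let p := (ContinuousLinearMap.fst ℝ (Path T) (Path T)).comp pu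
  let u := (ContinuousLinearMap.snd ℝ (Path T) (Path T)).comp pu
  (x - (fwd T).comp u).prod ((p - ((bwd T).comp (ContinuousLinearMap.mul ℝ (Path T)
    ((2 * κ) • 1 - (2 : ℝ) • stiffness.comp y))).comp x).prod ((2 : ℝ) • u + p))

theorem linearized_apply (κ : ℝ) (y x p u : Path T) : linearized κ y (x, p, u) =
    (x - fwd T u, p - bwd T (((2 * κ) • 1 - (2 : ℝ) • stiffness.comp y) * x), (2 : ℝ) • u + p) :=
  rfl

theorem linearized_eq_iff {κ : ℝ} {y x p u r₁ r₂ r₃ : Path T} :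
    linearized κ y (x, p, u) = (r₁, r₂, r₃) ↔ x = fwd T u + r₁ ∧
      p = bwd T (((2 * κ) • 1 - (2 : ℝ) • stiffness.comp y) * x) + r₂ ∧
      u = (1 / 2 : ℝ) • (r₃ - p) := by
  rw [linearized_apply, Prod.mk.injEq, Prod.mk.injEq, sub_eq_iff_eq_add', sub_eq_iff_eq_add']
  refine and_congr Iff.rfl (and_congr Iff.rfl ⟨?_, ?_⟩)
  · rintro rfl
    module
  · rintro rfl
    module

theorem stiffness_sub_nonpos {κ : ℝ} (hκ : 1 < κ) (y : Path T) (t : Time T) :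
    (stiffness.comp y - κ • (1 : Path T)) t ≤ 0 := by
  have := (abs_le.1 (abs_stiffness_le (y t))).2
  simp
  linarith

theorem mul_coeff_eq (κ : ℝ) (y x : Path T) :
    ((2 * κ) • 1 - (2 : ℝ) • stiffness.comp y) * x =
      (-2 : ℝ) • ((stiffness.comp y - κ • 1) * x) := by
  ext t
  simp
  ring

/-- Eliminating `p` and `u` leaves `x - green ((stiffness y - κ) x) = r`, whose coefficient is
nonpositive since `κ > 1`. For a frozen moment no nondegeneracy of `y` is needed. -/
theorem linearized_bijective (hT : 0 ≤ T) {κ : ℝ} (hκ : 1 < κ) (y : Path T) :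
    Function.Bijective (linearized κ y) := by
  constructor
  · rw [injective_iff_map_eq_zero]
    rintro ⟨x, p, u⟩ h
    obtain ⟨h1, h2, h3⟩ := linearized_eq_iff.1 (h : _ = ((0 : Path T), (0 : Path T), (0 : Path T)))
    have hx : x = 0 := by
      refine eq_zero_of_eq_green_mul hT (stiffness_sub_nonpos hκ y) ?_
      rw [h2, mul_coeff_eq] at h3
      rw [h3] at h1
      nth_rewrite 1 [h1]
      rw [green_apply]
      simp only [map_smul, map_sub, map_zero, add_zero]
      module
    subst hx
    have hp : p = 0 := by rw [h2]; simp
    subst hp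
    have hu : u = 0 := by rw [h3]; simp
    rw [hu]
    rfl
  · rintro ⟨r₁, r₂, r₃⟩
    obtain ⟨x, hx⟩ := surjective_sub_green_mul (stiffness.comp y - κ • 1)
      (fun x hx => eq_zero_of_eq_green_mul hT (stiffness_sub_nonpos hκ y) hx)
      (r₁ + fwd T ((1 / 2 : ℝ) • (r₃ - r₂)))
    refine ⟨(x, _, _), linearized_eq_iff.2 ⟨?_, rfl, rfl⟩⟩
    rw [sub_eq_iff_eq_add] at hx
    nth_rewrite 1 [hx]
    rw [mul_coeff_eq, green_apply]
    simp only [map_smul, map_sub, map_add]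
    module

/-- The influence of the moment on the linearized Pontryagin system. -/
def momentInfluence (κ : ℝ) : Path T →L[ℝ] Triple T :=
  (0 : Path T →L[ℝ] Path T).prod (((2 * κ) • bwd T).prod 0)

theorem momentInfluence_apply (κ : ℝ) (η : Path T) :
    momentInfluence κ η = ((0 : Path T), (2 * κ) • bwd T η, (0 : Path T)) := rfl

/-- `M η = 0` says that `η` is its own linearized reply. Then the two `κ` terms cancel and leave `η
= green (stiffness y · η)`, so the nondegeneracy hypothesis is exactly what inverts `M`. -/
theorem exists_linearized_equiv (hT : 0 ≤ T) {κ : ℝ} (hκ : 1 < κ) {y : Path T}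
    (hnd : ∀ x : Path T, x = green T (stiffness.comp y * x) → x = 0) :
    ∃ (A₀ : Triple T ≃L[ℝ] Triple T) (M : Path T ≃L[ℝ] Path T),
      (∀ w, A₀ w = linearized κ y w) ∧ ∀ η, M η = η +
        ContinuousLinearMap.fst ℝ (Path T) (Path T × Path T)
          (A₀.symm (momentInfluence κ η)) := by
  obtain ⟨hinj, hsurj⟩ := linearized_bijective hT hκ y
  set A₀ : Triple T ≃L[ℝ] Triple T := ContinuousLinearEquiv.ofBijective (linearized κ y)
    (LinearMap.ker_eq_bot.2 hinj) (LinearMap.range_eq_top.2 hsurj) with hA₀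
  have hA : ∀ w, A₀ w = linearized κ y w := fun w => rfl
  set M : Path T →L[ℝ] Path T := ContinuousLinearMap.id ℝ (Path T) +
    ((ContinuousLinearMap.fst ℝ (Path T) (Path T × Path T)).comp
      (A₀.symm : Triple T →L[ℝ] Triple T)).comp (momentInfluence κ) with hM
  have hMapply : ∀ η, M η = η + (A₀.symm (momentInfluence κ η)).1 := fun η => rfl
  have hfst : ∀ η x : Path T, (A₀.symm (momentInfluence κ η)).1 = x ↔
      x = green T ((stiffness.comp y - κ • 1) * x) - κ • green T η := by
    intro η x
    constructor
    · intro h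
      obtain ⟨⟨x', p, u⟩, hw⟩ : ∃ w, A₀.symm (momentInfluence κ η) = w := ⟨_, rfl⟩
      rw [hw] at h
      obtain rfl : x' = x := h
      rw [ContinuousLinearEquiv.symm_apply_eq, hA, momentInfluence_apply] at hw
      obtain ⟨h1, h2, h3⟩ := linearized_eq_iff.1 hw.symm
      rw [h2, mul_coeff_eq] at h3
      rw [h3] at h1
      nth_rewrite 1 [h1]
      rw [green_apply, green_apply]
      simp only [map_smul, map_sub, map_zero, map_add, add_zero]
      module
    · intro h
      have : A₀.symm (momentInfluence κ η) = (x,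
          bwd T (((2 * κ) • 1 - (2 : ℝ) • stiffness.comp y) * x) + (2 * κ) • bwd T η,
          (1 / 2 : ℝ) • (0 - (bwd T (((2 * κ) • 1 - (2 : ℝ) • stiffness.comp y) * x) +
            (2 * κ) • bwd T η))) := by
        rw [ContinuousLinearEquiv.symm_apply_eq, hA, momentInfluence_apply]
        refine (linearized_eq_iff.2 ⟨?_, rfl, rfl⟩).symm
        nth_rewrite 1 [h]
        rw [mul_coeff_eq, green_apply, green_apply]
        simp only [map_smul, map_sub, map_zero, map_add, add_zero]
        module
      rw [this]
  have hMinj : Function.Injective M := by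
    rw [injective_iff_map_eq_zero]
    intro η hη
    rw [hMapply] at hη
    have h1 := (hfst η (-η)).1 (by rw [← sub_eq_zero, ← hη]; abel)
    refine hnd η ?_
    rw [← neg_inj]
    nth_rewrite 1 [h1]
    rw [← map_neg, ← map_smul, ← map_sub]
    congr 1
    ext t
    simp
    ring
  have hMsurj : Function.Surjective M := by
    intro ρ
    obtain ⟨x, hx⟩ := surjective_sub_green_mul (stiffness.comp y) hnd (κ • green T ρ)
    refine ⟨x + ρ, ?_⟩
    rw [hMapply, (hfst (x + ρ) (-x)).2 ?_]
    · abel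
    · rw [sub_eq_iff_eq_add] at hx
      rw [← neg_inj, neg_neg]
      nth_rewrite 1 [hx]
      rw [← map_smul, ← map_smul, ← map_add, ← map_sub, ← map_neg]
      congr 1
      ext t
      simp
      ring
  exact ⟨A₀, ContinuousLinearEquiv.ofBijective M (LinearMap.ker_eq_bot.2 hMinj)
    (LinearMap.range_eq_top.2 hMsurj), hA, hMapply⟩

/-! ### Estimates for the perturbed Pontryagin system and for the moment. -/

theorem norm_path_le {v : Path T} {C : ℝ} (hC : 0 ≤ C) (h : ∀ t, |v t| ≤ C) : ‖v‖ ≤ C :=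
  (ContinuousMap.norm_le _ hC).2 h

theorem norm_point_sub_le {x u η x' u' η' : Path T} {d : ℝ} (hx : ‖x - x'‖ ≤ d)
    (hu : ‖u - u'‖ ≤ d) (hη : ‖η - η'‖ ≤ d) (t : Time T) :
    ‖(((t : ℝ), x t, u t, η t) - ((t : ℝ), x' t, u' t, η' t) : ℝ × ℝ × ℝ × ℝ)‖ ≤ d := by
  have h1 := ((x - x').norm_coe_le_norm t).trans hx
  have h2 := ((u - u').norm_coe_le_norm t).trans hu
  have h3 := ((η - η').norm_coe_le_norm t).trans hη
  have h0 : 0 ≤ d := (norm_nonneg _).trans hx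
  simp only [Prod.mk_sub_mk, sub_self]
  exact max_le (by simpa using h0) (max_le h1 (max_le h2 h3))

theorem norm_superpose_sub_le {g : ℝ × ℝ × ℝ × ℝ → ℝ} (hg : ContinuousOn g (dom T)) {r : ℝ}
    (hr : 0 ≤ r) (hlip : ∀ z ∈ dom T, ∀ z' ∈ dom T, |g z' - g z| ≤ r * ‖z' - z‖)
    {x u η x' u' η' : Path T} {d : ℝ} (hx : ‖x - x'‖ ≤ d) (hu : ‖u - u'‖ ≤ d)
    (hη : ‖η - η'‖ ≤ d) : ‖superpose hg x u η - superpose hg x' u' η'‖ ≤ r * d := by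
  have h0 : 0 ≤ d := (norm_nonneg _).trans hx
  exact norm_path_le (by positivity) fun t => (hlip _ (mem_dom t _ _ _) _ (mem_dom t _ _ _)).trans
    (mul_le_mul_of_nonneg_left (norm_point_sub_le hx hu hη t) hr)

theorem norm_superpose_le {g : ℝ × ℝ × ℝ × ℝ → ℝ} (hg : ContinuousOn g (dom T)) {r : ℝ}
    (hr : 0 ≤ r) (hb : ∀ z ∈ dom T, |g z| ≤ r) (x u η : Path T) : ‖superpose hg x u η‖ ≤ r :=
  norm_path_le hr fun t => hb _ (mem_dom t _ _ _)

/-- The superposition operators attached to the data of a perturbed game, on triples and moments: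
a function together with its Lipschitz bounds. -/
structure SmallOperator (T δ : ℝ) where
  /-- the operator -/
  op : Triple T → Path T → Path T
  δ_nonneg : 0 ≤ δ
  norm_le : ∀ w η, ‖op w η‖ ≤ δ
  norm_sub_le : ∀ w w' η η', ‖op w η - op w' η'‖ ≤ δ * max ‖w - w'‖ ‖η - η'‖

theorem SmallOperator.continuous {δ : ℝ} (S : SmallOperator T δ) :
    Continuous fun z : Triple T × Path T => S.op z.1 z.2 := by
  refine (LipschitzWith.of_dist_le_mul (K := ⟨δ, S.δ_nonneg⟩) fun z z' => ?_).continuous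
  rw [dist_eq_norm, dist_eq_norm]
  exact S.norm_sub_le _ _ _ _

/-- The operator `(x, p, u), η ↦ g(t, x, u, η)`. -/
def smallOperator {g : ℝ × ℝ × ℝ × ℝ → ℝ} {δ : ℝ} (hg : ContinuousOn g (dom T)) (hδ : 0 ≤ δ)
    (hb : ∀ z ∈ dom T, |g z| ≤ δ) (hlip : ∀ z ∈ dom T, ∀ z' ∈ dom T, |g z' - g z| ≤ δ * ‖z' - z‖) :
    SmallOperator T δ where
  op w η := superpose hg w.1 w.2.2 η
  δ_nonneg := hδ
  norm_le _ _ := norm_superpose_le hg hδ hb _ _ _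
  norm_sub_le w w' _ _ := norm_superpose_sub_le hg hδ hlip
    ((norm_fst_le (w - w')).trans (le_max_left _ _))
    (((norm_snd_le (w - w').2).trans (norm_snd_le (w - w'))).trans (le_max_left _ _))
    (le_max_right _ _)

/-- Left-hand side of the perturbed Pontryagin system as an operator on triples. -/
def residual (κ : ℝ) {δ : ℝ} (f lx fx lu fu : SmallOperator T δ) (k : Triple T → ℝ) (a : ℝ)
    (w : Triple T) (η : Path T) : Triple T :=
  (w.1 - a • 1 - fwd T (w.2.2 + f.op w η),
    w.2.1 - k w • 1 - bwd T ((-2 : ℝ) • force.comp w.1 + (2 * κ) • (w.1 - η) +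
      (lx.op w η + w.2.1 * fx.op w η)),
    (2 : ℝ) • w.2.2 + w.2.1 + (lu.op w η + w.2.1 * fu.op w η))

theorem continuous_residual (κ : ℝ) {δ : ℝ} (f lx fx lu fu : SmallOperator T δ)
    {k : Triple T → ℝ} (hk : Continuous k) :
    Continuous fun z : ℝ × Triple T × Path T => residual κ f lx fx lu fu k z.1 z.2.1 z.2.2 := by
  have hop : ∀ S : SmallOperator T δ, Continuous fun z : ℝ × Triple T × Path T =>
      S.op z.2.1 z.2.2 := fun S => S.continuous.comp continuous_snd
  have hforce : Continuous fun z : ℝ × Triple T × Path T => force.comp z.2.1.1 :=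
    (ContinuousMap.continuous_postcomp force).comp (by fun_prop)
  have h1 := hop f
  have h2 := hop lx
  have h3 := hop fx
  have h4 := hop lu
  have h5 := hop fu
  have h6 : Continuous fun z : ℝ × Triple T × Path T => k z.2.1 := hk.comp (by fun_prop)
  unfold residual
  refine Continuous.prodMk ?_ (Continuous.prodMk ?_ ?_)
  · exact ((by fun_prop : Continuous fun z : ℝ × Triple T × Path T => z.2.1.1).sub
      (continuous_fst.smul continuous_const)).sub ((fwd T).continuous.comp (by fun_prop))
  · exact ((by fun_prop : Continuous fun z : ℝ × Triple T × Path T => z.2.1.2.1).sub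
      (h6.smul continuous_const)).sub ((bwd T).continuous.comp (by fun_prop))
  · fun_prop

/-- `p S(w)` varies little. -/
theorem norm_mul_op_sub_le {δ P : ℝ} (S : SmallOperator T δ) {w w' : Triple T} {η η' : Path T}
    (hP : ‖w.2.1‖ ≤ P) : ‖w.2.1 * S.op w η - w'.2.1 * S.op w' η'‖ ≤
      (P + 1) * δ * max ‖w - w'‖ ‖η - η'‖ := by
  have e : w.2.1 * S.op w η - w'.2.1 * S.op w' η' =
      w.2.1 * (S.op w η - S.op w' η') + (w.2.1 - w'.2.1) * S.op w' η' := by ring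
  have h1 : ‖w.2.1 - w'.2.1‖ ≤ max ‖w - w'‖ ‖η - η'‖ :=
    ((norm_fst_le (w - w').2).trans (norm_snd_le (w - w'))).trans (le_max_left _ _)
  have hδ := S.δ_nonneg
  have h2 : ‖w.2.1 * (S.op w η - S.op w' η')‖ ≤ P * (δ * max ‖w - w'‖ ‖η - η'‖) :=
    (norm_mul_le _ _).trans (mul_le_mul hP (S.norm_sub_le _ _ _ _) (norm_nonneg _)
      ((norm_nonneg _).trans hP))
  have h3 : ‖(w.2.1 - w'.2.1) * S.op w' η'‖ ≤ max ‖w - w'‖ ‖η - η'‖ * δ :=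
    (norm_mul_le _ _).trans (mul_le_mul h1 (S.norm_le _ _) (norm_nonneg _)
      ((norm_nonneg _).trans h1))
  rw [e]
  refine (norm_add_le _ _).trans ((add_le_add h2 h3).trans (le_of_eq ?_))
  ring

theorem norm_force_sub_sub_le {y x x' : Path T} {ε : ℝ} (hx : ‖x - y‖ ≤ ε) (hx' : ‖x' - y‖ ≤ ε) :
    ‖force.comp x - force.comp x' - stiffness.comp y * (x - x')‖ ≤ 12 * ε * ‖x - x'‖ := by
  have hε : 0 ≤ ε := (norm_nonneg _).trans hx
  refine norm_path_le (by positivity) fun t => ?_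
  refine (abs_force_sub_sub_le (((x - y).norm_coe_le_norm t).trans hx)
    (((x' - y).norm_coe_le_norm t).trans hx')).trans ?_
  exact mul_le_mul_of_nonneg_left ((x - x').norm_coe_le_norm t) (by positivity)

/-- The only nonlinearity of the unperturbed system is `force`, which contributes `24 T ε`; all else
is of size `δ`. The bound `P` enters because the costate multiplies the derivatives of `f`. -/
theorem norm_residual_sub_le (hT : 0 ≤ T) {κ δ ε P : ℝ} (f lx fx lu fu : SmallOperator T δ)
    {k : Triple T → ℝ} (hk : ∀ w w', |k w - k w'| ≤ δ * ‖w - w'‖) {y : Path T} {a : ℝ}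
    {w w' : Triple T} {η η' : Path T} (hw : ‖w.1 - y‖ ≤ ε) (hw' : ‖w'.1 - y‖ ≤ ε)
    (hP : ‖w.2.1‖ ≤ P) :
    ‖residual κ f lx fx lu fu k a w η - residual κ f lx fx lu fu k a w' η' -
      (linearized κ y (w - w') + momentInfluence κ (η - η'))‖ ≤
      (24 * T * ε + δ * ((1 + T) * (3 + P))) * max ‖w - w'‖ ‖η - η'‖ := by
  have hδ := f.δ_nonneg
  have hε : 0 ≤ ε := (norm_nonneg _).trans hw
  have hP0 : 0 ≤ P := (norm_nonneg _).trans hP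
  set d := max ‖w - w'‖ ‖η - η'‖ with hd
  have hd0 : 0 ≤ d := (norm_nonneg _).trans (le_max_left _ _)
  have hfwd : ∀ v : Path T, ‖fwd T v‖ ≤ T * ‖v‖ := fun v => by
    have := norm_fwd_le v
    rwa [len_eq hT] at this
  have hbwd : ∀ v : Path T, ‖bwd T v‖ ≤ T * ‖v‖ := fun v => by
    have := norm_bwd_le v
    rwa [len_eq hT] at this
  have e : residual κ f lx fx lu fu k a w η - residual κ f lx fx lu fu k a w' η' -
      (linearized κ y (w - w') + momentInfluence κ (η - η')) =
      (-fwd T (f.op w η - f.op w' η'),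
        -((k w - k w') • 1) - bwd T ((-2 : ℝ) • (force.comp w.1 - force.comp w'.1 -
          stiffness.comp y * (w.1 - w'.1)) + ((lx.op w η - lx.op w' η') +
            (w.2.1 * fx.op w η - w'.2.1 * fx.op w' η'))),
        (lu.op w η - lu.op w' η') + (w.2.1 * fu.op w η - w'.2.1 * fu.op w' η')) := by
    have h1 : linearized κ y (w - w') = (w.1 - w'.1 - fwd T (w.2.2 - w'.2.2),
      w.2.1 - w'.2.1 - bwd T (((2 * κ) • 1 - (2 : ℝ) • stiffness.comp y) * (w.1 - w'.1)),
      (2 : ℝ) • (w.2.2 - w'.2.2) + (w.2.1 - w'.2.1)) := rfl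
    rw [h1, momentInfluence_apply]
    unfold residual
    refine Prod.ext ?_ (Prod.ext ?_ ?_)
    · simp only [Prod.fst_sub, Prod.fst_add, map_add, map_sub]
      abel
    · simp only [Prod.fst_sub, Prod.fst_add, Prod.snd_sub, Prod.snd_add, sub_mul, smul_mul_assoc,
        one_mul, map_add, map_sub, map_smul]
      module
    · simp only [Prod.snd_sub, Prod.snd_add]
      module
  rw [e]
  have hwd : ‖w - w'‖ ≤ d := le_max_left _ _
  have hxd : ‖w.1 - w'.1‖ ≤ d := (norm_fst_le (w - w')).trans hwd
  have hTδ : 0 ≤ T * ε := by positivity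
  have h1T : 0 ≤ δ * T := by positivity
  have hδP : 0 ≤ δ * P := by positivity
  have hδTP : 0 ≤ δ * T * P := by positivity
  have hop : ∀ S : SmallOperator T δ, ‖S.op w η - S.op w' η'‖ ≤ δ * d := fun S =>
    S.norm_sub_le _ _ _ _
  have hmul : ∀ S : SmallOperator T δ, ‖w.2.1 * S.op w η - w'.2.1 * S.op w' η'‖ ≤ (P + 1) * δ * d :=
    fun S => norm_mul_op_sub_le S hP
  refine max_le ?_ (max_le ?_ ?_)
  · rw [norm_neg]
    refine (hfwd _).trans ((mul_le_mul_of_nonneg_left (hop f) hT).trans ?_)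
    rw [← mul_assoc]
    exact mul_le_mul_of_nonneg_right (by nlinarith) hd0
  · have h1 : ‖-((k w - k w') • (1 : Path T))‖ ≤ δ * d := by
      rw [norm_neg, norm_smul, Real.norm_eq_abs]
      refine (mul_le_of_le_one_right (abs_nonneg _) norm_one_le).trans ((hk w w').trans ?_)
      exact mul_le_mul_of_nonneg_left hwd hδ
    have h2 : ‖(-2 : ℝ) • (force.comp w.1 - force.comp w'.1 -
        stiffness.comp y * (w.1 - w'.1))‖ ≤ 24 * ε * d := by
      rw [norm_smul, Real.norm_eq_abs, abs_neg, abs_two]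
      have h3 := (norm_force_sub_sub_le hw hw').trans
        (mul_le_mul_of_nonneg_left hxd (by positivity : 0 ≤ 12 * ε))
      linarith
    have h3 := (norm_add_le _ _).trans (add_le_add h2
      ((norm_add_le _ _).trans (add_le_add (hop lx) (hmul fx))))
    refine (norm_sub_le _ _).trans ((add_le_add h1 ((hbwd _).trans
      (mul_le_mul_of_nonneg_left h3 hT))).trans ?_)
    have : δ * d + T * (24 * ε * d + (δ * d + (P + 1) * δ * d)) =
        (δ + T * (24 * ε + (δ + (P + 1) * δ))) * d := by ring
    rw [this]
    exact mul_le_mul_of_nonneg_right (by nlinarith) hd0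
  · refine (norm_add_le _ _).trans ((add_le_add (hop lu) (hmul fu)).trans ?_)
    rw [← add_mul]
    exact mul_le_mul_of_nonneg_right (by nlinarith) hd0

/-- The triple `(y, -2y', y')` solves the unperturbed system exactly, so only perturbation terms
remain. -/
theorem norm_residual_le (hT : 0 ≤ T) {κ δ P : ℝ} (f lx fx lu fu : SmallOperator T δ)
    {k : Triple T → ℝ} (hk : ∀ w, |k w| ≤ δ) {y : Path T} (hy : y = green T (force.comp y))
    {a : ℝ} (ha : |a| ≤ δ) (hP : ‖(-2 : ℝ) • bwd T (force.comp y)‖ ≤ P) :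
    ‖residual κ f lx fx lu fu k a (y, (-2 : ℝ) • bwd T (force.comp y), bwd T (force.comp y)) y‖ ≤
      δ * ((1 + T) * (3 + P)) := by
  have hδ := f.δ_nonneg
  have hP0 : 0 ≤ P := (norm_nonneg _).trans hP
  set u := bwd T (force.comp y) with hu
  set p := (-2 : ℝ) • u with hp
  set w : Triple T := (y, p, u) with hw
  have e : residual κ f lx fx lu fu k a w y =
      (-(a • 1) - fwd T (f.op w y), -(k w • 1) - bwd T (lx.op w y + p * fx.op w y),
        lu.op w y + p * fu.op w y) := by
    unfold residual
    refine Prod.ext ?_ (Prod.ext ?_ ?_)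
    · have h1 : fwd T u = y := hy.symm
      simp only [hw, map_add, h1]
      abel
    · simp only [hw, hp, map_add, map_smul, sub_self, ← hu, map_zero]
      module
    · simp only [hw, hp]
      module
  rw [e]
  have hfwd : ∀ v : Path T, ‖fwd T v‖ ≤ T * ‖v‖ := fun v => by
    have := norm_fwd_le v
    rwa [len_eq hT] at this
  have hbwd : ∀ v : Path T, ‖bwd T v‖ ≤ T * ‖v‖ := fun v => by
    have := norm_bwd_le v
    rwa [len_eq hT] at this
  have hc : ∀ c : ℝ, |c| ≤ δ → ‖-(c • (1 : Path T))‖ ≤ δ := fun c hc => by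
    rw [norm_neg, norm_smul, Real.norm_eq_abs]
    exact (mul_le_of_le_one_right (abs_nonneg _) norm_one_le).trans hc
  have hmul : ∀ S : SmallOperator T δ, ‖p * S.op w y‖ ≤ P * δ := fun S =>
    (norm_mul_le _ _).trans (mul_le_mul hP (S.norm_le _ _) (norm_nonneg _) hP0)
  have h1T : 0 ≤ δ * T := by positivity
  have hδP : 0 ≤ δ * P := by positivity
  have hδTP : 0 ≤ δ * T * P := by positivity
  refine max_le ?_ (max_le ?_ ?_)
  · refine (norm_sub_le _ _).trans ((add_le_add (hc a ha) ((hfwd _).trans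
      (mul_le_mul_of_nonneg_left (f.norm_le _ _) hT))).trans ?_)
    nlinarith
  · refine (norm_sub_le _ _).trans ((add_le_add (hc _ (hk w)) ((hbwd _).trans
      (mul_le_mul_of_nonneg_left ((norm_add_le _ _).trans
        (add_le_add (lx.norm_le _ _) (hmul fx))) hT))).trans ?_)
    nlinarith
  · refine (norm_add_le _ _).trans ((add_le_add (lu.norm_le _ _) (hmul fu)).trans ?_)
    nlinarith

/-- The operator `x ↦ φ(t, x(t))` for `φ` a small perturbation of `(t, x) ↦ x`. -/
def momentMap {φ : ℝ × ℝ → ℝ} (hφ : ContinuousOn φ (domφ T)) (x : Path T) : Path T :=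
  x + ⟨fun t => φ (t, x t), hφ.comp_continuous (by fun_prop) fun t => mem_domφ t _⟩

theorem norm_momentMap_sub_sub_le {φ : ℝ × ℝ → ℝ} (hφ : ContinuousOn φ (domφ T)) {r : ℝ}
    (hr : 0 ≤ r) (hlip : ∀ z ∈ domφ T, ∀ z' ∈ domφ T, |φ z' - φ z| ≤ r * ‖z' - z‖)
    (x x' : Path T) : ‖momentMap hφ x - momentMap hφ x' - (x - x')‖ ≤ r * ‖x - x'‖ := by
  refine norm_path_le (by positivity) fun t => ?_
  have e : (momentMap hφ x - momentMap hφ x' - (x - x')) t = φ (t, x t) - φ (t, x' t) := by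
    simp [momentMap]
    ring
  rw [e]
  refine (hlip _ (mem_domφ t _) _ (mem_domφ t _)).trans (mul_le_mul_of_nonneg_left ?_ hr)
  simp only [Prod.mk_sub_mk, sub_self]
  exact max_le (by simp) ((x - x').norm_coe_le_norm t)

theorem continuous_momentMap {φ : ℝ × ℝ → ℝ} (hφ : ContinuousOn φ (domφ T)) {r : ℝ}
    (hr : 0 ≤ r) (hlip : ∀ z ∈ domφ T, ∀ z' ∈ domφ T, |φ z' - φ z| ≤ r * ‖z' - z‖) :
    Continuous (momentMap hφ) := by
  refine (LipschitzWith.of_dist_le_mul (K := ⟨r + 1, by positivity⟩) fun x x' => ?_).continuous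
  rw [dist_eq_norm, dist_eq_norm]
  have h := norm_momentMap_sub_sub_le hφ hr hlip x x'
  have h2 := norm_add_le (momentMap hφ x - momentMap hφ x' - (x - x')) (x - x')
  rw [sub_add_cancel] at h2
  refine h2.trans ((add_le_add_left h _).trans (le_of_eq ?_))
  change r * ‖x - x'‖ + ‖x - x'‖ = (r + 1) * ‖x - x'‖
  ring

/-! ### Structural stability. -/

/-- Smallness conditions on the size `δ` of the perturbation. -/
theorem exists_small_parameters {T κ K P ε₀ : ℝ} (hT : 0 < T) (hκ : 1 < κ) (hK : 0 < K)
    (hε₀ : 0 < ε₀) : ∃ ε > 0, ε < ε₀ ∧ ε ≤ 1 ∧ ∃ δ > 0, δ ≤ 1 ∧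
      K * (24 * T * ε + δ * ((1 + T) * (3 + P))) ≤ 1 / 2 ∧
      2 * K * (δ * ((1 + T) * (3 + P))) ≤ ε ∧
      δ * (1 + P + 8 * T) ≤ 1 / 2 ∧ δ * (1 + P + 8 * T) ≤ (κ - 1) / 2 := by
  obtain ⟨ε, hε, h1, h2, h3⟩ : ∃ ε > 0, ε < ε₀ ∧ ε ≤ 1 ∧ K * (24 * T * ε) ≤ 1 / 4 := by
    refine ⟨min (ε₀ / 2) (min 1 (1 / (96 * T * K))), by positivity, ?_, ?_, ?_⟩
    · exact (min_le_left _ _).trans_lt (half_lt_self hε₀)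
    · exact (min_le_right _ _).trans (min_le_left _ _)
    · have : min (ε₀ / 2) (min 1 (1 / (96 * T * K))) ≤ 1 / (96 * T * K) :=
        (min_le_right _ _).trans (min_le_right _ _)
      rw [le_div_iff₀ (by positivity)] at this
      linarith
  have hlim : ∀ A B : ℝ, 0 < B → ∀ᶠ δ in nhdsWithin (0 : ℝ) (Ioi 0), A * δ ≤ B := fun A B hB => by
    have hc : Filter.Tendsto (fun δ : ℝ => A * δ) (nhdsWithin 0 (Ioi 0)) (nhds (A * 0)) :=
      (continuous_const.mul continuous_id).continuousWithinAt
    rw [mul_zero] at hc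
    exact (hc.eventually (gt_mem_nhds hB)).mono fun _ h => h.le
  obtain ⟨δ, hδ, g1, g2, g3, g4, g5⟩ := ((eventually_mem_nhdsWithin (a := (0 : ℝ))
    (s := Ioi 0)).and ((hlim 1 1 one_pos).and ((hlim (K * ((1 + T) * (3 + P))) (1 / 4)
      (by norm_num)).and ((hlim (2 * K * ((1 + T) * (3 + P))) ε hε).and
      ((hlim (1 + P + 8 * T) (1 / 2) (by norm_num)).and
        (hlim (1 + P + 8 * T) ((κ - 1) / 2) (by linarith))))))).exists
  exact ⟨ε, hε, h1, h2, δ, hδ, by linarith, by linarith, by linarith, by linarith, by linarith⟩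

/-- Nondegenerate equilibria are structurally stable. -/
theorem isStructurallyStable_of_nondegenerate (hT : 0 < T) {κ : ℝ} (hκ : 1 < κ) {y : Path T}
    (hy : y = green T (force.comp y))
    (hnd : ∀ x : Path T, x = green T (stiffness.comp y * x) → x = 0) :
    (barycenterGame κ T hT.le).IsStructurallyStable fun _ => y := by
  intro ε₀ hε₀
  obtain ⟨A₀, M, hA₀, hM⟩ := exists_linearized_equiv hT.le hκ hnd
  obtain ⟨K, hK, hsolve⟩ := exists_coupled_solution A₀ (momentInfluence κ)
    (ContinuousLinearMap.fst ℝ (Path T) (Path T × Path T)) M hM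
  set u₀ := bwd T (force.comp y) with hu₀
  set p₀ := (-2 : ℝ) • u₀ with hp₀
  obtain ⟨ε, hε, hεε₀, hε1, δ, hδ, hδ1, hc, hb, hopt1, hopt2⟩ :=
    -- Since `ε ≤ 1`, every costate in the `ε`-ball about `p₀` is bounded by `‖p₀‖ + 1`.
    exists_small_parameters (P := ‖p₀‖ + 1) hT hκ hK hε₀
  refine ⟨δ, hδ, fun G hnear => ?_⟩
  obtain ⟨Df, Dl, Dψ, Dφ, hG⟩ := hnear.exists_isPerturbation hT
  have hδ0 := hδ.le
  set f := smallOperator hG.f.continuousOn hδ0 hG.f.abs_le hG.f.abs_sub_le with hf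
  set lx := smallOperator (hG.L.continuousOn_apply dirX) hδ0 (hG.L.abs_apply_le norm_dirX)
    (hG.L.abs_apply_sub_le norm_dirX) with hlx
  set fx := smallOperator (hG.f.continuousOn_apply dirX) hδ0 (hG.f.abs_apply_le norm_dirX)
    (hG.f.abs_apply_sub_le norm_dirX) with hfx
  set lu := smallOperator (hG.L.continuousOn_apply dirU) hδ0 (hG.L.abs_apply_le norm_dirU)
    (hG.L.abs_apply_sub_le norm_dirU) with hlu
  set fu := smallOperator (hG.f.continuousOn_apply dirU) hδ0 (hG.f.abs_apply_le norm_dirU)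
    (hG.f.abs_apply_sub_le norm_dirU) with hfu
  set k : Triple T → ℝ := fun w => Dψ (w.1 (t₁ hT.le)) 1 with hk
  have hk1 : ∀ w, |k w| ≤ δ := fun w => hG.ψ.abs_apply_le (by simp) _ trivial
  have hk2 : ∀ w w', |k w - k w'| ≤ δ * ‖w - w'‖ := fun w w' =>
    (hG.ψ.abs_apply_sub_le (v := (1 : ℝ)) (by simp) (w'.1 (t₁ hT.le)) trivial
      (w.1 (t₁ hT.le)) trivial).trans
      (mul_le_mul_of_nonneg_left (((w.1 - w'.1).norm_coe_le_norm (t₁ hT.le)).trans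
        (norm_fst_le (w - w'))) hδ0)
  have hkc : Continuous k :=
    (LipschitzWith.of_dist_le_mul (K := ⟨δ, hδ0⟩) fun w w' => by
      rw [dist_eq_norm, dist_eq_norm]; exact hk2 w w').continuous
  have hx0 : ∀ᵐ ξ : Player, G.xinit ξ ∈ Icc (-δ) δ := by
    have h1 := hnear.xinit_near
    rw [eLpNorm_exponent_top] at h1
    filter_upwards [ae_lt_of_essSup_lt h1] with ξ hξ
    have h2 : ‖G.xinit ξ‖ₑ < ENNReal.ofReal δ := by simpa [barycenterGame] using hξ
    rw [← ofReal_norm, ENNReal.ofReal_lt_ofReal_iff hδ, Real.norm_eq_abs] at h2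
    exact abs_le.1 h2.le
  have hδδ : -δ ≤ δ := by linarith
  -- A player matters only through the initial point, so the unknown is a continuous function on a
  -- compact interval. The projection changes `xinit` only on a null set.
  set π : Player → Icc (-δ) δ := fun ξ => projIcc (-δ) δ hδδ (G.xinit ξ) with hπ
  have hπm : AEStronglyMeasurable π volume :=
    continuous_projIcc.comp_aestronglyMeasurable hnear.xinit_measurable.aestronglyMeasurable
  set φ : Triple T → Path T := fun w => momentMap hG.φ.continuousOn w.1 with hφ
  have hφc : Continuous φ :=
    (continuous_momentMap hG.φ.continuousOn hδ0 hG.φ.abs_sub_le).comp continuous_fst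
  have hP1 : 1 ≤ (1 + T) * (3 + (‖p₀‖ + 1)) := by
    nlinarith [norm_nonneg p₀, mul_nonneg hT.le (norm_nonneg p₀)]
  have hδC : δ ≤ δ * ((1 + T) * (3 + (‖p₀‖ + 1))) := le_mul_of_one_le_right hδ0 hP1
  obtain ⟨w, η, hw, hη, hwε, -⟩ := hsolve (A := Icc (-δ) δ) (Ω := Player) hπm
    (F := fun a => residual κ f lx fx lu fu k (a : ℝ))
    ((continuous_residual κ f lx fx lu fu hkc).comp
      ((continuous_subtype_val.comp continuous_fst).prodMk continuous_snd))
    hφc (w₀ := (y, p₀, u₀)) (η₀ := y) hε.le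
    (fun a w w' η η' h1 h2 _ _ => by
      rw [hA₀]
      refine norm_residual_sub_le hT.le f lx fx lu fu hk2
        ((norm_fst_le (w - (y, p₀, u₀))).trans h1) ((norm_fst_le (w' - (y, p₀, u₀))).trans h2) ?_
      have h3 : ‖w.2.1 - p₀‖ ≤ 1 := (((norm_fst_le (w - (y, p₀, u₀)).2).trans
        (norm_snd_le (w - (y, p₀, u₀)))).trans h1).trans hε1
      linarith [norm_sub_norm_le w.2.1 p₀])
    (fun a => norm_residual_le hT.le f lx fx lu fu hk1 hy (abs_le.2 a.2) (by linarith))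
    (fun w w' _ _ => by
      refine (norm_momentMap_sub_sub_le hG.φ.continuousOn hδ0 hG.φ.abs_sub_le w.1 w'.1).trans ?_
      refine mul_le_mul ?_ (norm_fst_le (w - w')) (norm_nonneg _) (by positivity)
      exact hδC.trans (le_add_of_nonneg_left (by positivity)))
    (by
      refine le_trans ?_ hδC
      refine norm_path_le hδ0 fun t => ?_
      have h1 := hG.φ.abs_le _ (mem_domφ t (y t))
      have e : (y - φ (y, p₀, u₀)) t = -(G.φ t (y t) - y t) := by simp [hφ, momentMap]
      rw [e, abs_neg]
      exact h1)
    (by positivity) hc hb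
  set x : Player → Path T := fun ξ => (w (π ξ)).1 with hx
  have hφapply : ∀ (w : Triple T) (t : Time T), φ w t = G.φ t (w.1 t) := fun w t => by
    simp [hφ, momentMap]
  have hwint := integrable_comp hπm w
  have hφint := integrable_comp hπm ((⟨φ, hφc⟩ : C(Triple T, Path T)).comp w)
  refine ⟨x, ⟨hwint.fst, fun ξ => (w (π ξ)).2.2, η, fun t => ?_, ?_⟩, ?_⟩
  · have h1 := (ContinuousMap.evalCLM ℝ t).integrable_comp hφint
    have h2 := (ContinuousMap.evalCLM ℝ t).integral_comp_comm hφint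
    have h3 : ∀ ξ, ContinuousMap.evalCLM ℝ t (((⟨φ, hφc⟩ : C(Triple T, Path T)).comp w) (π ξ)) =
        G.φ t (x ξ t) := fun ξ => hφapply _ t
    simp only [h3] at h1 h2
    refine ⟨h1, ?_⟩
    rw [h2, hη]
    rfl
  · filter_upwards [hx0] with ξ hξ
    have ha : ((π ξ : Icc (-δ) δ) : ℝ) = G.xinit ξ := by
      simp only [hπ, projIcc_of_mem hδδ hξ]
    obtain ⟨⟨x', p, u⟩, hz⟩ : ∃ z, w (π ξ) = z := ⟨_, rfl⟩
    have h0 := hw (π ξ)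
    have hnorm := hwε (π ξ)
    rw [ha, hz] at h0
    rw [hz] at hnorm
    simp only [hx, hz]
    have hp : ‖p‖ ≤ ‖p₀‖ + 1 := by
      have h3 : ‖p - p₀‖ ≤ 1 := (((norm_fst_le ((x', p, u) - (y, p₀, u₀) : Triple T).2).trans
        (norm_snd_le ((x', p, u) - (y, p₀, u₀) : Triple T))).trans hnorm).trans hε1
      linarith [norm_sub_norm_le p p₀]
    have hext : IsExtremal κ G Df Dl Dψ η (G.xinit ξ) x' p u
        ((-2 : ℝ) • force.comp x' + (2 * κ) • (x' - η) +
          (lx.op (x', p, u) η + p * fx.op (x', p, u) η)) := by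
      have e1 := congrArg (fun z : Triple T => z.1) h0
      have e2 := congrArg (fun z : Triple T => z.2.1) h0
      have e3 := congrArg (fun z : Triple T => z.2.2) h0
      refine ⟨fun t => ?_, fun t => ?_, fun t => ?_, fun t => ?_⟩
      · have e4 : x' = G.xinit ξ • 1 + fwd T (u + f.op (x', p, u) η) := by
          rw [← sub_eq_zero, ← sub_sub]; exact e1
        have e5 := congrArg (fun v : Path T => v t) e4
        refine e5.trans ?_
        have e6 : ∀ s : Time T, (u + f.op (x', p, u) η) s = G.f s (x' s) (u s) (η s) := fun s => by
          change u s + (G.f s (x' s) (u s) (η s) - u s) = _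
          ring
        simp only [ContinuousMap.add_apply, ContinuousMap.smul_apply, ContinuousMap.one_apply,
          smul_eq_mul, mul_one, fwd_apply, ← e6]
      · rfl
      · have e4 : p = k (x', p, u) • 1 + bwd T ((-2 : ℝ) • force.comp x' + (2 * κ) • (x' - η) +
            (lx.op (x', p, u) η + p * fx.op (x', p, u) η)) := by
          rw [← sub_eq_zero, ← sub_sub]; exact e2
        have e5 := congrArg (fun v : Path T => v t) e4
        refine e5.trans ?_
        rw [ContinuousMap.add_apply, ContinuousMap.smul_apply, ContinuousMap.one_apply,
          smul_eq_mul, mul_one]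
      · exact congrArg (fun v : Path T => v t) e3
    exact hext.isOptimal hT hκ hG (fun t => (abs_apply_le_norm p t).trans hp) hδ1 hopt1 hopt2
  · have : Nonempty (Time T) := ⟨t₁ hT.le⟩
    refine lt_of_le_of_lt (ciSup_le fun t => ?_) hεε₀
    have h1 : ∀ ξ, ‖|x ξ t - y t|‖ ≤ ε := fun ξ => by
      rw [Real.norm_eq_abs, abs_abs]
      exact ((x ξ - y).norm_coe_le_norm t).trans
        ((norm_fst_le (w (π ξ) - (y, p₀, u₀))).trans (hwε (π ξ)))
    have h2 := norm_integral_le_of_norm_le_const (μ := (volume : Measure Player))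
      (Filter.Eventually.of_forall h1)
    rw [probReal_univ, mul_one] at h2
    exact (le_abs_self _).trans h2

theorem stiffness_zero : stiffness 0 = 1 := by simp [stiffness_apply]

theorem zero_nondegenerate (hT : 0 ≤ T) (hcos : Real.cos T ≠ 0) (x : Path T)
    (hx : x = green T (stiffness.comp (0 : Path T) * x)) : x = 0 := by
  have : stiffness.comp (0 : Path T) = 1 := ContinuousMap.ext fun _ => stiffness_zero
  rw [this, one_mul] at hx
  exact eq_zero_of_eq_green hT hcos hx

theorem cos_ne_zero_of_ne (hT : 0 < T)
    (h : ∀ n : ℕ, 1 ≤ n → T ≠ (2 * (n : ℝ) - 1) * Real.pi / 2) : Real.cos T ≠ 0 := by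
  rw [Real.cos_ne_zero_iff]
  intro k hk
  have hk0 : 0 ≤ k := by
    by_contra! hlt
    have h1 : (k : ℝ) ≤ -1 := by exact_mod_cast Int.le_sub_one_of_lt hlt
    nlinarith [Real.pi_pos]
  obtain ⟨m, rfl⟩ := Int.eq_ofNat_of_zero_le hk0
  -- `cos` vanishes at `(2m + 1)π/2` with `m ≥ 0`, which is `(2n - 1)π/2` for `n = m + 1`.
  refine h (m + 1) (by omega) ?_
  rw [hk]
  push_cast
  ring

theorem neg_equilibrium {y : Path T} (hy : y = green T (force.comp y)) :
    -y = green T (force.comp (-y)) := by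
  have : force.comp (-y) = -force.comp y := ContinuousMap.ext fun t => force_neg (y t)
  rw [this, map_neg, ← hy]

theorem stiffness_comp_neg (y : Path T) : stiffness.comp (-y) = stiffness.comp y := by
  ext t
  simp [stiffness_apply]

end MFG

end

theorem mainTheorem4 (κ T : ℝ) (hκ : 1 < κ) (hT : 2 < T) :
    ∃ y₁ : MFG.Path T, StrictMono y₁ ∧
      -- three solutions, independent of the player
      (MFG.barycenterGame κ T (zero_le_two.trans hT.le)).IsSolution (fun _ => 0) ∧
      (MFG.barycenterGame κ T (zero_le_two.trans hT.le)).IsSolution (fun _ => y₁) ∧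
      (MFG.barycenterGame κ T (zero_le_two.trans hT.le)).IsSolution (fun _ => -y₁) ∧
      -- the zero solution
      ¬ (MFG.barycenterGame κ T (zero_le_two.trans hT.le)).IsStable (fun _ => 0) ∧
      ((∀ n : ℕ, 1 ≤ n → T ≠ (2 * (n : ℝ) - 1) * Real.pi / 2) →
        (MFG.barycenterGame κ T (zero_le_two.trans hT.le)).IsStructurallyStable (fun _ => 0)) ∧
      -- the two nonzero solutions
      (MFG.barycenterGame κ T (zero_le_two.trans hT.le)).IsStable (fun _ => y₁) ∧
      (MFG.barycenterGame κ T (zero_le_two.trans hT.le)).IsStable (fun _ => -y₁) ∧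
      (MFG.barycenterGame κ T (zero_le_two.trans hT.le)).IsStructurallyStable (fun _ => y₁) ∧
      (MFG.barycenterGame κ T (zero_le_two.trans hT.le)).IsStructurallyStable (fun _ => -y₁) := by
  have hT0 : 0 < T := by linarith
  obtain ⟨y, hy, hlow⟩ := MFG.exists_positive_equilibrium hT
  have hpos : MFG.IsPositiveEquilibrium y := ⟨hy, hlow⟩
  have h0 : (0 : MFG.Path T) = MFG.green T (MFG.force.comp 0) := by
    have : MFG.force.comp (0 : MFG.Path T) = 0 := ContinuousMap.ext fun _ => MFG.force_zero
    rw [this, map_zero]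
  exact ⟨y, hpos.strictMono hT, MFG.barycenterGame.isSolution hT0 hκ h0,
    MFG.barycenterGame.isSolution hT0 hκ hy,
    MFG.barycenterGame.isSolution hT0 hκ (MFG.neg_equilibrium hy),
    MFG.barycenterGame.not_isStable_zero hT hκ _,
    fun hn => MFG.isStructurallyStable_of_nondegenerate hT0 hκ h0
      (MFG.zero_nondegenerate hT0.le (MFG.cos_ne_zero_of_ne hT0 hn)),
    MFG.barycenterGame.isStable hT hκ hpos _, MFG.barycenterGame.isStable_neg hT hκ hpos _,
    MFG.isStructurallyStable_of_nondegenerate hT0 hκ hy fun x hx => hpos.nondegenerate hT hx,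
    MFG.isStructurallyStable_of_nondegenerate hT0 hκ (MFG.neg_equilibrium hy) fun x hx =>
      hpos.nondegenerate hT (by rwa [MFG.stiffness_comp_neg] at hx)⟩
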